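/- **Setting.** Let $\mathcal H$ be a complex Hilbert space, let $\Xi$ be the real vector space of self-adjoint trace-class operators on $\mathcal H$ with trace $0$, let $\rho_0$ be a density operator, and let $\theta\in\Xi$ be such that $\rho=\rho(\theta):=\rho_0+\theta$ is strictly positive, i.e. $(x,\rho x)>0$ for all $x\ne0$. Let $A,B$ be (possibly unbounded) self-adjoint operators such that $A^2$ and $B^2$ have finite expectation in $\rho$, in the sense that $A\rho^{1/2}$ and $B\rho^{1/2}$ are Hilbert–Schmidt; then $AB$ has a finite expectation too. For $X,Y\in\{A,B\}$ put $\langle X\rangle_\theta=\operatorname{Tr}[\rho X]$, $\langle XY\rangle_\theta=\operatorname{Tr}[\rho XY]:=\operatorname{Tr}[(X\rho^{1/2})^*(Y\rho^{1/2})]$, $\langle[A,B]\rangle_\theta=\langle AB\rangle_\theta-\langle BA\rangle_\theta$, $C_\theta(X,Y)=\langle XY\rangle_\theta-\langle X\rangle_\theta\langle Y\rangle_\theta$, $C^{S}_\theta(A,B)=\tfrac12\{C_\theta(A,B)+C_\theta(B,A)\}$ and $\sigma^2_\theta(X)=C_\theta(X,X)$. **Fisher information.** For a state $\sigma$ and a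 direction $\varphi$, the SLD Fisher information is $(\varphi,J^S_\sigma\varphi)=\operatorname{Tr}[L\sigma L]=\|L\sigma^{1/2}\|_{HS}^2$, where $L$ is the symmetric operator (determined on the support of $\sigma$) with $\varphi=\tfrac12(L\sigma+\sigma L)$; it is $+\infty$ if there is no such $L$ with $L\sigma^{1/2}$ Hilbert–Schmidt. For a POVM $M$ the Fisher information is $(\varphi,J^M_\theta\varphi)=\int l_\varphi^2\,dP$, where $P(\cdot)=\operatorname{Tr}[\rho M(\cdot)]$ and $l_\varphi$ is the Radon–Nikodým derivative of the signed measure $\operatorname{Tr}[\varphi M(\cdot)]$ with respect to $P$. Admissible directions are the $\varphi\in\Xi$ with $(\varphi,J^S_\rho\varphi)<\infty$ (all of $\Xi$ if $\dim\mathcal H<\infty$). The gradient of $\langle X\rangle_\theta$ is given by $(\nabla_\theta\langle X\rangle_\theta,\varphi)=\operatorname{Tr}[\varphi X]$ for those admissible $\varphi$ with $X\varphi$ trace class. For such a Fisher information operator $J$ with Moore–Penrose inverse $J^+$ and such a gradient $g$, the quadratic form of $J^+$ is understood as $$(g,J^+g)=\sup_\varphi\{2(g,\varphi)-(\varphi,J\varphi)\}\in[0,\infty],$$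 the supremum being over the admissible $\varphi$ for which $(g,\varphi)$ is defined; this is the usual value if $J^+$ exists and $g\in(\ker J)^\perp$, and $+\infty$ if $g\notin(\ker J)^\perp$. Further, $(g,J^+h)$ is defined by polarization, $\tfrac14\{(g+h,J^+(g+h))-(g-h,J^+(g-h))\}$, when $(g,J^+g)$ and $(h,J^+h)$ are finite. **Error and disturbance.** For a POVM $M$ let $$\varepsilon(A;\rho(\theta),M)=(\nabla_\theta\langle A\rangle_\theta,(J^M_\theta)^+\nabla_\theta\langle A\rangle_\theta)-\sigma^2_\theta(A)\in(-\infty,\infty],$$ $$\mathcal R_M(A,B)=(\nabla_\theta\langle A\rangle_\theta,(J^M_\theta)^+\nabla_\theta\langle B\rangle_\theta)-C^S_\theta(A,B).$$ Let $\mathcal I$ be a CP-instrument on $\mathbb R$, i.e. a countably additive family of completely positive maps $\mathcal I(X)$, $X\subseteq\mathbb R$ Borel, on the trace-class operators such that $\mathcal I(\mathbb R)$ preserves the trace. Put $\varepsilon(A;\rho(\theta),\mathcal I)=\varepsilon(A;\rho(\theta),\mathcal I(\cdot)^*(1))$ and $\eta(B;\rho(\theta),\mathcal I)=(\nabla_\theta\langle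 B\rangle_\theta,(J^S_{\mathcal I(\mathbb R)\circ\rho(\theta)})^+\nabla_\theta\langle B\rangle_\theta)-\sigma_\theta^2(B)$, where $(\varphi,J^S_{\mathcal I(\mathbb R)\circ\rho(\theta)}\varphi)$ is the SLD Fisher information of the state $\mathcal I(\mathbb R)(\rho)$ in the direction $\mathcal I(\mathbb R)(\varphi)$. **Theorem (error–disturbance inequality).** There is a POVM $M$ on $\mathbb R\times\mathbb R$ such that $\varepsilon(A;\rho(\theta),M)$ and $\varepsilon(B;\rho(\theta),M)$ are finite (so that $\mathcal R_M(A,B)$ is defined) and $$\varepsilon(A;\rho(\theta),\mathcal I)\,\eta(B;\rho(\theta),\mathcal I)\ \ge\ \mathcal R_M(A,B)^2+\tfrac14\big|\langle[A,B]\rangle_\theta\big|^2,$$ where the product on the left is $+\infty$ whenever one of its factors is (even if the other one is $0$). -/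

import Mathlib

open scoped ENNReal ComplexOrder InnerProductSpace
open MeasureTheory

noncomputable section

/-! ### The quadratic form of the Moore-Penrose inverse -/

/-- Let `q` be the quadratic form `φ ↦ (φ, J φ)` of a positive operator `J` (value `⊤` outside the
form domain) and let `α φ = (g, φ)` be a linear functional, both on the directions `φ ∈ D`.
Then `pinvForm D α q` is `(g, J⁺ g)`, the quadratic form of the Moore-Penrose inverse of `J`
evaluated at the gradient `g` of `α`, and `⊤` if `g` is not orthogonal to `ker J`
(see the two `pinvForm` lemmas below). The expression does not depend on the inner
product by which forms are turned into operators and functionals into vectors, and it also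
makes sense when `J⁺` is unbounded (it is then `⊤` exactly when `g` is not in the form domain of
`J⁺`). -/
def pinvForm {E : Type*} (D : Set E) (α : E → ℝ) (q : E → ℝ≥0∞) : EReal :=
  ⨆ φ ∈ D, ((2 * α φ : ℝ) : EReal) - ((q φ : ℝ≥0∞) : EReal)

/-- The bilinear form `(g, J⁺ h)` of the Moore-Penrose inverse, obtained from its quadratic form
by polarization. It is meaningful when the quadratic form is finite at both functionals. -/
def pinvPairing {E : Type*} (D : Set E) (α β : E → ℝ) (q : E → ℝ≥0∞) : ℝ :=
  ((pinvForm D (fun φ => α φ + β φ) q).toReal - (pinvForm D (fun φ => α φ - β φ) q).toReal) / 4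

/-- The four Penrose equations for linear operators on a real inner product space. -/
structure IsMoorePenrose {Ξ : Type*} [NormedAddCommGroup Ξ] [InnerProductSpace ℝ Ξ]
    (J Jp : Ξ →ₗ[ℝ] Ξ) : Prop where
  mul_mul_self : J ∘ₗ Jp ∘ₗ J = J
  self_mul_mul : Jp ∘ₗ J ∘ₗ Jp = Jp
  symm_left : (J ∘ₗ Jp).IsSymmetric
  symm_right : (Jp ∘ₗ J).IsSymmetric

theorem IsMoorePenrose.apply_apply {Ξ : Type*} [NormedAddCommGroup Ξ] [InnerProductSpace ℝ Ξ]
    {J Jp : Ξ →ₗ[ℝ] Ξ} (hJ : J.IsSymmetric) (h : IsMoorePenrose J Jp) {g : Ξ}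
    (hg : g ∈ (LinearMap.ker J)ᗮ) : J (Jp g) = g := by
  have hJJ : ∀ k, J (Jp (J k)) = J k := fun k => LinearMap.congr_fun h.mul_mul_self k
  set w := g - J (Jp g) with hw
  have hJw : J w = 0 := by
    apply ext_inner_right ℝ
    intro k
    rw [hJ w k, inner_zero_left, hw, inner_sub_left]
    have := h.symm_left g (J k)
    simp only [LinearMap.comp_apply, hJJ] at this
    linarith
  have h1 : ⟪w, g⟫_ℝ = 0 := hg w hJw
  have h2 : ⟪w, J (Jp g)⟫_ℝ = 0 := by rw [← hJ w (Jp g), hJw, inner_zero_left]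
  have h3 : ⟪w, w⟫_ℝ = 0 := by
    nth_rewrite 2 [hw]
    rw [inner_sub_right, h1, h2, sub_zero]
  have := inner_self_eq_zero.1 h3
  rw [hw, sub_eq_zero] at this
  exact this.symm

/-- If the Moore-Penrose inverse `Jp` exists and `g ⟂ ker J`, the form is `(g, Jp g)`. -/
theorem pinvForm_eq_of_isMoorePenrose {Ξ : Type*} [NormedAddCommGroup Ξ] [InnerProductSpace ℝ Ξ]
    {J Jp : Ξ →ₗ[ℝ] Ξ} (hJ : J.IsSymmetric) (hpos : ∀ φ, 0 ≤ ⟪φ, J φ⟫_ℝ)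
    (h : IsMoorePenrose J Jp) {g : Ξ} (hg : g ∈ (LinearMap.ker J)ᗮ) :
    pinvForm Set.univ (fun φ => ⟪g, φ⟫_ℝ) (fun φ => ENNReal.ofReal ⟪φ, J φ⟫_ℝ)
      = ((⟪g, Jp g⟫_ℝ : ℝ) : EReal) := by
  have hχ := h.apply_apply hJ hg
  have hc : ∀ φ : Ξ, ((2 * ⟪g, φ⟫_ℝ : ℝ) : EReal)
      - ((ENNReal.ofReal ⟪φ, J φ⟫_ℝ : ℝ≥0∞) : EReal)
      = ((2 * ⟪g, φ⟫_ℝ - ⟪φ, J φ⟫_ℝ : ℝ) : EReal) := by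
    intro φ
    rw [EReal.coe_ennreal_ofReal, max_eq_left (hpos φ), EReal.coe_sub]
  unfold pinvForm
  simp only [Set.mem_univ, iSup_pos, hc]
  apply le_antisymm
  · refine iSup_le fun φ => EReal.coe_le_coe_iff.2 ?_
    have h0 := hpos (φ - Jp g)
    have h1 : ⟪Jp g, J φ⟫_ℝ = ⟪g, φ⟫_ℝ := by rw [← hJ, hχ]
    have h2 : ⟪φ, g⟫_ℝ = ⟪g, φ⟫_ℝ := real_inner_comm _ _
    have h3 : ⟪Jp g, g⟫_ℝ = ⟪g, Jp g⟫_ℝ := real_inner_comm _ _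
    rw [map_sub, hχ, inner_sub_left, inner_sub_right, inner_sub_right, h1, h2, h3] at h0
    linarith
  · refine le_iSup_of_le (Jp g) (EReal.coe_le_coe_iff.2 ?_)
    rw [hχ, real_inner_comm g (Jp g)]
    linarith

/-- If the Moore-Penrose inverse `Jp` exists and `g, h ⟂ ker J`, the pairing is `(g, Jp h)`. -/
theorem pinvPairing_eq_of_isMoorePenrose {Ξ : Type*} [NormedAddCommGroup Ξ]
    [InnerProductSpace ℝ Ξ] {J Jp : Ξ →ₗ[ℝ] Ξ} (hJ : J.IsSymmetric)
    (hpos : ∀ φ, 0 ≤ ⟪φ, J φ⟫_ℝ) (hp : IsMoorePenrose J Jp) {g h : Ξ}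
    (hg : g ∈ (LinearMap.ker J)ᗮ) (hh : h ∈ (LinearMap.ker J)ᗮ) :
    pinvPairing Set.univ (fun φ => ⟪g, φ⟫_ℝ) (fun φ => ⟪h, φ⟫_ℝ)
      (fun φ => ENNReal.ofReal ⟪φ, J φ⟫_ℝ) = ⟪g, Jp h⟫_ℝ := by
  have hs : ⟪h, Jp g⟫_ℝ = ⟪g, Jp h⟫_ℝ := by
    nth_rewrite 1 [← hp.apply_apply hJ hh]
    rw [hJ, hp.apply_apply hJ hg, real_inner_comm]
  unfold pinvPairing
  simp only [← inner_add_left, ← inner_sub_left]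
  rw [pinvForm_eq_of_isMoorePenrose hJ hpos hp (Submodule.add_mem _ hg hh),
    pinvForm_eq_of_isMoorePenrose hJ hpos hp (Submodule.sub_mem _ hg hh), EReal.toReal_coe,
    EReal.toReal_coe, map_add, map_sub, inner_add_left, inner_sub_left, inner_add_right,
    inner_add_right, inner_sub_right, inner_sub_right, hs]
  ring

/-- If `g` is not orthogonal to `ker J`, the form is `⊤`. -/
theorem pinvForm_eq_top {Ξ : Type*} [NormedAddCommGroup Ξ] [InnerProductSpace ℝ Ξ]
    {J : Ξ →ₗ[ℝ] Ξ} {g : Ξ} (hg : g ∉ (LinearMap.ker J)ᗮ) :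
    pinvForm Set.univ (fun φ => ⟪g, φ⟫_ℝ) (fun φ => ENNReal.ofReal ⟪φ, J φ⟫_ℝ) = ⊤ := by
  obtain ⟨k, hk, hkg⟩ : ∃ k, J k = 0 ∧ ⟪k, g⟫_ℝ ≠ 0 := by
    by_contra hcon
    push Not at hcon
    exact hg fun k hk => hcon k hk
  rw [EReal.eq_top_iff_forall_lt]
  intro y
  have hgk : ⟪g, k⟫_ℝ ≠ 0 := by rwa [real_inner_comm]
  refine lt_of_lt_of_le (b := ((y + 1 : ℝ) : EReal)) (EReal.coe_lt_coe_iff.2 (by linarith)) ?_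
  refine le_iSup₂_of_le (((y + 1) / (2 * ⟪g, k⟫_ℝ)) • k) (Set.mem_univ _) ?_
  beta_reduce
  rw [map_smul, hk, smul_zero, inner_zero_right, ENNReal.ofReal_zero, EReal.coe_ennreal_zero,
    sub_zero, inner_smul_right]
  refine EReal.coe_le_coe_iff.2 (le_of_eq ?_)
  field_simp

namespace QM

variable {H : Type*} [NormedAddCommGroup H] [InnerProductSpace ℂ H] [CompleteSpace H]

/-! ### Hilbert-Schmidt and trace-class operators -/

variable (H) in
/-- The index set of a fixed orthonormal basis of `H`. -/
def basisIndex : Set H := (exists_hilbertBasis ℂ H).choose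

variable (H) in
/-- A fixed orthonormal basis of `H`; the notions below do not depend on it. -/
def onb : HilbertBasis (basisIndex H) ℂ H := (exists_hilbertBasis ℂ H).choose_spec.choose

/-- The squared Hilbert-Schmidt norm `Tr[T* T]`, possibly infinite. -/
def hsNormSq (T : H →L[ℂ] H) : ℝ≥0∞ := ∑' i, ENNReal.ofReal (‖T (onb H i)‖ ^ 2)

/-- The trace norm `Tr |T|` with `|T| = √(T* T)`, possibly infinite. -/
def traceNorm (T : H →L[ℂ] H) : ℝ≥0∞ :=
  ∑' i, ENNReal.ofReal (⟪onb H i, CFC.abs T (onb H i)⟫_ℂ).re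

def IsTraceClass (T : H →L[ℂ] H) : Prop := traceNorm T ≠ ⊤

/-- The trace of a trace-class operator. -/
def trace (T : H →L[ℂ] H) : ℂ := ∑' i, ⟪onb H i, T (onb H i)⟫_ℂ

/-! ### States and the parameter space -/

structure IsDensity (ρ : H →L[ℂ] H) : Prop where
  nonneg : 0 ≤ ρ
  isTraceClass : IsTraceClass ρ
  trace_eq_one : trace ρ = 1

/-- Strict positivity of an operator: `T ≥ 0` and `(x, T x) > 0` for all `x ≠ 0`. -/
def IsStrictlyPos (T : H →L[ℂ] H) : Prop := 0 ≤ T ∧ ∀ x, x ≠ 0 → 0 < (⟪x, T x⟫_ℂ).re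

variable (H) in
/-- The space `Ξ` of self-adjoint trace-class operators with trace zero. -/
def tracelessSpace : Set (H →L[ℂ] H) := {φ | IsSelfAdjoint φ ∧ IsTraceClass φ ∧ trace φ = 0}

/-- The parameter set `Θ` of the model `ρ(θ) = ρ₀ + θ`. -/
def parameterSet (ρ₀ : H →L[ℂ] H) : Set (H →L[ℂ] H) :=
  {θ | θ ∈ tracelessSpace H ∧ IsStrictlyPos (ρ₀ + θ)}

/-! ### The symmetric logarithmic derivative -/

/-- `L` is the symmetric logarithmic derivative of the state `σ` in the direction `φ`, that is,
`L` is symmetric and `φ = (L σ + σ L) / 2`. As `L` may be unbounded, it is represented by the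
bounded operator `T = L √σ`: then `L σ = T √σ`, `σ L = (L σ)* = √σ T*`, and `L` is symmetric iff
`√σ T = √σ L √σ` is self-adjoint. `T` vanishes on `ker σ` and is unique if it is
Hilbert-Schmidt. -/
structure IsSLD (σ φ T : H →L[ℂ] H) : Prop where
  ker_le : ∀ x, σ x = 0 → T x = 0
  symm : IsSelfAdjoint (CFC.sqrt σ * T)
  eq : φ = (2⁻¹ : ℂ) • (T * CFC.sqrt σ + CFC.sqrt σ * star T)

/-- The quadratic form `(φ, J^S φ) = Tr[L σ L] = ‖L √σ‖²_HS` of the SLD Fisher information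
operator at the state `σ` in the direction `φ`; it is `⊤` if there is no symmetric logarithmic
derivative of finite second moment. -/
def sldInfo (σ φ : H →L[ℂ] H) : ℝ≥0∞ := ⨅ (T : H →L[ℂ] H) (_ : IsSLD σ φ T), hsNormSq T

/-- The directions `φ ∈ Ξ` in which the model `ρ(θ) = ρ₀ + θ` has finite SLD Fisher information
at `ρ = ρ(θ)`: the directions for which the logarithmic derivatives of the model exist and have
finite second moments. This is all of `Ξ` if `H` is finite dimensional. -/
def directions (ρ : H →L[ℂ] H) : Set (H →L[ℂ] H) := {φ | φ ∈ tracelessSpace H ∧ sldInfo ρ φ ≠ ⊤}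

/-! ### Expectation values of unbounded observables -/

/-- `S` is the everywhere defined product `A T` of an unbounded operator and a bounded one. -/
def IsProd (A : H →ₗ.[ℂ] H) (T S : H →L[ℂ] H) : Prop :=
  ∀ x, ∃ hx : T x ∈ A.domain, A ⟨T x, hx⟩ = S x

open Classical in
/-- The product `A T`, if it is an everywhere defined bounded operator. -/
def prod (A : H →ₗ.[ℂ] H) (T : H →L[ℂ] H) : H →L[ℂ] H :=
  if h : ∃ S, IsProd A T S then h.choose else 0

/-- `A T` is trace class, so that `Tr[T A] = Tr[A T]` exists. (For self-adjoint `A` and `T`, the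
operators `A T` and `T A` are adjoint to each other.) -/
def HasExpect (T : H →L[ℂ] H) (A : H →ₗ.[ℂ] H) : Prop := ∃ S, IsProd A T S ∧ IsTraceClass S

/-- `⟨A⟩ = Tr[A T]`. -/
def expect (T : H →L[ℂ] H) (A : H →ₗ.[ℂ] H) : ℂ := trace (prod A T)

/-- `⟨A²⟩ = ‖A √ρ‖²_HS` is finite. -/
def HasSecondMoment (ρ : H →L[ℂ] H) (A : H →ₗ.[ℂ] H) : Prop :=
  ∃ S, IsProd A (CFC.sqrt ρ) S ∧ hsNormSq S ≠ ⊤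

/-- `⟨A* B⟩ = Tr[ρ A* B]`, in the form `Tr[(A √ρ)* (B √ρ)]` which exists whenever `A` and `B` have
finite second moments. -/
def expectMul (ρ : H →L[ℂ] H) (A B : H →ₗ.[ℂ] H) : ℂ :=
  trace (star (prod A (CFC.sqrt ρ)) * prod B (CFC.sqrt ρ))

/-- The correlation `C(A, B)`. -/
def corr (ρ : H →L[ℂ] H) (A B : H →ₗ.[ℂ] H) : ℂ :=
  expectMul ρ A B - expect ρ A * expect ρ B

/-- The symmetrized correlation `C^S(A, B)`. -/
def symCorr (ρ : H →L[ℂ] H) (A B : H →ₗ.[ℂ] H) : ℂ := (corr ρ A B + corr ρ B A) / 2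

/-- The variance `σ²(A)`. -/
def variance (ρ : H →L[ℂ] H) (A : H →ₗ.[ℂ] H) : ℝ := (corr ρ A A).re

/-- `⟨[A, B]⟩` for self-adjoint `A` and `B`. -/
def expectComm (ρ : H →L[ℂ] H) (A B : H →ₗ.[ℂ] H) : ℂ := expectMul ρ A B - expectMul ρ B A

/-- The derivative `D_θ⟨A⟩[φ] = Tr[φ A]`, i.e. `(∇_θ⟨A⟩, φ)`, for the affine model
`ρ(θ) = ρ₀ + θ`. -/
def gradExpect (A : H →ₗ.[ℂ] H) (φ : H →L[ℂ] H) : ℝ := (expect φ A).re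

/-! ### Measurements -/

/-- Positive operator-valued measures, given on the measurable sets. -/
structure IsPOVM {Ω : Type*} [MeasurableSpace Ω] (M : Set Ω → H →L[ℂ] H) : Prop where
  nonneg : ∀ B, MeasurableSet B → 0 ≤ M B
  univ : M Set.univ = 1
  iUnion : ∀ f : ℕ → Set Ω, (∀ k, MeasurableSet (f k)) → Pairwise (Function.onFun Disjoint f) →
    ∀ x y : H, HasSum (fun k => ⟪x, M (f k) y⟫_ℂ) ⟪x, M (⋃ k, f k) y⟫_ℂ

open Classical in
/-- The probability measure `P(B) = Tr[ρ M(B)]`. -/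
def law {Ω : Type*} [MeasurableSpace Ω] (M : Set Ω → H →L[ℂ] H) (ρ : H →L[ℂ] H) : Measure Ω :=
  if h : ∃ P : Measure Ω, ∀ B, MeasurableSet B → P B = ENNReal.ofReal (trace (ρ * M B)).re
  then h.choose else 0

open Classical in
/-- The derivative of the law in the direction `φ`: the signed measure `B ↦ Tr[φ M(B)]`. -/
def lawDeriv {Ω : Type*} [MeasurableSpace Ω] (M : Set Ω → H →L[ℂ] H) (φ : H →L[ℂ] H) :
    SignedMeasure Ω :=
  if h : ∃ ν : SignedMeasure Ω, ∀ B, MeasurableSet B → ν B = (trace (φ * M B)).re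
  then h.choose else 0

/-- The logarithmic derivative of the law in the direction `φ`: the Radon-Nikodym derivative of
the derivative of the law with respect to the law. -/
def logDeriv {Ω : Type*} [MeasurableSpace Ω] (M : Set Ω → H →L[ℂ] H) (ρ φ : H →L[ℂ] H) : Ω → ℝ :=
  (lawDeriv M φ).rnDeriv (law M ρ)

/-- The quadratic form `(φ, J^M φ) = E[l(X; φ)²]` of the Fisher information operator of the law of
the outcomes of `M`. -/
def fisherInfo {Ω : Type*} [MeasurableSpace Ω] (M : Set Ω → H →L[ℂ] H) (ρ φ : H →L[ℂ] H) : ℝ≥0∞ :=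
  ∫⁻ x, ENNReal.ofReal (logDeriv M ρ φ x ^ 2) ∂(law M ρ)

/-- The measurement error `ε(A; ρ, M) = (∇⟨A⟩, (J^M)⁺ ∇⟨A⟩) - σ²(A)`, or `⊤`. The directions are
those in which the expectation value of `A` is finite. -/
def povmError {Ω : Type*} [MeasurableSpace Ω] (A : H →ₗ.[ℂ] H) (ρ : H →L[ℂ] H)
    (M : Set Ω → H →L[ℂ] H) : EReal :=
  pinvForm (directions ρ ∩ {φ | HasExpect φ A}) (gradExpect A) (fisherInfo M ρ)
    - (variance ρ A : EReal)

/-- `ℛ_M(A, B) = (∇⟨A⟩, (J^M)⁺ ∇⟨B⟩) - C^S(A, B)`. -/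
def remainder {Ω : Type*} [MeasurableSpace Ω] (A B : H →ₗ.[ℂ] H) (ρ : H →L[ℂ] H)
    (M : Set Ω → H →L[ℂ] H) : ℝ :=
  pinvPairing (directions ρ ∩ {φ | HasExpect φ A ∧ HasExpect φ B})
    (gradExpect A) (gradExpect B) (fisherInfo M ρ) - (symCorr ρ A B).re

/-- The disturbance `η(A; ρ, 𝓔) = (∇⟨A⟩, (J^S_{𝓔∘ρ})⁺ ∇⟨A⟩) - σ²(A)`, or `⊤`, of a time evolution
`𝓔` of the states. The model `𝓔(ρ(θ))` has the derivative `𝓔 φ` in the direction `φ`. -/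
def channelDisturbance (A : H →ₗ.[ℂ] H) (ρ : H →L[ℂ] H)
    (𝓔 : (H →L[ℂ] H) → (H →L[ℂ] H)) : EReal :=
  pinvForm (directions ρ ∩ {φ | HasExpect φ A}) (gradExpect A) (fun φ => sldInfo (𝓔 ρ) (𝓔 φ))
    - (variance ρ A : EReal)

variable (H) in
/-- A completely positive instrument with outcomes in `Ω`: a countably additive family of
completely positive linear maps `𝓘(B)` on the trace-class operators such that `𝓘(Ω)` preserves
the trace. Only the values on measurable sets and trace-class operators matter. -/
structure CPInstrument (Ω : Type*) [MeasurableSpace Ω] where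
  toFun : Set Ω → (H →L[ℂ] H) → (H →L[ℂ] H)
  isTraceClass : ∀ B, MeasurableSet B → ∀ T, IsTraceClass T → IsTraceClass (toFun B T)
  map_add : ∀ B, MeasurableSet B → ∀ S T, IsTraceClass S → IsTraceClass T →
    toFun B (S + T) = toFun B S + toFun B T
  map_smul : ∀ B, MeasurableSet B → ∀ (c : ℂ) (T), IsTraceClass T →
    toFun B (c • T) = c • toFun B T
  /-- Positive block operators with trace-class entries are mapped to positive ones. -/
  completelyPositive : ∀ B, MeasurableSet B → ∀ (n : ℕ) (T : Fin n → Fin n → H →L[ℂ] H),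
    (∀ i j, IsTraceClass (T i j)) →
    (∀ x : Fin n → H, 0 ≤ ∑ i, ∑ j, ⟪x i, T i j (x j)⟫_ℂ) →
    ∀ x : Fin n → H, 0 ≤ ∑ i, ∑ j, ⟪x i, toFun B (T i j) (x j)⟫_ℂ
  /-- Countable additivity, tested against all bounded operators. -/
  iUnion : ∀ f : ℕ → Set Ω, (∀ k, MeasurableSet (f k)) → Pairwise (Function.onFun Disjoint f) →
    ∀ T, IsTraceClass T → ∀ X : H →L[ℂ] H,
      HasSum (fun k => trace (toFun (f k) T * X)) (trace (toFun (⋃ k, f k) T * X))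
  trace_univ : ∀ T, IsTraceClass T → trace (toFun Set.univ T) = trace T

namespace CPInstrument

variable {Ω : Type*} [MeasurableSpace Ω]

open Classical in
/-- The dual map `𝓘(B)*` on the bounded operators: `Tr[T 𝓘(B)*(X)] = Tr[𝓘(B)(T) X]` for all
trace-class `T`. -/
def dual (𝓘 : CPInstrument H Ω) (B : Set Ω) (X : H →L[ℂ] H) : H →L[ℂ] H :=
  if h : ∃ Y : H →L[ℂ] H, ∀ T, IsTraceClass T → trace (T * Y) = trace (𝓘.toFun B T * X)
  then h.choose else 0

/-- The induced POVM `B ↦ 𝓘(B)*(1)`. -/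
def povm (𝓘 : CPInstrument H Ω) : Set Ω → H →L[ℂ] H := fun B => 𝓘.dual B 1

/-- The measurement error `ε(A; ρ, 𝓘)`. -/
def error (A : H →ₗ.[ℂ] H) (ρ : H →L[ℂ] H) (𝓘 : CPInstrument H Ω) : EReal :=
  povmError A ρ 𝓘.povm

/-- The disturbance `η(A; ρ, 𝓘)`. -/
def disturbance (A : H →ₗ.[ℂ] H) (ρ : H →L[ℂ] H) (𝓘 : CPInstrument H Ω) : EReal :=
  channelDisturbance A ρ (𝓘.toFun Set.univ)

end CPInstrument

open Classical in
/-- The product of an error and a disturbance, which is infinite as soon as one factor is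
infinite, even if the other one is zero. -/
def extMul (x y : EReal) : EReal := if x = ⊤ ∨ y = ⊤ then ⊤ else x * y

end QM

end

/-! The proof turns both Fisher quantities into Hilbert space geometry. Write `W` for the map `f ↦ ∫
f dM √ρ` from real `L²(law M ρ)` to the Hilbert-Schmidt operators. A logarithmic derivative `L` is
represented by `t = L√ρ`, and such `t` form the tangent space `sldSpace`. For an observable `X` the
gradient is `t ↦ Re⟨X√ρ, t⟩` (`IsFaithful.gradExpect_sldDir`). The map `W` is a contraction and its
adjoint sends `t` to the classical score, so the Fisher form is `‖W* t‖²`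
(`IsPOVM.fisherInfo_sldDir`). Hence the quadratic form of the pseudo-inverse is the least `‖f‖²`
among locally unbiased estimators, those with `Re⟨W f, t⟩ = Re⟨X√ρ, t⟩` for all tangent `t`.

The optimal `f` lies in the closure of the scores. For it `W f = (X - ⟨X⟩)√ρ`
(`IsFaithful.realIntegralCLM_eq`), because a symmetric derivative orthogonal to all tangent vectors
is a real multiple of `√ρ`. So if `f, g` are optimal for `A, B`, the numbers `‖f‖² - σ²(A)`, `‖g‖² -
σ²(B)` and `⟨f, g⟩ - C(A, B)` are entries of the form of the defect `1 - W*W`, complexified. The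
last one has real part `ℛ_M(A, B)` and an imaginary part of modulus `|⟨[A, B]⟩| / 2`. The
Cauchy-Schwarz inequality for the defect is the uncertainty relation
`IsFaithful.remainder_sq_add_le`.

It remains to build a joint measurement whose errors are at most the error and the disturbance of
the instrument. Let `σ` be the final state. By Kadison-Schwarz, `X√σ ↦ 𝓘(ℝ)*(X)√ρ` is a contraction
`Γ`, and `Γ*` carries logarithmic derivatives at `ρ` to ones at `σ`
(`CPInstrument.exists_transfer`). A finite disturbance gives `y` in the closure of the range of `Γ*`
such that `Γ y` is unbiased for `B` and `‖y‖² - σ²(B)` is at most the disturbance. This `y` has the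
form `L√σ` with `L` symmetric, but `L` need not be self-adjoint. Extending its Cayley transform to a
unitary on `H ⊕ H` and compressing the spectral measure yields a POVM `E` with `∫ x dE √σ = y` and
second moment `‖y‖²` (`exists_povm_realIntegralCLM_eq`).

Running the instrument and then measuring `E` defines a bimeasure, hence a POVM `M` on the plane
(`CPInstrument.exists_joint_povm`). Estimators on the two marginals lift to `M` without gain of norm
(`IsPOVM.exists_lift`). If the error or the disturbance is infinite, a fair-coin mixture of a
measurement for `A` and one for `B` serves as `M`. -/

open scoped ENNReal ComplexOrder InnerProductSpace
open MeasureTheory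

noncomputable section

set_option linter.unusedSectionVars false

/-! ### Factorization of one operator through another -/

section Extension

variable {𝕜 : Type*} [RCLike 𝕜] {E F G : Type*} [AddCommGroup E] [Module 𝕜 E]
  [NormedAddCommGroup F] [InnerProductSpace 𝕜 F] [CompleteSpace F]
  [NormedAddCommGroup G] [NormedSpace 𝕜 G] [CompleteSpace G]

/-- The Douglas factorization: if `‖b e‖ ≤ C ‖a e‖` for all `e`, then `b` factors through `a` by a
bounded operator that vanishes on the orthogonal complement of the range of `a`. -/
theorem exists_factor_of_norm_le (a : E →ₗ[𝕜] F) (b : E →ₗ[𝕜] G) {C : ℝ} (hC : 0 ≤ C)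
    (h : ∀ e, ‖b e‖ ≤ C * ‖a e‖) :
    ∃ W : F →L[𝕜] G, (∀ e, W (a e) = b e) ∧ ‖W‖ ≤ C ∧ ∀ x ∈ (LinearMap.range a)ᗮ, W x = 0 := by
  classical
  set R := LinearMap.range a
  have hker : ∀ e, a e = 0 → b e = 0 := fun e he => by
    have := h e
    rw [he, norm_zero, mul_zero] at this
    exact norm_le_zero_iff.1 this
  -- A preimage is chosen for every point of the range; by `hker` the value of `b` there does not
  -- depend on the choice, so `b` descends to a linear map on the range.
  choose s hs using fun y : R => y.2
  have hb : ∀ e (y : R), a e = y → b e = b (s y) := fun e y hy => by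
    rw [← sub_eq_zero, ← map_sub]
    exact hker _ (by rw [map_sub, hy, hs, sub_self])
  let f₀ : R →ₗ[𝕜] G :=
    { toFun := fun y => b (s y)
      map_add' := fun y z => by
        rw [← map_add]; exact (hb _ _ (by rw [map_add, hs, hs]; rfl)).symm
      map_smul' := fun c y => by
        rw [RingHom.id_apply, ← map_smul]; exact (hb _ _ (by rw [map_smul, hs]; rfl)).symm }
  let f₁ : R →L[𝕜] G := f₀.mkContinuous C fun y => (h (s y)).trans (by rw [hs]; rfl)
  let K := R.topologicalClosure
  have : CompleteSpace K := R.isClosed_topologicalClosure.completeSpace_coe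
  let i : R →ₗᵢ[𝕜] K := ⟨Submodule.inclusion R.le_topologicalClosure, fun _ => rfl⟩
  have hd : DenseRange i := by
    intro x
    rw [mem_closure_iff_seq_limit]
    obtain ⟨u, hu, hux⟩ := mem_closure_iff_seq_limit.1 x.2
    refine ⟨fun n => i ⟨u n, hu n⟩, fun n => ⟨_, rfl⟩, ?_⟩
    rw [tendsto_subtype_rng]
    exact hux
  have hiu : IsUniformInducing i := i.isometry.isUniformInducing
  let f₂ : K →L[𝕜] G := f₁.extend i.toContinuousLinearMap
  have hf₂ : ∀ y : R, f₂ (i y) = f₁ y := fun y =>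
    ContinuousLinearMap.extend_eq (e := i.toContinuousLinearMap) f₁ hd hiu y
  have hn : ‖f₂‖ ≤ C := by
    refine ContinuousLinearMap.opNorm_le_bound _ hC fun x => ?_
    refine hd.induction_on (p := fun x => ‖f₂ x‖ ≤ C * ‖x‖) x ?_ fun y => ?_
    · exact isClosed_le (by fun_prop) (by fun_prop)
    · rw [hf₂, i.norm_map]
      exact (h (s y)).trans (by rw [hs]; rfl)
  -- Composing with the projection onto the closed range keeps the bound `C` and forces the
  -- extension to vanish on the orthogonal complement.
  refine ⟨f₂ ∘L K.orthogonalProjectionOnto, fun e => ?_, ?_, fun x hx => ?_⟩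
  · let y : R := ⟨a e, e, rfl⟩
    have : K.orthogonalProjectionOnto (a e) = i y := by
      have := K.orthogonalProjectionOnto_mem_subspace_eq_self (i y)
      exact this
    rw [ContinuousLinearMap.comp_apply, this, hf₂]
    exact (hb e y rfl).symm
  · refine (ContinuousLinearMap.opNorm_comp_le _ _).trans ?_
    calc _ ≤ C * 1 := mul_le_mul hn K.orthogonalProjectionOnto_norm_le (norm_nonneg _) hC
      _ = C := mul_one C
  · have : K.orthogonalProjectionOnto x = 0 := by
      rw [Submodule.orthogonalProjectionOnto_eq_zero_iff]
      rwa [Submodule.orthogonal_closure]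
    rw [ContinuousLinearMap.comp_apply, this, map_zero]

end Extension

/-! ### Hilbert-Schmidt operators as a Hilbert space -/

namespace QM

variable {H : Type*} [NormedAddCommGroup H] [InnerProductSpace ℂ H] [CompleteSpace H]

variable (H) in
/-- The Hilbert space of Hilbert-Schmidt operators, given by their values on the basis `onb H`. -/
def HSSpace : Type _ := lp (fun _ : basisIndex H => H) 2

instance : NormedAddCommGroup (HSSpace H) :=
  inferInstanceAs (NormedAddCommGroup (lp (fun _ : basisIndex H => H) 2))

instance : InnerProductSpace ℂ (HSSpace H) :=
  inferInstanceAs (InnerProductSpace ℂ (lp (fun _ : basisIndex H => H) 2))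

instance : CompleteSpace (HSSpace H) :=
  inferInstanceAs (CompleteSpace (lp (fun _ : basisIndex H => H) 2))

instance : InnerProductSpace ℝ (HSSpace H) := InnerProductSpace.complexToReal

/-- The value of a Hilbert-Schmidt operator on a basis vector. -/
def HSSpace.coeff (t : HSSpace H) (i : basisIndex H) : H :=
  (show lp (fun _ : basisIndex H => H) 2 from t) i

namespace HSSpace

theorem coeff_add (s t : HSSpace H) (i) : (s + t).coeff i = s.coeff i + t.coeff i := rfl

theorem coeff_smul (c : ℂ) (t : HSSpace H) (i) : (c • t).coeff i = c • t.coeff i := rfl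

/-- The Hilbert-Schmidt operator with prescribed values on the basis vectors. -/
def mk (v : basisIndex H → H) (h : Summable fun i => ‖v i‖ ^ 2) : HSSpace H :=
  (⟨v, memℓp_gen (by simpa using h)⟩ : lp (fun _ : basisIndex H => H) 2)

theorem coeff_mk (v : basisIndex H → H) (h) (i) : (mk v h).coeff i = v i := rfl

theorem ext_coeff {s t : HSSpace H} (h : ∀ i, s.coeff i = t.coeff i) : s = t :=
  lp.ext (funext h)

theorem hasSum_inner (s t : HSSpace H) :
    HasSum (fun i => ⟪s.coeff i, t.coeff i⟫_ℂ) ⟪s, t⟫_ℂ :=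
  lp.hasSum_inner (𝕜 := ℂ) (G := fun _ : basisIndex H => H) s t

theorem real_inner_eq_re (s t : HSSpace H) : ⟪s, t⟫_ℝ = (⟪s, t⟫_ℂ).re := rfl

theorem hasSum_norm_sq (t : HSSpace H) : HasSum (fun i => ‖t.coeff i‖ ^ 2) (‖t‖ ^ 2) := by
  have h := Complex.hasSum_re (hasSum_inner t t)
  simpa only [← RCLike.re_eq_complex_re, inner_self_eq_norm_sq (𝕜 := ℂ)] using h

end HSSpace

theorem hasSum_norm_inner_onb_sq (x : H) : HasSum (fun i => ‖⟪onb H i, x⟫_ℂ‖ ^ 2) (‖x‖ ^ 2) := by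
  have h := Complex.hasSum_re ((onb H).hasSum_inner_mul_inner x x)
  rw [← RCLike.re_eq_complex_re, inner_self_eq_norm_sq (𝕜 := ℂ)] at h
  convert h using 2 with i
  rw [← inner_conj_symm x (onb H i), mul_comm, Complex.mul_conj, Complex.normSq_eq_norm_sq]
  exact (Complex.ofReal_re _).symm

theorem summable_inner_onb_smul (t : HSSpace H) (x : H) :
    Summable fun i => ‖⟪onb H i, x⟫_ℂ • t.coeff i‖ := by
  refine Summable.of_nonneg_of_le (fun _ => norm_nonneg _) (fun i => ?_)
    ((hasSum_norm_inner_onb_sq x).add t.hasSum_norm_sq).summable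
  rw [norm_smul]
  nlinarith [sq_nonneg (‖⟪onb H i, x⟫_ℂ‖ - ‖t.coeff i‖), sq_nonneg ‖⟪onb H i, x⟫_ℂ‖,
    sq_nonneg ‖t.coeff i‖]

namespace HSSpace

theorem norm_tsum_le (t : HSSpace H) (x : H) :
    ‖∑' i, ⟪onb H i, x⟫_ℂ • t.coeff i‖ ≤ ‖t‖ * ‖x‖ := by
  have hs := summable_inner_onb_smul t x
  refine (norm_tsum_le_tsum_norm hs).trans ?_
  refine hs.tsum_le_of_sum_le fun s => ?_
  simp only [norm_smul]
  have h := Finset.sum_mul_sq_le_sq_mul_sq s (fun i => ‖⟪onb H i, x⟫_ℂ‖) fun i => ‖t.coeff i‖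
  have h1 : ∑ i ∈ s, ‖⟪onb H i, x⟫_ℂ‖ ^ 2 ≤ ‖x‖ ^ 2 :=
    sum_le_hasSum s (fun _ _ => sq_nonneg _) (hasSum_norm_inner_onb_sq x)
  have h2 : ∑ i ∈ s, ‖t.coeff i‖ ^ 2 ≤ ‖t‖ ^ 2 :=
    sum_le_hasSum s (fun _ _ => sq_nonneg _) t.hasSum_norm_sq
  refine le_of_sq_le_sq (h.trans ?_) (by positivity)
  rw [mul_pow, mul_comm (‖t‖ ^ 2)]
  exact mul_le_mul h1 h2 (Finset.sum_nonneg fun _ _ => sq_nonneg _) (sq_nonneg _)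

/-- The bounded operator given by an element of `HSSpace H`. -/
def op : HSSpace H →ₗ[ℂ] (H →L[ℂ] H) where
  toFun t := LinearMap.mkContinuous
    { toFun := fun x => ∑' i, ⟪onb H i, x⟫_ℂ • t.coeff i
      map_add' := fun x y => by
        rw [← (summable_inner_onb_smul t x).of_norm.tsum_add (summable_inner_onb_smul t y).of_norm]
        simp only [inner_add_right, add_smul]
      map_smul' := fun c x => by
        rw [RingHom.id_apply, ← (summable_inner_onb_smul t x).of_norm.tsum_const_smul]
        simp only [inner_smul_right, smul_smul] } ‖t‖ (norm_tsum_le t)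
  map_add' s t := by
    ext x
    simp only [LinearMap.mkContinuous_apply, LinearMap.coe_mk, AddHom.coe_mk,
      add_apply, coeff_add, smul_add]
    exact (summable_inner_onb_smul s x).of_norm.tsum_add (summable_inner_onb_smul t x).of_norm
  map_smul' c t := by
    ext x
    simp only [LinearMap.mkContinuous_apply, LinearMap.coe_mk, AddHom.coe_mk,
      smul_apply, coeff_smul, RingHom.id_apply, smul_comm _ c]
    exact (summable_inner_onb_smul t x).of_norm.tsum_const_smul c

theorem op_apply (t : HSSpace H) (x : H) : op t x = ∑' i, ⟪onb H i, x⟫_ℂ • t.coeff i := rfl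

theorem norm_op_apply_le (t : HSSpace H) (x : H) : ‖op t x‖ ≤ ‖t‖ * ‖x‖ := norm_tsum_le t x

theorem op_onb (t : HSSpace H) (i) : op t (onb H i) = t.coeff i := by
  classical
  rw [op_apply, tsum_eq_single i]
  · rw [inner_self_eq_norm_sq_to_K, (onb H).orthonormal.1 i]; simp
  · intro j hj
    rw [(onb H).orthonormal.2 hj, zero_smul]

end HSSpace

theorem clm_ext_onb {S T : H →L[ℂ] H} (h : ∀ i, S (onb H i) = T (onb H i)) : S = T := by
  refine ContinuousLinearMap.ext_on (s := Set.range (onb H)) ?_ ?_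
  · have := (onb H).dense_span
    rw [Submodule.dense_iff_topologicalClosure_eq_top, this]
  · rintro _ ⟨i, rfl⟩; exact h i

theorem HSSpace.op_injective : Function.Injective (op : HSSpace H → H →L[ℂ] H) := fun s t h =>
  ext_coeff fun i => by rw [← op_onb, ← op_onb, h]

/-- Hilbert-Schmidt operators. -/
def IsHS (T : H →L[ℂ] H) : Prop := hsNormSq T ≠ ⊤

theorem hsNormSq_op (t : HSSpace H) : hsNormSq (HSSpace.op t) = ENNReal.ofReal (‖t‖ ^ 2) := by
  rw [hsNormSq, ← t.hasSum_norm_sq.tsum_eq,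
    ENNReal.ofReal_tsum_of_nonneg (fun _ => sq_nonneg _) t.hasSum_norm_sq.summable]
  simp only [HSSpace.op_onb]

theorem isHS_op (t : HSSpace H) : IsHS (HSSpace.op t) := by
  rw [IsHS, hsNormSq_op]; exact ENNReal.ofReal_ne_top

theorem IsHS.summable {T : H →L[ℂ] H} (h : IsHS T) : Summable fun i => ‖T (onb H i)‖ ^ 2 := by
  have := ENNReal.summable_toReal h
  refine this.congr fun i => ?_
  rw [ENNReal.toReal_ofReal (sq_nonneg _)]

theorem isHS_of_summable {T : H →L[ℂ] H} (h : Summable fun i => ‖T (onb H i)‖ ^ 2) : IsHS T := by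
  rw [IsHS, hsNormSq, ← ENNReal.ofReal_tsum_of_nonneg (fun _ => sq_nonneg _) h]
  exact ENNReal.ofReal_ne_top

open Classical in
/-- A Hilbert-Schmidt operator as an element of the Hilbert space `HSSpace H`. -/
def hs (T : H →L[ℂ] H) : HSSpace H :=
  if h : IsHS T then HSSpace.mk (fun i => T (onb H i)) h.summable else 0

open HSSpace

theorem coeff_hs {T : H →L[ℂ] H} (h : IsHS T) (i) : (hs T).coeff i = T (onb H i) := by
  rw [hs, dif_pos h, coeff_mk]

theorem op_hs {T : H →L[ℂ] H} (h : IsHS T) : op (hs T) = T :=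
  clm_ext_onb fun i => by rw [op_onb, coeff_hs h]

theorem hs_op (t : HSSpace H) : hs (op t) = t := op_injective (op_hs (isHS_op t))

theorem hs_add {S T : H →L[ℂ] H} (hS : IsHS S) (hT : IsHS T) : hs (S + T) = hs S + hs T := by
  rw [← hs_op (hs S + hs T), map_add, op_hs hS, op_hs hT]

theorem hs_zero : hs (0 : H →L[ℂ] H) = 0 := by
  rw [← map_zero op, hs_op]

theorem hs_smul (c : ℂ) {T : H →L[ℂ] H} (hT : IsHS T) : hs (c • T) = c • hs T := by
  rw [← hs_op (c • hs T), map_smul, op_hs hT]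

theorem IsHS.add {S T : H →L[ℂ] H} (hS : IsHS S) (hT : IsHS T) : IsHS (S + T) := by
  rw [← op_hs hS, ← op_hs hT, ← map_add]; exact isHS_op _

theorem IsHS.smul (c : ℂ) {T : H →L[ℂ] H} (hT : IsHS T) : IsHS (c • T) := by
  rw [← op_hs hT, ← map_smul]; exact isHS_op _

theorem IsHS.sub {S T : H →L[ℂ] H} (hS : IsHS S) (hT : IsHS T) : IsHS (S - T) := by
  rw [← op_hs hS, ← op_hs hT, ← map_sub]; exact isHS_op _

theorem hs_sub {S T : H →L[ℂ] H} (hS : IsHS S) (hT : IsHS T) : hs (S - T) = hs S - hs T := by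
  rw [← hs_op (hs S - hs T), map_sub, op_hs hS, op_hs hT]

theorem IsHS.mul_left (X : H →L[ℂ] H) {T : H →L[ℂ] H} (hT : IsHS T) : IsHS (X * T) := by
  refine isHS_of_summable (Summable.of_nonneg_of_le (fun _ => sq_nonneg _) (fun i => ?_)
    (hT.summable.mul_left (‖X‖ ^ 2)))
  rw [← mul_pow]
  exact pow_le_pow_left₀ (norm_nonneg _) (X.le_opNorm _) 2

theorem hasSum_inner_hs {S T : H →L[ℂ] H} (hS : IsHS S) (hT : IsHS T) :
    HasSum (fun i => ⟪S (onb H i), T (onb H i)⟫_ℂ) ⟪hs S, hs T⟫_ℂ := by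
  have := (hs S).hasSum_inner (hs T)
  simpa only [coeff_hs hS, coeff_hs hT] using this

theorem hasSum_norm_sq_hs {T : H →L[ℂ] H} (hT : IsHS T) :
    HasSum (fun i => ‖T (onb H i)‖ ^ 2) (‖hs T‖ ^ 2) := by
  have := (hs T).hasSum_norm_sq
  simpa only [coeff_hs hT] using this

theorem hsNormSq_eq {T : H →L[ℂ] H} (hT : IsHS T) : hsNormSq T = ENNReal.ofReal (‖hs T‖ ^ 2) := by
  rw [← hsNormSq_op, op_hs hT]

/-- By Parseval the squared norm is the double sum of the squared moduli of the matrix entries, and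
the two summations can be exchanged. -/
theorem hsNormSq_star (T : H →L[ℂ] H) : hsNormSq (star T) = hsNormSq T := by
  have key : ∀ S : H →L[ℂ] H, hsNormSq S
      = ∑' i, ∑' j, ENNReal.ofReal (‖⟪onb H j, S (onb H i)⟫_ℂ‖ ^ 2) := fun S => by
    refine tsum_congr fun i => ?_
    have := hasSum_norm_inner_onb_sq (S (onb H i))
    rw [← this.tsum_eq, ENNReal.ofReal_tsum_of_nonneg (fun _ => sq_nonneg _) this.summable]
  rw [key, key, ENNReal.tsum_comm]
  refine tsum_congr fun i => tsum_congr fun j => ?_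
  rw [ContinuousLinearMap.star_eq_adjoint, ContinuousLinearMap.adjoint_inner_right,
    norm_inner_symm]

theorem IsHS.star {T : H →L[ℂ] H} (hT : IsHS T) : IsHS (star T) := by
  rw [IsHS, hsNormSq_star]; exact hT

theorem isHS_star_iff {T : H →L[ℂ] H} : IsHS (star T) ↔ IsHS T :=
  ⟨fun h => by simpa using h.star, fun h => h.star⟩

theorem IsHS.mul_right {T : H →L[ℂ] H} (hT : IsHS T) (X : H →L[ℂ] H) : IsHS (T * X) := by
  rw [← isHS_star_iff, star_mul]
  exact hT.star.mul_left _

theorem norm_hs_star {T : H →L[ℂ] H} (hT : IsHS T) : ‖hs (star T)‖ = ‖hs T‖ := by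
  have h := hsNormSq_star T
  rw [hsNormSq_eq hT, hsNormSq_eq hT.star, ENNReal.ofReal_eq_ofReal_iff (sq_nonneg _)
    (sq_nonneg _)] at h
  exact (sq_eq_sq₀ (norm_nonneg _) (norm_nonneg _)).1 h

/-- The adjoint is an antilinear isometry, so the polarization identity shows that it reverses inner
products. Cyclicity of the trace rests on this. -/
theorem inner_hs_star {S T : H →L[ℂ] H} (hS : IsHS S) (hT : IsHS T) :
    ⟪hs (star S), hs (star T)⟫_ℂ = ⟪hs T, hs S⟫_ℂ := by
  rw [inner_eq_sum_norm_sq_div_four, inner_eq_sum_norm_sq_div_four (hs T)]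
  have h1 : ‖hs (star S) + hs (star T)‖ = ‖hs T + hs S‖ := by
    rw [← hs_add hS.star hT.star, ← star_add, norm_hs_star (hS.add hT), hs_add hS hT, add_comm]
  have h2 : ‖hs (star S) - hs (star T)‖ = ‖hs T - hs S‖ := by
    rw [← hs_sub hS.star hT.star, ← star_sub, norm_hs_star (hS.sub hT), hs_sub hS hT,
      norm_sub_rev]
  have h3 : ‖hs (star S) - (RCLike.I : ℂ) • hs (star T)‖ = ‖hs T - (RCLike.I : ℂ) • hs S‖ := by
    have : star S - (RCLike.I : ℂ) • star T = star (S + (RCLike.I : ℂ) • T) := by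
      rw [star_add, star_smul]; simp [sub_eq_add_neg]
    rw [← hs_smul _ hT.star, ← hs_sub hS.star (hT.star.smul _), this,
      norm_hs_star (hS.add (hT.smul _)), hs_add hS (hT.smul _), hs_smul _ hT]
    have : hs S + (RCLike.I : ℂ) • hs T = (RCLike.I : ℂ) • (hs T - (RCLike.I : ℂ) • hs S) := by
      rw [smul_sub, smul_smul]; simp [add_comm]
    rw [this, norm_smul]; simp
  have h4 : ‖hs (star S) + (RCLike.I : ℂ) • hs (star T)‖ = ‖hs T + (RCLike.I : ℂ) • hs S‖ := by
    have : star S + (RCLike.I : ℂ) • star T = star (S - (RCLike.I : ℂ) • T) := by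
      rw [star_sub, star_smul]; simp [sub_eq_add_neg]
    rw [← hs_smul _ hT.star, ← hs_add hS.star (hT.star.smul _), this,
      norm_hs_star (hS.sub (hT.smul _)), hs_sub hS (hT.smul _), hs_smul _ hT]
    have : hs S - (RCLike.I : ℂ) • hs T = -((RCLike.I : ℂ) • (hs T + (RCLike.I : ℂ) • hs S)) := by
      rw [smul_add, smul_smul]; simp [sub_eq_add_neg]
    rw [this, norm_neg, norm_smul]; simp
  rw [h1, h2, h3, h4]

/-! ### The trace -/

theorem trace_star_mul {S T : H →L[ℂ] H} (hS : IsHS S) (hT : IsHS T) :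
    trace (star S * T) = ⟪hs S, hs T⟫_ℂ := by
  rw [← (hasSum_inner_hs hS hT).tsum_eq, trace]
  refine tsum_congr fun i => ?_
  rw [mul_apply_eq_comp, ContinuousLinearMap.star_eq_adjoint,
    ContinuousLinearMap.adjoint_inner_right]

theorem trace_mul_eq {S T : H →L[ℂ] H} (hS : IsHS S) (hT : IsHS T) :
    trace (S * T) = ⟪hs (star S), hs T⟫_ℂ := by
  rw [← trace_star_mul hS.star hT, star_star]

theorem trace_mul_comm_of_isHS {S T : H →L[ℂ] H} (hS : IsHS S) (hT : IsHS T) :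
    trace (S * T) = trace (T * S) := by
  rw [trace_mul_eq hS hT, trace_mul_eq hT hS]
  have := inner_hs_star hS hT.star
  rwa [star_star] at this

end QM

/-! ### Trace-class operators -/

namespace QM

variable {H : Type*} [NormedAddCommGroup H] [InnerProductSpace ℂ H] [CompleteSpace H]

open HSSpace

theorem inner_star_left (T : H →L[ℂ] H) (x y : H) : ⟪star T x, y⟫_ℂ = ⟪x, T y⟫_ℂ := by
  rw [ContinuousLinearMap.star_eq_adjoint, ContinuousLinearMap.adjoint_inner_left]

theorem inner_star_right (T : H →L[ℂ] H) (x y : H) : ⟪x, star T y⟫_ℂ = ⟪T x, y⟫_ℂ := by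
  rw [ContinuousLinearMap.star_eq_adjoint, ContinuousLinearMap.adjoint_inner_right]

theorem _root_.IsSelfAdjoint.inner_comm_apply {T : H →L[ℂ] H} (hT : IsSelfAdjoint T) (x y : H) :
    ⟪T x, y⟫_ℂ = ⟪x, T y⟫_ℂ := by
  rw [← inner_star_left, hT.star_eq]

theorem inner_apply_self_nonneg {T : H →L[ℂ] H} (hT : 0 ≤ T) (x : H) : 0 ≤ ⟪x, T x⟫_ℂ :=
  ((ContinuousLinearMap.nonneg_iff_isPositive T).1 hT).inner_nonneg_right x

theorem nonneg_of_inner {T : H →L[ℂ] H} (hT : ∀ x, 0 ≤ ⟪x, T x⟫_ℂ) : 0 ≤ T := by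
  rw [ContinuousLinearMap.nonneg_iff_isPositive, ContinuousLinearMap.isPositive_iff_complex]
  intro x
  obtain ⟨h0, h1⟩ := Complex.nonneg_iff.1 (hT x)
  have h2 : (⟪T x, x⟫_ℂ).im = 0 := by
    have := inner_im_symm (𝕜 := ℂ) (T x) x
    simp only [RCLike.im_eq_complex_im] at this
    rw [this, ← h1, neg_zero]
  have h3 : (⟪T x, x⟫_ℂ).re = (⟪x, T x⟫_ℂ).re := inner_re_symm (𝕜 := ℂ) (T x) x
  exact ⟨Complex.ext (by simp) (by simp [h2]), h0.trans_eq h3.symm⟩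

theorem norm_abs_apply (T : H →L[ℂ] H) (x : H) : ‖CFC.abs T x‖ = ‖T x‖ := by
  have hsa : IsSelfAdjoint (CFC.abs T) := IsSelfAdjoint.of_nonneg (CFC.abs_nonneg T)
  refine (sq_eq_sq₀ (norm_nonneg _) (norm_nonneg _)).1 ?_
  rw [← inner_self_eq_norm_sq (𝕜 := ℂ), ← inner_self_eq_norm_sq (𝕜 := ℂ), hsa.inner_comm_apply,
    ← mul_apply_eq_comp, CFC.abs_mul_abs, mul_apply_eq_comp, inner_star_right]

/-- This stands in for the polar decomposition: since `‖|T| x‖ = ‖T x‖`, each of `T` and `|T|` is a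
bounded left multiple of the other. -/
theorem exists_mul_eq_of_norm_apply_le {S T : H →L[ℂ] H} (h : ∀ x, ‖T x‖ ≤ ‖S x‖) :
    ∃ V : H →L[ℂ] H, V * S = T := by
  obtain ⟨V, hV, -, -⟩ := exists_factor_of_norm_le (𝕜 := ℂ) (S : H →ₗ[ℂ] H) (T : H →ₗ[ℂ] H)
    zero_le_one (by simpa using h)
  exact ⟨V, ContinuousLinearMap.ext fun x => hV x⟩

theorem sqrt_mul_self {T : H →L[ℂ] H} (hT : 0 ≤ T) : CFC.sqrt T * CFC.sqrt T = T :=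
  CFC.sqrt_mul_sqrt_self T hT

theorem sqrt_isSelfAdjoint (T : H →L[ℂ] H) : IsSelfAdjoint (CFC.sqrt T) :=
  IsSelfAdjoint.of_nonneg (CFC.sqrt_nonneg T)

theorem norm_sqrt_apply_sq {T : H →L[ℂ] H} (hT : 0 ≤ T) (x : H) :
    ‖CFC.sqrt T x‖ ^ 2 = (⟪x, T x⟫_ℂ).re := by
  rw [← inner_self_eq_norm_sq (𝕜 := ℂ), (sqrt_isSelfAdjoint T).inner_comm_apply,
    ← mul_apply_eq_comp, sqrt_mul_self hT]
  rfl

theorem isHS_sqrt_iff {T : H →L[ℂ] H} (hT : 0 ≤ T) : IsHS (CFC.sqrt T) ↔ IsTraceClass T := by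
  rw [IsHS, IsTraceClass, hsNormSq, traceNorm, CFC.abs_of_nonneg T hT]
  simp only [norm_sqrt_apply_sq hT]

theorem isTraceClass_iff_abs {T : H →L[ℂ] H} : IsTraceClass (CFC.abs T) ↔ IsTraceClass T := by
  rw [IsTraceClass, traceNorm, CFC.abs_of_nonneg _ (CFC.abs_nonneg T)]; rfl

/-- With `T = V|T|`, the factors are `V|T|^{1/2}` and `|T|^{1/2}`. The ideal property, the
convergence of the trace and its cyclicity all reduce to Hilbert-Schmidt facts in this way. -/
theorem IsTraceClass.exists_mul {T : H →L[ℂ] H} (hT : IsTraceClass T) :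
    ∃ R S : H →L[ℂ] H, IsHS R ∧ IsHS S ∧ T = R * S := by
  have hS := (isHS_sqrt_iff (CFC.abs_nonneg T)).2 (isTraceClass_iff_abs.2 hT)
  obtain ⟨V, hV⟩ := exists_mul_eq_of_norm_apply_le (S := CFC.abs T) (T := T)
    fun x => (norm_abs_apply T x).ge
  refine ⟨V * CFC.sqrt (CFC.abs T), CFC.sqrt (CFC.abs T), hS.mul_left V, hS, ?_⟩
  rw [mul_assoc, sqrt_mul_self (CFC.abs_nonneg T), hV]

theorem hasSum_trace_mul {R S : H →L[ℂ] H} (hR : IsHS R) (hS : IsHS S) :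
    HasSum (fun i => ⟪onb H i, (R * S) (onb H i)⟫_ℂ) (trace (R * S)) := by
  rw [trace_mul_eq hR hS]
  convert hasSum_inner_hs hR.star hS using 2 with i
  rw [mul_apply_eq_comp, inner_star_left]

/-- For the `V` with `V T = |T|` the diagonal series is the trace norm itself. The criterion is
linear in `T`, which makes sums accessible although `|S + T|` is not. -/
theorem isTraceClass_of_forall_summable {T : H →L[ℂ] H}
    (h : ∀ V : H →L[ℂ] H, Summable fun i => ⟪onb H i, (V * T) (onb H i)⟫_ℂ) :
    IsTraceClass T := by
  obtain ⟨V, hV⟩ := exists_mul_eq_of_norm_apply_le (S := T) (T := CFC.abs T)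
    fun x => (norm_abs_apply T x).le
  have hs := h V
  rw [hV] at hs
  have hr := (Complex.hasSum_re hs.hasSum).summable
  rw [IsTraceClass, traceNorm, ← ENNReal.ofReal_tsum_of_nonneg _ hr]
  · exact ENNReal.ofReal_ne_top
  · exact fun i => (Complex.nonneg_iff.1 (inner_apply_self_nonneg (CFC.abs_nonneg T) _)).1

theorem isTraceClass_mul {R S : H →L[ℂ] H} (hR : IsHS R) (hS : IsHS S) : IsTraceClass (R * S) :=
  isTraceClass_of_forall_summable fun V => by
    rw [← mul_assoc]; exact (hasSum_trace_mul (hR.mul_left V) hS).summable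

theorem IsTraceClass.mul_left (X : H →L[ℂ] H) {T : H →L[ℂ] H} (hT : IsTraceClass T) :
    IsTraceClass (X * T) := by
  obtain ⟨R, S, hR, hS, rfl⟩ := hT.exists_mul
  rw [← mul_assoc]; exact isTraceClass_mul (hR.mul_left X) hS

theorem IsTraceClass.mul_right {T : H →L[ℂ] H} (hT : IsTraceClass T) (X : H →L[ℂ] H) :
    IsTraceClass (T * X) := by
  obtain ⟨R, S, hR, hS, rfl⟩ := hT.exists_mul
  rw [mul_assoc]; exact isTraceClass_mul hR (hS.mul_right X)

theorem IsTraceClass.hasSum_trace {T : H →L[ℂ] H} (hT : IsTraceClass T) :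
    HasSum (fun i => ⟪onb H i, T (onb H i)⟫_ℂ) (trace T) := by
  obtain ⟨R, S, hR, hS, rfl⟩ := hT.exists_mul
  exact hasSum_trace_mul hR hS

theorem IsTraceClass.add {S T : H →L[ℂ] H} (hS : IsTraceClass S) (hT : IsTraceClass T) :
    IsTraceClass (S + T) :=
  isTraceClass_of_forall_summable fun V => by
    simp only [mul_add, add_apply, inner_add_right]
    exact (hS.mul_left V).hasSum_trace.summable.add (hT.mul_left V).hasSum_trace.summable

theorem IsTraceClass.smul (c : ℂ) {T : H →L[ℂ] H} (hT : IsTraceClass T) :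
    IsTraceClass (c • T) := by
  have := hT.mul_left (c • 1)
  rwa [smul_mul_assoc, one_mul] at this

theorem IsTraceClass.neg {T : H →L[ℂ] H} (hT : IsTraceClass T) : IsTraceClass (-T) := by
  have := hT.smul (-1)
  rwa [neg_one_smul] at this

theorem IsTraceClass.sub {S T : H →L[ℂ] H} (hS : IsTraceClass S) (hT : IsTraceClass T) :
    IsTraceClass (S - T) := by
  rw [sub_eq_add_neg]; exact hS.add hT.neg

theorem isTraceClass_zero : IsTraceClass (0 : H →L[ℂ] H) :=
  isTraceClass_of_forall_summable fun V => by simp [summable_zero]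

theorem trace_add {S T : H →L[ℂ] H} (hS : IsTraceClass S) (hT : IsTraceClass T) :
    trace (S + T) = trace S + trace T := by
  rw [← (hS.hasSum_trace.add hT.hasSum_trace).tsum_eq, trace]
  simp only [add_apply, inner_add_right]

theorem trace_smul (c : ℂ) (T : H →L[ℂ] H) : trace (c • T) = c * trace T := by
  rw [trace, trace, ← tsum_mul_left]
  simp only [smul_apply, inner_smul_right]

theorem trace_neg (T : H →L[ℂ] H) : trace (-T) = -trace T := by
  rw [← neg_one_smul ℂ, trace_smul]; ring

theorem trace_zero : trace (0 : H →L[ℂ] H) = 0 := by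
  rw [← zero_smul ℂ (0 : H →L[ℂ] H), trace_smul, zero_mul]

theorem trace_sub {S T : H →L[ℂ] H} (hS : IsTraceClass S) (hT : IsTraceClass T) :
    trace (S - T) = trace S - trace T := by
  rw [sub_eq_add_neg, trace_add hS hT.neg, trace_neg, sub_eq_add_neg]

theorem trace_star (T : H →L[ℂ] H) : trace (star T) = star (trace T) := by
  rw [trace, trace, Complex.star_def, Complex.conj_tsum]
  refine tsum_congr fun i => ?_
  rw [inner_conj_symm, inner_star_right]

theorem trace_mul_comm {T : H →L[ℂ] H} (hT : IsTraceClass T) (X : H →L[ℂ] H) :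
    trace (T * X) = trace (X * T) := by
  obtain ⟨R, S, hR, hS, rfl⟩ := hT.exists_mul
  rw [mul_assoc, trace_mul_comm_of_isHS hR (hS.mul_right X), mul_assoc,
    trace_mul_comm_of_isHS hS (hR.mul_left X), mul_assoc]

theorem trace_nonneg {T : H →L[ℂ] H} (hT : 0 ≤ T) : 0 ≤ trace T :=
  tsum_nonneg fun _ => inner_apply_self_nonneg hT _

/-! ### Rank-one operators -/

/-- The operator `x ↦ ⟨v, x⟩ u`. -/
abbrev ketbra (u v : H) : H →L[ℂ] H := InnerProductSpace.rankOne ℂ u v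

theorem ketbra_apply (u v x : H) : ketbra u v x = ⟪v, x⟫_ℂ • u :=
  InnerProductSpace.rankOne_apply ..

theorem isHS_ketbra (u v : H) : IsHS (ketbra u v) := by
  refine isHS_of_summable ?_
  simp only [ketbra_apply, norm_smul, mul_pow, norm_inner_symm v]
  exact (hasSum_norm_inner_onb_sq v).summable.mul_right _

theorem isTraceClass_ketbra (u v : H) : IsTraceClass (ketbra u v) := by
  rcases eq_or_ne u 0 with rfl | hu
  · have : ketbra (0 : H) v = 0 := by ext; simp
    rw [this]; exact isTraceClass_zero
  · have : ketbra u v = ((⟪u, u⟫_ℂ)⁻¹ • ketbra u u) * ketbra u v := by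
      ext x
      rw [mul_apply_eq_comp, smul_apply, ketbra_apply, ketbra_apply, inner_smul_right, smul_smul,
        mul_left_comm, inv_mul_cancel₀ (by simpa using hu), mul_one]
    rw [this]
    exact isTraceClass_mul ((isHS_ketbra u u).smul _) (isHS_ketbra u v)

theorem trace_ketbra_mul (u v : H) (X : H →L[ℂ] H) : trace (ketbra u v * X) = ⟪v, X u⟫_ℂ := by
  rw [← inner_star_left, ← (onb H).tsum_inner_mul_inner, trace]
  refine tsum_congr fun i => ?_
  rw [mul_apply_eq_comp, ketbra_apply, inner_smul_right, inner_star_left]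

theorem ketbra_mul (u v : H) (X : H →L[ℂ] H) : ketbra u v * X = ketbra u (star X v) := by
  ext x; simp [inner_star_left]

theorem mul_ketbra (X : H →L[ℂ] H) (u v : H) : X * ketbra u v = ketbra (X u) v := by
  ext x; simp

theorem ketbra_self_nonneg (u : H) : 0 ≤ ketbra u u := by
  refine nonneg_of_inner fun x => ?_
  rw [ketbra_apply, inner_smul_right, ← inner_conj_symm u x, mul_comm, Complex.mul_conj]
  exact_mod_cast Complex.normSq_nonneg _

theorem eq_of_forall_trace_eq {X Y : H →L[ℂ] H}
    (h : ∀ T, IsTraceClass T → trace (T * X) = trace (T * Y)) : X = Y := by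
  ext x
  refine ext_inner_left ℂ fun v => ?_
  rw [← trace_ketbra_mul, ← trace_ketbra_mul, h _ (isTraceClass_ketbra _ _)]

end QM

/-! ### Building operator-valued measures from scalar ones -/

namespace QM

variable {H : Type*} [NormedAddCommGroup H] [InnerProductSpace ℂ H] [CompleteSpace H]

open HSSpace Filter Topology

theorem inner_polarization (T : H →L[ℂ] H) (x y : H) :
    ⟪x, T y⟫_ℂ = (⟪x + y, T (x + y)⟫_ℂ - ⟪x - y, T (x - y)⟫_ℂ
      - Complex.I * ⟪x + Complex.I • y, T (x + Complex.I • y)⟫_ℂ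
      + Complex.I * ⟪x - Complex.I • y, T (x - Complex.I • y)⟫_ℂ) / 4 := by
  simp only [map_add, map_sub, map_smul, inner_add_left, inner_add_right, inner_sub_left,
    inner_sub_right, inner_smul_left, inner_smul_right, Complex.conj_I]
  linear_combination (1 / 2 * ⟪x, T y⟫_ℂ - 1 / 2 * ⟪y, T x⟫_ℂ) * Complex.I_sq

/-- A bounded family of operators whose quadratic forms converge has a weak limit. -/
theorem exists_weak_limit {ι : Type*} {l : Filter ι} [l.NeBot] {M : ι → H →L[ℂ] H} {C : ℝ}
    (hC : ∀ n, ‖M n‖ ≤ C) (h : ∀ x, ∃ z, Tendsto (fun n => ⟪x, M n x⟫_ℂ) l (𝓝 z)) :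
    ∃ M₀ : H →L[ℂ] H, ∀ x y, Tendsto (fun n => ⟪x, M n y⟫_ℂ) l (𝓝 ⟪x, M₀ y⟫_ℂ) := by
  have hpol : ∀ x y, ∃ z, Tendsto (fun n => ⟪M n x, y⟫_ℂ) l (𝓝 z) := fun x y => by
    choose q hq using h
    refine ⟨star ((q (y + x) - q (y - x) - Complex.I * q (y + Complex.I • x)
      + Complex.I * q (y - Complex.I • x)) / 4), ?_⟩
    have h1 : ∀ n, ⟪M n x, y⟫_ℂ = star ⟪y, M n x⟫_ℂ := fun n => (inner_conj_symm _ _).symm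
    simp only [h1]
    refine Tendsto.star ?_
    simp only [inner_polarization (M _) y x]
    exact ((((hq _).sub (hq _)).sub ((hq _).const_mul _)).add ((hq _).const_mul _)).div_const _
  choose b hb using hpol
  let B : H →L⋆[ℂ] H →L[ℂ] ℂ := LinearMap.mkContinuous₂
    (LinearMap.mk₂'ₛₗ (starRingEnd ℂ) (RingHom.id ℂ) b
      (fun x x' y => tendsto_nhds_unique (hb _ _) (by
        simpa only [map_add, inner_add_left] using (hb x y).add (hb x' y)))
      (fun c x y => tendsto_nhds_unique (hb _ _) (by
        simpa only [map_smul, inner_smul_left, smul_eq_mul] using (hb x y).const_mul _))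
      (fun x y y' => tendsto_nhds_unique (hb _ _) (by
        simpa only [inner_add_right] using (hb x y).add (hb x y')))
      (fun c x y => tendsto_nhds_unique (hb _ _) (by
        simpa only [inner_smul_right, smul_eq_mul, RingHom.id_apply] using (hb x y).const_mul _))) C
    (fun x y => le_of_tendsto (hb x y).norm (Eventually.of_forall fun n =>
      (norm_inner_le_norm _ _).trans (mul_le_mul_of_nonneg_right
        ((M n).le_of_opNorm_le (hC n) x) (norm_nonneg _))))
  refine ⟨InnerProductSpace.continuousLinearMapOfBilin B, fun x y => ?_⟩
  simp only [← inner_conj_symm x]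
  rw [InnerProductSpace.continuousLinearMapOfBilin_apply]
  exact (hb y x).star

theorem ext_of_inner_self {S T : H →L[ℂ] H} (h : ∀ x, ⟪x, S x⟫_ℂ = ⟪x, T x⟫_ℂ) : S = T := by
  ext y
  refine ext_inner_left ℂ fun x => ?_
  rw [inner_polarization S, inner_polarization T, h, h, h, h]

theorem _root_.MeasureTheory.hasSum_measureReal_iUnion {Ω : Type*} [MeasurableSpace Ω]
    {μ : Measure Ω} [IsFiniteMeasure μ] {f : ℕ → Set Ω} (hd : Pairwise (Function.onFun Disjoint f))
    (hf : ∀ k, MeasurableSet (f k)) : HasSum (fun k => μ.real (f k)) (μ.real (⋃ k, f k)) := by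
  have h := measure_iUnion (μ := μ) hd hf
  rw [measureReal_def, h, ENNReal.tsum_toReal_eq fun k => measure_ne_top _ _]
  exact ENNReal.hasSum_toReal (h ▸ measure_ne_top _ _)

theorem norm_le_one_of_inner {T : H →L[ℂ] H} (h0 : ∀ x, 0 ≤ ⟪x, T x⟫_ℂ)
    (h1 : ∀ x, ⟪x, T x⟫_ℂ ≤ ⟪x, x⟫_ℂ) : ‖T‖ ≤ 1 := by
  rw [CStarAlgebra.norm_le_one_iff_of_nonneg T (nonneg_of_inner h0), ← sub_nonneg]
  refine nonneg_of_inner fun x => ?_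
  rw [sub_apply, inner_sub_right, sub_nonneg]
  exact h1 x

theorem inner_self_eq_ofReal_norm_sq (x : H) : ⟪x, x⟫_ℂ = ((‖x‖ ^ 2 : ℝ) : ℂ) := by
  rw [inner_self_eq_norm_sq_to_K]; norm_cast

/-- A family of measures `μ x` of mass `‖x‖²` which on a generating π-system is given by quadratic
forms of operators comes from a positive operator-valued measure. -/
theorem exists_povm {Ω : Type*} [m : MeasurableSpace Ω] (μ : H → Measure Ω)
    (hu : ∀ x, μ x Set.univ = ENNReal.ofReal (‖x‖ ^ 2)) (𝒢 : Set (Set Ω))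
    (hgen : m = MeasurableSpace.generateFrom 𝒢) (hpi : IsPiSystem 𝒢)
    (h𝒢 : ∀ C ∈ 𝒢, ∃ M : H →L[ℂ] H, ∀ x, ⟪x, M x⟫_ℂ = ((μ x).real C : ℂ)) :
    ∃ M : Set Ω → H →L[ℂ] H, IsPOVM M ∧
      ∀ C, MeasurableSet C → ∀ x, ⟪x, M C x⟫_ℂ = ((μ x).real C : ℂ) := by
  classical
  have hfin : ∀ x, IsFiniteMeasure (μ x) := fun x => ⟨by rw [hu]; exact ENNReal.ofReal_lt_top⟩
  have hur : ∀ x, ((μ x).real Set.univ : ℂ) = ⟪x, x⟫_ℂ := fun x => by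
    rw [measureReal_def, hu, ENNReal.toReal_ofReal (sq_nonneg _), inner_self_eq_ofReal_norm_sq]
  have hsum : ∀ x (f : ℕ → Set Ω), Pairwise (Function.onFun Disjoint f) →
      (∀ k, MeasurableSet (f k)) →
      HasSum (fun k => ((μ x).real (f k) : ℂ)) ((μ x).real (⋃ k, f k) : ℂ) := by
    intro x f hd hf
    rw [Complex.hasSum_ofReal]
    exact hasSum_measureReal_iUnion hd hf
  have key : ∀ C, MeasurableSet C → ∃ M : H →L[ℂ] H, ∀ x, ⟪x, M x⟫_ℂ = ((μ x).real C : ℂ) := by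
    intro C hC
    induction C, hC using MeasurableSpace.induction_on_inter hgen hpi with
    | empty => exact ⟨0, fun x => by simp⟩
    | basic C hC => exact h𝒢 C hC
    | compl C hC ih =>
      obtain ⟨M, hM⟩ := ih
      refine ⟨1 - M, fun x => ?_⟩
      rw [sub_apply, inner_sub_right, hM, measureReal_compl hC, Complex.ofReal_sub, hur]
      rfl
    | iUnion f hd hf ih =>
      choose M hM using ih
      have hS : ∀ n x, ⟪x, (∑ k ∈ Finset.range n, M k) x⟫_ℂ
          = ((∑ k ∈ Finset.range n, (μ x).real (f k) : ℝ) : ℂ) := fun n x => by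
        rw [sum_apply, inner_sum, Complex.ofReal_sum]
        exact Finset.sum_congr rfl fun k _ => hM k x
      -- The partial sums lie between `0` and `1`, so they are uniformly bounded and their weak
      -- limit is the operator of the union.
      have hle : ∀ n, ‖∑ k ∈ Finset.range n, M k‖ ≤ 1 := fun n => by
        refine norm_le_one_of_inner (fun x => ?_) (fun x => ?_)
        · rw [hS]
          exact_mod_cast Finset.sum_nonneg fun k _ => measureReal_nonneg
        · rw [hS, ← hur]
          have h1 := sum_le_hasSum (Finset.range n) (fun k _ => measureReal_nonneg)
            (hasSum_measureReal_iUnion (μ := μ x) hd hf)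
          exact_mod_cast h1.trans (measureReal_mono (Set.subset_univ _))
      have ht : ∀ x, Tendsto (fun n => ⟪x, (∑ k ∈ Finset.range n, M k) x⟫_ℂ) atTop
          (𝓝 ((μ x).real (⋃ k, f k) : ℂ)) := fun x => by
        simp only [hS, Complex.ofReal_sum]
        exact (hsum x f hd hf).tendsto_sum_nat
      obtain ⟨M₀, hM₀⟩ := exists_weak_limit hle fun x => ⟨_, ht x⟩
      exact ⟨M₀, fun x => tendsto_nhds_unique (hM₀ x x) (ht x)⟩
  choose! M hM using key
  refine ⟨M, ⟨fun C hC => nonneg_of_inner fun x => ?_, ?_, ?_⟩, hM⟩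
  · rw [hM C hC]; exact_mod_cast measureReal_nonneg
  · refine ext_of_inner_self fun x => ?_
    rw [hM _ MeasurableSet.univ, hur]
    rfl
  · intro f hf hd x y
    simp only [inner_polarization (M _) x y, hM _ (hf _), hM _ (MeasurableSet.iUnion hf)]
    exact ((((hsum _ f hd hf).sub (hsum _ f hd hf)).sub ((hsum _ f hd hf).mul_left _)).add
      ((hsum _ f hd hf).mul_left _)).div_const _

end QM

/-! ### Integration against a POVM -/

namespace QM

variable {H : Type*} [NormedAddCommGroup H] [InnerProductSpace ℂ H] [CompleteSpace H]

open HSSpace Filter Topology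

variable {Ω : Type*} [MeasurableSpace Ω] {M : Set Ω → H →L[ℂ] H} {ρ : H →L[ℂ] H}

theorem IsPOVM.empty (hM : IsPOVM M) : M ∅ = 0 := by
  refine ext_of_inner_self fun x => ?_
  -- A constant series converges only if its term is zero.
  have h := hM.iUnion (fun _ => ∅) (fun _ => .empty) (fun _ _ _ => by simp [Function.onFun]) x x
  simpa using (summable_const_iff _).1 h.summable

theorem IsPOVM.union (hM : IsPOVM M) {C D : Set Ω} (hC : MeasurableSet C) (hD : MeasurableSet D)
    (hCD : Disjoint C D) : M (C ∪ D) = M C + M D := by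
  refine ext_of_inner_self fun x => ?_
  have hd : Pairwise (Function.onFun Disjoint fun k : ℕ => if k = 0 then C else if k = 1 then D
      else ∅) := by
    intro i j hij
    rcases i with _ | _ | i <;> rcases j with _ | _ | j <;> simp_all [Function.onFun, hCD.symm]
  have h := hM.iUnion _ (fun k => by split_ifs <;> first | assumption | exact .empty) hd x x
  have hU : (⋃ k : ℕ, if k = 0 then C else if k = 1 then D else ∅) = C ∪ D := by
    ext ω
    simp only [Set.mem_iUnion, Set.mem_union]
    constructor
    · rintro ⟨k, hk⟩
      split_ifs at hk
      · exact Or.inl hk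
      · exact Or.inr hk
      · exact absurd hk (Set.notMem_empty _)
    · rintro (h | h)
      · exact ⟨0, by simpa using h⟩
      · exact ⟨1, by simpa using h⟩
  rw [hU] at h
  rw [← h.tsum_eq, tsum_eq_sum (s := Finset.range 2), Finset.sum_range_succ,
    Finset.sum_range_one, add_apply, inner_add_right]
  · simp
  · intro k hk
    rw [Finset.mem_range, not_lt] at hk
    rw [if_neg (by omega), if_neg (by omega), hM.empty]
    simp

theorem IsPOVM.exists_measure (hM : IsPOVM M) (x : H) :
    ∃ μ : Measure Ω, ∀ C, MeasurableSet C → μ C = ENNReal.ofReal (⟪x, M C x⟫_ℂ).re := by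
  refine ⟨Measure.ofMeasurable (fun C _ => ENNReal.ofReal (⟪x, M C x⟫_ℂ).re)
    (by simp [hM.empty]) (fun f hf hd => ?_), fun C hC => Measure.ofMeasurable_apply C hC⟩
  have h := Complex.hasSum_re (hM.iUnion f hf hd x x)
  rw [← h.tsum_eq, ENNReal.ofReal_tsum_of_nonneg _ h.summable]
  exact fun k => (Complex.nonneg_iff.1 (inner_apply_self_nonneg (hM.nonneg _ (hf k)) x)).1

theorem trace_mul_eq_inner_sqrt (hρ : 0 ≤ ρ) (hρ1 : IsTraceClass ρ) (X : H →L[ℂ] H) :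
    trace (ρ * X) = ⟪hs (CFC.sqrt ρ), hs (X * CFC.sqrt ρ)⟫_ℂ := by
  have h := (isHS_sqrt_iff hρ).2 hρ1
  rw [← trace_star_mul h (h.mul_left X), (sqrt_isSelfAdjoint ρ).star_eq]
  nth_rewrite 1 [← sqrt_mul_self hρ]
  rw [mul_assoc, trace_mul_comm_of_isHS h (h.mul_right X), mul_assoc,
    trace_mul_comm_of_isHS h (h.mul_left X)]

theorem hasSum_trace_mul_sqrt (hρ : 0 ≤ ρ) (hρ1 : IsTraceClass ρ) (X : H →L[ℂ] H) :
    HasSum (fun i => ⟪CFC.sqrt ρ (onb H i), X (CFC.sqrt ρ (onb H i))⟫_ℂ) (trace (ρ * X)) := by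
  have h := (isHS_sqrt_iff hρ).2 hρ1
  rw [trace_mul_eq_inner_sqrt hρ hρ1]
  exact hasSum_inner_hs h (h.mul_left X)

theorem trace_mul_nonneg (hρ : 0 ≤ ρ) (hρ1 : IsTraceClass ρ) {X : H →L[ℂ] H} (hX : 0 ≤ X) :
    0 ≤ trace (ρ * X) :=
  (hasSum_trace_mul_sqrt hρ hρ1 X).nonneg fun _ => inner_apply_self_nonneg hX _

theorem IsPOVM.exists_law (hM : IsPOVM M) (hρ : 0 ≤ ρ) (hρ1 : IsTraceClass ρ) :
    ∃ P : Measure Ω, ∀ C, MeasurableSet C → P C = ENNReal.ofReal (trace (ρ * M C)).re := by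
  choose μ hμ using hM.exists_measure
  refine ⟨Measure.sum fun i => μ (CFC.sqrt ρ (onb H i)), fun C hC => ?_⟩
  have h := Complex.hasSum_re (hasSum_trace_mul_sqrt hρ hρ1 (M C))
  rw [Measure.sum_apply _ hC, ← h.tsum_eq, ENNReal.ofReal_tsum_of_nonneg _ h.summable]
  · simp only [hμ _ C hC]
  · exact fun i => (Complex.nonneg_iff.1 (inner_apply_self_nonneg (hM.nonneg _ hC) _)).1

theorem IsPOVM.law_apply (hM : IsPOVM M) (hρ : 0 ≤ ρ) (hρ1 : IsTraceClass ρ) {C : Set Ω}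
    (hC : MeasurableSet C) : law M ρ C = ENNReal.ofReal (trace (ρ * M C)).re := by
  rw [law, dif_pos (hM.exists_law hρ hρ1)]
  exact (hM.exists_law hρ hρ1).choose_spec C hC

instance isFiniteMeasure_law : IsFiniteMeasure (law M ρ) := by
  refine ⟨?_⟩
  rw [law]
  split_ifs with h
  · rw [h.choose_spec _ .univ]; exact ENNReal.ofReal_lt_top
  · simp

theorem IsPOVM.law_real (hM : IsPOVM M) (hρ : 0 ≤ ρ) (hρ1 : IsTraceClass ρ) {C : Set Ω}
    (hC : MeasurableSet C) :
    (((law M ρ).real C : ℝ) : ℂ) = ⟪hs (CFC.sqrt ρ), hs (M C * CFC.sqrt ρ)⟫_ℂ := by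
  obtain ⟨h0, h1⟩ := Complex.nonneg_iff.1 (trace_mul_nonneg hρ hρ1 (hM.nonneg C hC))
  rw [measureReal_def, hM.law_apply hρ hρ1 hC, ENNReal.toReal_ofReal h0,
    ← trace_mul_eq_inner_sqrt hρ hρ1]
  exact Complex.ext (by simp) (by simp [← h1])

/-- This is `(∑ z_j N_j)*(∑ z_j N_j) ≤ ∑ |z_j|² N_j` for positive `N_j` with sum at most `1`. It is
obtained without a dilation: pair the vector `v` on the left with itself, bound each term by
arithmetic-geometric means in `√N_j`, and absorb `∑ ⟨v, N_j v⟩ ≤ ‖v‖²`. -/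
theorem norm_sum_smul_sq_le {ι : Type*} (J : Finset ι) (N : ι → H →L[ℂ] H)
    (hN : ∀ j ∈ J, 0 ≤ N j) (h1 : ∀ v, ∑ j ∈ J, (⟪v, N j v⟫_ℂ).re ≤ ‖v‖ ^ 2) (z : ι → ℂ) (y : H) :
    ‖∑ j ∈ J, z j • N j y‖ ^ 2 ≤ ∑ j ∈ J, ‖z j‖ ^ 2 * (⟪y, N j y⟫_ℂ).re := by
  set v := ∑ j ∈ J, z j • N j y with hv
  have h2 : ‖v‖ ^ 2 = ∑ j ∈ J, (z j * ⟪v, N j y⟫_ℂ).re := by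
    rw [← inner_self_eq_norm_sq (𝕜 := ℂ), RCLike.re_eq_complex_re]
    conv_lhs => rw [hv, inner_sum]
    rw [Complex.re_sum]
    exact Finset.sum_congr rfl fun j _ => by rw [inner_smul_right]
  have h3 : ∀ j ∈ J, 2 * (z j * ⟪v, N j y⟫_ℂ).re
      ≤ (⟪v, N j v⟫_ℂ).re + ‖z j‖ ^ 2 * (⟪y, N j y⟫_ℂ).re := fun j hj => by
    have e : ⟪v, N j y⟫_ℂ = ⟪CFC.sqrt (N j) v, CFC.sqrt (N j) y⟫_ℂ := by
      rw [(sqrt_isSelfAdjoint _).inner_comm_apply, ← mul_apply_eq_comp, sqrt_mul_self (hN j hj)]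
    rw [← norm_sqrt_apply_sq (hN j hj), ← norm_sqrt_apply_sq (hN j hj), e]
    have := (Complex.re_le_norm _).trans_eq (norm_mul (z j)
      ⟪CFC.sqrt (N j) v, CFC.sqrt (N j) y⟫_ℂ)
    have h4 := mul_le_mul_of_nonneg_left (norm_inner_le_norm (𝕜 := ℂ) (CFC.sqrt (N j) v)
      (CFC.sqrt (N j) y)) (norm_nonneg (z j))
    nlinarith [sq_nonneg (‖CFC.sqrt (N j) v‖ - ‖z j‖ * ‖CFC.sqrt (N j) y‖)]
  have h4 := Finset.sum_le_sum h3
  rw [← Finset.mul_sum, ← h2, Finset.sum_add_distrib] at h4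
  linarith [h1 v]

/-- The value of the integral `∫ s dM √ρ` of a simple function. -/
def simpleIntegral (M : Set Ω → H →L[ℂ] H) (ρ : H →L[ℂ] H) (s : SimpleFunc Ω ℂ) : HSSpace H :=
  s.setToSimpleFunc fun C =>
    (ContinuousLinearMap.toSpanSingleton ℂ (hs (M C * CFC.sqrt ρ))).restrictScalars ℝ

theorem simpleIntegral_eq (s : SimpleFunc Ω ℂ) :
    simpleIntegral M ρ s = ∑ z ∈ s.range, z • hs (M (s ⁻¹' {z}) * CFC.sqrt ρ) := rfl

theorem IsPOVM.finMeasAdditive (hM : IsPOVM M) (hρ : 0 ≤ ρ) (hρ1 : IsTraceClass ρ)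
    (μ : Measure Ω) : FinMeasAdditive μ fun C =>
      (ContinuousLinearMap.toSpanSingleton ℂ (hs (M C * CFC.sqrt ρ))).restrictScalars ℝ := by
  intro C D hC hD _ _ hCD
  have h := (isHS_sqrt_iff hρ).2 hρ1
  ext1
  simp [hM.union hC hD hCD, add_mul, hs_add (h.mul_left (M C)) (h.mul_left (M D)), smul_add]

theorem IsPOVM.sum_fiber (hM : IsPOVM M) (s : SimpleFunc Ω ℂ) (v : H) :
    ∑ z ∈ s.range, (⟪v, M (s ⁻¹' {z}) v⟫_ℂ).re = ‖v‖ ^ 2 := by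
  obtain ⟨μ, hμ⟩ := hM.exists_measure v
  have hfin : IsFiniteMeasure μ := ⟨by rw [hμ _ .univ]; exact ENNReal.ofReal_lt_top⟩
  have h0 : ∀ C, MeasurableSet C → (⟪v, M C v⟫_ℂ).re = μ.real C := fun C hC => by
    rw [measureReal_def, hμ _ hC, ENNReal.toReal_ofReal
      (Complex.nonneg_iff.1 (inner_apply_self_nonneg (hM.nonneg _ hC) _)).1]
  have h1 : μ.real Set.univ = ‖v‖ ^ 2 := by
    rw [← h0 _ .univ, hM.univ, one_apply_eq_self, ← inner_self_eq_norm_sq (𝕜 := ℂ)]; rfl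
  rw [Finset.sum_congr rfl fun z _ => h0 _ (s.measurableSet_fiber z), ← h1, measureReal_def,
    ← s.sum_range_measure_preimage_singleton, ENNReal.toReal_sum fun _ _ => measure_ne_top _ _]
  rfl

theorem IsPOVM.norm_simpleIntegral_le (hM : IsPOVM M) (hρ : 0 ≤ ρ) (hρ1 : IsTraceClass ρ)
    (s : SimpleFunc Ω ℂ) :
    ‖simpleIntegral M ρ s‖ ^ 2 ≤ ∑ z ∈ s.range, ‖z‖ ^ 2 * (law M ρ).real (s ⁻¹' {z}) := by
  have h := (isHS_sqrt_iff hρ).2 hρ1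
  have hc : ∀ i, (simpleIntegral M ρ s).coeff i
      = ∑ z ∈ s.range, z • M (s ⁻¹' {z}) (CFC.sqrt ρ (onb H i)) := fun i => by
    rw [← op_onb, simpleIntegral_eq, map_sum, sum_apply]
    refine Finset.sum_congr rfl fun z _ => ?_
    rw [map_smul, op_hs (h.mul_left _), smul_apply, mul_apply_eq_comp]
  have hl : ∀ z, (law M ρ).real (s ⁻¹' {z})
      = (⟪hs (CFC.sqrt ρ), hs (M (s ⁻¹' {z}) * CFC.sqrt ρ)⟫_ℂ).re := fun z => by
    rw [← hM.law_real hρ hρ1 (s.measurableSet_fiber z), Complex.ofReal_re]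
  simp only [hl]
  refine hasSum_le (fun i => ?_) (simpleIntegral M ρ s).hasSum_norm_sq
    (hasSum_sum fun z (_ : z ∈ s.range) => (Complex.hasSum_re (hasSum_inner_hs h
      (h.mul_left (M (s ⁻¹' {z}))))).mul_left (‖z‖ ^ 2))
  rw [hc]
  exact norm_sum_smul_sq_le s.range (fun z => M (s ⁻¹' {z}))
    (fun z _ => hM.nonneg _ (s.measurableSet_fiber z)) (fun v => (hM.sum_fiber s v).le) id _

theorem norm_toLp_simpleFunc_sq {𝕜 : Type*} [RCLike 𝕜] (μ : Measure Ω) [IsFiniteMeasure μ]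
    (s : SimpleFunc Ω 𝕜) :
    ‖(s.memLp_of_isFiniteMeasure 2 μ).toLp s‖ ^ 2
      = ∑ z ∈ s.range, ‖z‖ ^ 2 * μ.real (s ⁻¹' {z}) := by
  rw [← inner_self_eq_norm_sq (𝕜 := 𝕜), L2.inner_def]
  have h1 : ∫ ω, ⟪(s.memLp_of_isFiniteMeasure 2 μ).toLp s ω,
      (s.memLp_of_isFiniteMeasure 2 μ).toLp s ω⟫_𝕜 ∂μ
      = ((∫ ω, (s.map fun z => ‖z‖ ^ 2) ω ∂μ : ℝ) : 𝕜) := by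
    rw [← integral_ofReal]
    refine integral_congr_ae ?_
    filter_upwards [(s.memLp_of_isFiniteMeasure 2 μ).coeFn_toLp] with ω hω
    rw [hω, inner_self_eq_norm_sq_to_K]
    simp
  rw [h1, RCLike.ofReal_re, ← SimpleFunc.integral_eq_integral _
    (SimpleFunc.integrable_of_isFiniteMeasure _), SimpleFunc.map_integral _ _
    (SimpleFunc.integrable_of_isFiniteMeasure _) (by simp)]
  simp [mul_comm]

/-- On simple functions the integral is bounded by the `L²` norm (`IsPOVM.norm_simpleIntegral_le`),
so the factorization theorem extends it to all of `L²` as a contraction. -/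
theorem IsPOVM.exists_integral (hM : IsPOVM M) (hρ : 0 ≤ ρ) (hρ1 : IsTraceClass ρ) :
    ∃ W : Lp ℂ 2 (law M ρ) →L[ℂ] HSSpace H, ‖W‖ ≤ 1 ∧
      ∀ C (hC : MeasurableSet C), W (indicatorConstLp 2 hC (measure_ne_top _ _) 1)
        = hs (M C * CFC.sqrt ρ) := by
  have hadd := hM.finMeasAdditive hρ hρ1 (law M ρ)
  let a : SimpleFunc Ω ℂ →ₗ[ℂ] Lp ℂ 2 (law M ρ) :=
    { toFun := fun s => (s.memLp_of_isFiniteMeasure 2 _).toLp s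
      map_add' := fun s t => rfl
      map_smul' := fun c s => rfl }
  let b : SimpleFunc Ω ℂ →ₗ[ℂ] HSSpace H :=
    { toFun := simpleIntegral M ρ
      map_add' := fun s t => SimpleFunc.setToSimpleFunc_add _ hadd
        (SimpleFunc.integrable_of_isFiniteMeasure _) (SimpleFunc.integrable_of_isFiniteMeasure _)
      map_smul' := fun c s => SimpleFunc.setToSimpleFunc_smul _ hadd
        (fun c C x => by simp [mul_smul]) c
        (SimpleFunc.integrable_of_isFiniteMeasure _) }
  obtain ⟨W, hW, hn, -⟩ := exists_factor_of_norm_le a b zero_le_one fun s => by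
    rw [one_mul]
    refine le_of_sq_le_sq ?_ (norm_nonneg _)
    exact (hM.norm_simpleIntegral_le hρ hρ1 s).trans_eq (norm_toLp_simpleFunc_sq _ s).symm
  refine ⟨W, hn, fun C hC => ?_⟩
  let s : SimpleFunc Ω ℂ := SimpleFunc.piecewise C hC (SimpleFunc.const Ω 1) (SimpleFunc.const Ω 0)
  have h1 : a s = indicatorConstLp 2 hC (measure_ne_top _ _) 1 := by
    rw [indicatorConstLp]
    congr 1
  rw [← h1, hW]
  have h2 := SimpleFunc.setToSimpleFunc_indicator (fun C => (ContinuousLinearMap.toSpanSingleton ℂ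
    (hs (M C * CFC.sqrt ρ))).restrictScalars ℝ) (by ext; simp [hM.empty, hs_zero]) hC (1 : ℂ)
  refine h2.trans ?_
  simp

open Classical in
/-- The integral `f ↦ ∫ f dM √ρ` as a contraction of `L²(law M ρ)` into the Hilbert-Schmidt
operators. -/
def integralCLM (M : Set Ω → H →L[ℂ] H) (ρ : H →L[ℂ] H) : Lp ℂ 2 (law M ρ) →L[ℂ] HSSpace H :=
  if h : ∃ W : Lp ℂ 2 (law M ρ) →L[ℂ] HSSpace H, ‖W‖ ≤ 1 ∧
      ∀ C (hC : MeasurableSet C), W (indicatorConstLp 2 hC (measure_ne_top _ _) 1)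
        = hs (M C * CFC.sqrt ρ)
  then h.choose else 0

theorem norm_integralCLM_le : ‖integralCLM M ρ‖ ≤ 1 := by
  rw [integralCLM]
  split_ifs with h
  · exact h.choose_spec.1
  · simp

theorem IsPOVM.integralCLM_indicator (hM : IsPOVM M) (hρ : 0 ≤ ρ) (hρ1 : IsTraceClass ρ)
    {C : Set Ω} (hC : MeasurableSet C) :
    integralCLM M ρ (indicatorConstLp 2 hC (measure_ne_top _ _) 1) = hs (M C * CFC.sqrt ρ) := by
  rw [integralCLM, dif_pos (hM.exists_integral hρ hρ1)]
  exact (hM.exists_integral hρ hρ1).choose_spec.2 C hC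

/-- Real-valued square integrable functions as complex-valued ones. -/
def toComplexL2 (μ : Measure Ω) : Lp ℝ 2 μ →L[ℝ] Lp ℂ 2 μ := Complex.ofRealCLM.compLpL 2 μ

theorem inner_toComplexL2 (μ : Measure Ω) (f g : Lp ℝ 2 μ) :
    ⟪toComplexL2 μ f, toComplexL2 μ g⟫_ℂ = ((⟪f, g⟫_ℝ : ℝ) : ℂ) := by
  rw [L2.inner_def, L2.inner_def, ← integral_complex_ofReal]
  refine integral_congr_ae ?_
  filter_upwards [Complex.ofRealCLM.coeFn_compLpL f, Complex.ofRealCLM.coeFn_compLpL g]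
    with ω h1 h2
  rw [toComplexL2, h1, h2]
  simp

theorem toComplexL2_indicator (μ : Measure Ω) {C : Set Ω} (hC : MeasurableSet C) (hμ : μ C ≠ ⊤) :
    toComplexL2 μ (indicatorConstLp 2 hC hμ 1) = indicatorConstLp 2 hC hμ 1 := by
  refine Lp.ext ?_
  filter_upwards [Complex.ofRealCLM.coeFn_compLpL (indicatorConstLp 2 hC hμ (1 : ℝ)),
    indicatorConstLp_coeFn (p := 2) (hs := hC) (hμs := hμ) (c := (1 : ℝ)),
    indicatorConstLp_coeFn (p := 2) (hs := hC) (hμs := hμ) (c := (1 : ℂ))] with ω h1 h2 h3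
  rw [toComplexL2, h1, h2, h3]
  by_cases hω : ω ∈ C <;> simp [hω]

/-- The integral of real-valued functions. -/
def realIntegralCLM (M : Set Ω → H →L[ℂ] H) (ρ : H →L[ℂ] H) : Lp ℝ 2 (law M ρ) →L[ℝ] HSSpace H :=
  (integralCLM M ρ).restrictScalars ℝ ∘L toComplexL2 (law M ρ)

theorem realIntegralCLM_apply (f : Lp ℝ 2 (law M ρ)) :
    realIntegralCLM M ρ f = integralCLM M ρ (toComplexL2 _ f) := rfl

theorem IsPOVM.realIntegralCLM_indicator (hM : IsPOVM M) (hρ : 0 ≤ ρ) (hρ1 : IsTraceClass ρ)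
    {C : Set Ω} (hC : MeasurableSet C) :
    realIntegralCLM M ρ (indicatorConstLp 2 hC (measure_ne_top _ _) 1)
      = hs (M C * CFC.sqrt ρ) := by
  rw [realIntegralCLM_apply, toComplexL2_indicator, hM.integralCLM_indicator hρ hρ1]

theorem norm_toComplexL2_sq (μ : Measure Ω) (f : Lp ℝ 2 μ) : ‖toComplexL2 μ f‖ ^ 2 = ‖f‖ ^ 2 := by
  rw [← inner_self_eq_norm_sq (𝕜 := ℂ), inner_toComplexL2, real_inner_self_eq_norm_sq]
  exact Complex.ofReal_re _

theorem norm_realIntegralCLM_apply_le (f : Lp ℝ 2 (law M ρ)) : ‖realIntegralCLM M ρ f‖ ≤ ‖f‖ := by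
  refine le_of_sq_le_sq ?_ (norm_nonneg _)
  rw [← norm_toComplexL2_sq, realIntegralCLM_apply]
  refine pow_le_pow_left₀ (norm_nonneg _) ?_ 2
  simpa using (integralCLM M ρ).le_of_opNorm_le norm_integralCLM_le (toComplexL2 _ f)

end QM

/-! ### Fisher information as the norm of the adjoint integral -/

namespace QM

variable {H : Type*} [NormedAddCommGroup H] [InnerProductSpace ℂ H] [CompleteSpace H]

open HSSpace Filter Topology

variable {Ω : Type*} [MeasurableSpace Ω] {M : Set Ω → H →L[ℂ] H} {ρ : H →L[ℂ] H}

/-- The direction `(T √ρ + √ρ T*) / 2` whose logarithmic derivative is represented by `T`. -/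
def sldDir (ρ T : H →L[ℂ] H) : H →L[ℂ] H :=
  (2⁻¹ : ℂ) • (T * CFC.sqrt ρ + CFC.sqrt ρ * star T)

theorem isTraceClass_sldDir {T : H →L[ℂ] H} (hρ : IsHS (CFC.sqrt ρ)) (hT : IsHS T) :
    IsTraceClass (sldDir ρ T) :=
  ((isTraceClass_mul hT hρ).add (isTraceClass_mul hρ hT.star)).smul _

theorem isSelfAdjoint_sldDir (T : H →L[ℂ] H) : IsSelfAdjoint (sldDir ρ T) := by
  rw [IsSelfAdjoint, sldDir, star_smul, star_add, star_mul, star_mul, star_star,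
    (sqrt_isSelfAdjoint ρ).star_eq, add_comm]
  simp

/-- The two halves of the direction contribute complex conjugate traces, so only the real inner
product survives. This is why the whole tangent geometry is over `ℝ`. -/
theorem trace_sldDir_mul {T X : H →L[ℂ] H} (hρ : IsHS (CFC.sqrt ρ)) (hT : IsHS T)
    (hX : IsSelfAdjoint X) :
    trace (sldDir ρ T * X) = ((⟪hs T, hs (X * CFC.sqrt ρ)⟫_ℝ : ℝ) : ℂ) := by
  have h1 : trace (CFC.sqrt ρ * star T * X) = ⟪hs T, hs (X * CFC.sqrt ρ)⟫_ℂ := by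
    rw [← trace_star_mul hT (hρ.mul_left X), mul_assoc, trace_mul_comm_of_isHS hρ
      (hT.star.mul_right X), mul_assoc]
  have h2 : trace (T * CFC.sqrt ρ * X) = star ⟪hs T, hs (X * CFC.sqrt ρ)⟫_ℂ := by
    rw [← h1, ← trace_star, star_mul, star_mul, star_star, hX.star_eq,
      (sqrt_isSelfAdjoint ρ).star_eq, trace_mul_comm (isTraceClass_mul hT hρ) X]
  rw [sldDir, smul_mul_assoc, trace_smul, add_mul, trace_add
    ((isTraceClass_mul hT hρ).mul_right X) ((isTraceClass_mul hρ hT.star).mul_right X), h1, h2,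
    real_inner_eq_re, add_comm, Complex.star_def, Complex.add_conj]
  push_cast
  ring

/-- The adjoint of the integral maps the quantum logarithmic derivative to the classical score: test
against indicators, whose integrals are `M(C)√ρ`. -/
theorem IsPOVM.lawDeriv_sldDir (hM : IsPOVM M) (hρ : 0 ≤ ρ) (hρ1 : IsTraceClass ρ)
    {T : H →L[ℂ] H} (hT : IsHS T) :
    lawDeriv M (sldDir ρ T)
      = (law M ρ).withDensityᵥ (ContinuousLinearMap.adjoint (realIntegralCLM M ρ) (hs T)) := by
  have h := (isHS_sqrt_iff hρ).2 hρ1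
  set l := ContinuousLinearMap.adjoint (realIntegralCLM M ρ) (hs T)
  have hl : Integrable l (law M ρ) := (Lp.memLp l).integrable (by norm_num)
  have key : ∀ C, MeasurableSet C →
      (law M ρ).withDensityᵥ l C = (trace (sldDir ρ T * M C)).re := fun C hC => by
    rw [trace_sldDir_mul h hT (IsSelfAdjoint.of_nonneg (hM.nonneg C hC)), Complex.ofReal_re,
      ← hM.realIntegralCLM_indicator hρ hρ1 hC, ← ContinuousLinearMap.adjoint_inner_left,
      withDensityᵥ_apply hl hC, real_inner_comm, L2.inner_indicatorConstLp_one]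
  have hex : ∃ ν : SignedMeasure Ω, ∀ C, MeasurableSet C → ν C = (trace (sldDir ρ T * M C)).re :=
    ⟨_, key⟩
  rw [lawDeriv, dif_pos hex]
  ext C hC
  rw [hex.choose_spec C hC, key C hC]

theorem IsPOVM.fisherInfo_sldDir (hM : IsPOVM M) (hρ : 0 ≤ ρ) (hρ1 : IsTraceClass ρ)
    {T : H →L[ℂ] H} (hT : IsHS T) :
    fisherInfo M ρ (sldDir ρ T)
      = ENNReal.ofReal (‖ContinuousLinearMap.adjoint (realIntegralCLM M ρ) (hs T)‖ ^ 2) := by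
  set l := ContinuousLinearMap.adjoint (realIntegralCLM M ρ) (hs T) with hl_def
  have hl : Integrable l (law M ρ) := (Lp.memLp l).integrable (by norm_num)
  -- Uniqueness of the Lebesgue decomposition, with zero singular part.
  have h1 : l =ᵐ[law M ρ] logDeriv M ρ (sldDir ρ T) := by
    refine SignedMeasure.eq_rnDeriv 0 l hl VectorMeasure.MutuallySingular.zero_left ?_
    rw [zero_add, hM.lawDeriv_sldDir hρ hρ1 hT]
  rw [← real_inner_self_eq_norm_sq, L2.inner_def, fisherInfo,
    ofReal_integral_eq_lintegral_ofReal]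
  · refine lintegral_congr_ae ?_
    filter_upwards [h1] with ω hω
    rw [← hω]
    simp [sq]
  · exact L2.integrable_inner l l
  · exact Eventually.of_forall fun ω => by simpa using sq_nonneg _

end QM

/-! ### Faithful states and expectations of unbounded observables -/

namespace QM

variable {H : Type*} [NormedAddCommGroup H] [InnerProductSpace ℂ H] [CompleteSpace H]

open HSSpace Filter Topology

variable {ρ : H →L[ℂ] H}

/-- Strictly positive density operators. -/
structure IsFaithful (ρ : H →L[ℂ] H) : Prop where
  nonneg : 0 ≤ ρ
  isTraceClass : IsTraceClass ρ
  trace_eq_one : trace ρ = 1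
  pos : ∀ x, x ≠ 0 → 0 < (⟪x, ρ x⟫_ℂ).re

theorem isFaithful_of_mem_parameterSet {ρ₀ θ : H →L[ℂ] H} (h₀ : IsDensity ρ₀)
    (hθ : θ ∈ parameterSet ρ₀) : IsFaithful (ρ₀ + θ) where
  nonneg := hθ.2.1
  isTraceClass := h₀.isTraceClass.add hθ.1.2.1
  trace_eq_one := by rw [trace_add h₀.isTraceClass hθ.1.2.1, h₀.trace_eq_one, hθ.1.2.2, add_zero]
  pos := hθ.2.2

namespace IsFaithful

theorem isHS_sqrt (h : IsFaithful ρ) : IsHS (CFC.sqrt ρ) :=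
  (isHS_sqrt_iff h.nonneg).2 h.isTraceClass

theorem eq_zero_of_sqrt (h : IsFaithful ρ) {x : H} (hx : CFC.sqrt ρ x = 0) : x = 0 := by
  by_contra h0
  have := h.pos x h0
  rw [← norm_sqrt_apply_sq h.nonneg, hx] at this
  simp at this

theorem eq_zero_of_sqrt_mul (h : IsFaithful ρ) {X : H →L[ℂ] H} (hX : CFC.sqrt ρ * X = 0) :
    X = 0 := by
  ext x
  exact h.eq_zero_of_sqrt (by rw [← mul_apply_eq_comp, hX]; rfl)

theorem eq_zero_of_mul_sqrt (h : IsFaithful ρ) {X : H →L[ℂ] H} (hX : X * CFC.sqrt ρ = 0) :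
    X = 0 := by
  have : CFC.sqrt ρ * star X = 0 := by
    rw [← (sqrt_isSelfAdjoint ρ).star_eq, ← star_mul, hX, star_zero]
  rw [← star_star X, h.eq_zero_of_sqrt_mul this, star_zero]

theorem denseRange_sqrt (h : IsFaithful ρ) : DenseRange fun x : H => CFC.sqrt ρ x := by
  have h1 : (LinearMap.range ((CFC.sqrt ρ : H →L[ℂ] H) : H →ₗ[ℂ] H))ᗮ = ⊥ := by
    rw [eq_bot_iff]
    intro x hx
    refine h.eq_zero_of_sqrt (ext_inner_left ℂ fun y => ?_)
    rw [← (sqrt_isSelfAdjoint ρ).inner_comm_apply, inner_zero_right]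
    exact hx _ ⟨y, rfl⟩
  rw [← Submodule.topologicalClosure_eq_top_iff,
    ← Submodule.dense_iff_topologicalClosure_eq_top] at h1
  exact h1

theorem norm_hs_sqrt (h : IsFaithful ρ) : ⟪hs (CFC.sqrt ρ), hs (CFC.sqrt ρ)⟫_ℂ = 1 := by
  rw [← trace_star_mul h.isHS_sqrt h.isHS_sqrt, (sqrt_isSelfAdjoint ρ).star_eq,
    sqrt_mul_self h.nonneg, h.trace_eq_one]

end IsFaithful

/-- Take `R = f(s)` with `f(t) = t/(t² + ε)`, a bounded approximation to `s⁻¹`: `t f(t) ≤ 1`, and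
`|t² f(t) - t| = ε|t|/(t² + ε) ≤ √ε`. -/
theorem exists_regularizer {s : H →L[ℂ] H} (hs : IsSelfAdjoint s) {ε : ℝ} (hε : 0 < ε) :
    ∃ R : H →L[ℂ] H, IsSelfAdjoint R ∧ R * s = s * R ∧ ‖R * s‖ ≤ 1 ∧ ‖R * s * s - s‖ ≤ √ε := by
  have hpos : ∀ t : ℝ, t ^ 2 + ε ≠ 0 := fun t => by positivity
  have hc : Continuous fun t : ℝ => t / (t ^ 2 + ε) := by fun_prop (disch := exact hpos _)
  have h1 : cfc (fun t : ℝ => t / (t ^ 2 + ε)) s * s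
      = cfc (fun t : ℝ => t / (t ^ 2 + ε) * t) s := by
    rw [cfc_mul (fun t : ℝ => t / (t ^ 2 + ε)) (fun t => t) s hc.continuousOn continuousOn_id,
      cfc_id' ℝ s]
  refine ⟨cfc (fun t : ℝ => t / (t ^ 2 + ε)) s, cfc_predicate _ _, ?_, ?_, ?_⟩
  · have := (cfc_commute_cfc (fun t : ℝ => t / (t ^ 2 + ε)) (fun t => t) s).eq
    rwa [cfc_id' ℝ s] at this
  · rw [h1]
    refine norm_cfc_le zero_le_one fun t _ => ?_
    rw [Real.norm_eq_abs, div_mul_eq_mul_div, abs_of_nonneg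
      (div_nonneg (mul_self_nonneg t) (by positivity)), div_le_one (by positivity)]
    nlinarith
  · have h2 : cfc (fun t : ℝ => t / (t ^ 2 + ε)) s * s * s - s
        = cfc (fun t : ℝ => t / (t ^ 2 + ε) * t * t - t) s := by
      rw [cfc_sub (fun t : ℝ => t / (t ^ 2 + ε) * t * t) (fun t => t) s
          (by fun_prop (disch := exact hpos _)) continuousOn_id,
        cfc_mul (fun t : ℝ => t / (t ^ 2 + ε) * t) (fun t => t) s
          (by fun_prop (disch := exact hpos _)) continuousOn_id, h1, cfc_id' ℝ s]
    rw [h2]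
    refine norm_cfc_le (Real.sqrt_nonneg _) fun t _ => ?_
    have h3 : t / (t ^ 2 + ε) * t * t - t = -(ε * t / (t ^ 2 + ε)) := by
      have := hpos t
      field_simp
      ring
    rw [h3, norm_neg, Real.norm_eq_abs, abs_div, abs_mul, abs_of_pos hε,
      abs_of_pos (by positivity : 0 < t ^ 2 + ε), div_le_iff₀ (by positivity)]
    have h4 := Real.sq_sqrt hε.le
    have h5 := Real.sqrt_nonneg ε
    have h6 : t ^ 2 = |t| ^ 2 := (sq_abs t).symm
    rw [h6]
    nlinarith [sq_nonneg (√ε - |t|), abs_nonneg t, mul_nonneg h5 (abs_nonneg t)]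

theorem tendsto_of_denseRange {ι : Type*} {K : ℕ → H →L[ℂ] H} (hK : ∀ n, ‖K n‖ ≤ 1) {u : ι → H}
    (hu : DenseRange u) (h : ∀ y, Tendsto (fun n => K n (u y)) atTop (𝓝 (u y))) (x : H) :
    Tendsto (fun n => K n x) atTop (𝓝 x) := by
  rw [Metric.tendsto_atTop]
  intro ε hε
  obtain ⟨y, hy⟩ := hu.exists_dist_lt x (show 0 < ε / 3 by positivity)
  obtain ⟨N, hN⟩ := Metric.tendsto_atTop.1 (h y) (ε / 3) (by positivity)
  refine ⟨N, fun n hn => ?_⟩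
  have h1 : dist (K n x) (K n (u y)) ≤ dist x (u y) := by
    rw [dist_eq_norm, dist_eq_norm, ← map_sub]
    simpa using (K n).le_of_opNorm_le (hK n) (x - u y)
  have h2 := dist_triangle4 (K n x) (K n (u y)) (u y) x
  rw [dist_comm (u y) x] at h2
  linarith [hN n hn]

/-- Dominated convergence for the trace series: for `X = R S` the terms are at most `‖S* e_i‖ ‖R
e_i‖`, which is summable and independent of `n`. -/
theorem tendsto_trace_mul {K : ℕ → H →L[ℂ] H} (hK : ∀ n, ‖K n‖ ≤ 1)
    (hK' : ∀ x, Tendsto (fun n => K n x) atTop (𝓝 x)) {X : H →L[ℂ] H} (hX : IsTraceClass X) :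
    Tendsto (fun n => trace (K n * X)) atTop (𝓝 (trace X)) := by
  obtain ⟨R, S, hR, hS, rfl⟩ := hX.exists_mul
  have key : ∀ L : H →L[ℂ] H, trace (L * (R * S))
      = ∑' i, ⟪star S (onb H i), L (R (onb H i))⟫_ℂ := fun L => by
    rw [← mul_assoc, trace_mul_comm_of_isHS (hR.mul_left L) hS, trace_mul_eq hS (hR.mul_left L),
      ← (hasSum_inner_hs hS.star (hR.mul_left L)).tsum_eq]
    rfl
  simp only [key]
  rw [show trace (R * S) = trace (1 * (R * S)) by rw [one_mul], key]
  refine tendsto_tsum_of_dominated_convergence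
    (hS.star.summable.add hR.summable) (fun i => ?_) (Eventually.of_forall fun n i => ?_)
  · exact (tendsto_const_nhds).inner (hK' _)
  · refine (norm_inner_le_norm _ _).trans ?_
    have h1 : ‖K n (R (onb H i))‖ ≤ ‖R (onb H i)‖ := by
      simpa using (K n).le_of_opNorm_le (hK n) (R (onb H i))
    nlinarith [sq_nonneg (‖star S (onb H i)‖ - ‖R (onb H i)‖), norm_nonneg (star S (onb H i)),
      norm_nonneg (R (onb H i)), mul_le_mul_of_nonneg_left h1 (norm_nonneg (star S (onb H i))),
      sq_nonneg ‖star S (onb H i)‖, sq_nonneg ‖R (onb H i)‖]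

/-! ### Products with unbounded operators -/

theorem IsProd.unique {A : H →ₗ.[ℂ] H} {T S S' : H →L[ℂ] H} (h : IsProd A T S)
    (h' : IsProd A T S') : S = S' := by
  ext x
  obtain ⟨h1, h2⟩ := h x
  obtain ⟨h3, h4⟩ := h' x
  rw [← h2, ← h4]

theorem IsProd.prod_eq {A : H →ₗ.[ℂ] H} {T S : H →L[ℂ] H} (h : IsProd A T S) : prod A T = S := by
  have hex : ∃ S, IsProd A T S := ⟨S, h⟩
  rw [prod, dif_pos hex]
  exact hex.choose_spec.unique h

theorem IsProd.mul {A : H →ₗ.[ℂ] H} {T S : H →L[ℂ] H} (h : IsProd A T S) (X : H →L[ℂ] H) :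
    IsProd A (T * X) (S * X) := fun x => h (X x)

theorem IsProd.add {A : H →ₗ.[ℂ] H} {T T' S S' : H →L[ℂ] H} (h : IsProd A T S)
    (h' : IsProd A T' S') : IsProd A (T + T') (S + S') := fun x => by
  obtain ⟨h1, h2⟩ := h x
  obtain ⟨h3, h4⟩ := h' x
  refine ⟨A.domain.add_mem h1 h3, ?_⟩
  rw [add_apply S, ← h2, ← h4]
  exact A.toFun.map_add ⟨T x, h1⟩ ⟨T' x, h3⟩

theorem IsProd.smul {A : H →ₗ.[ℂ] H} {T S : H →L[ℂ] H} (h : IsProd A T S) (c : ℂ) :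
    IsProd A (c • T) (c • S) := fun x => by
  obtain ⟨h1, h2⟩ := h x
  refine ⟨A.domain.smul_mem c h1, ?_⟩
  change _ = c • S x
  rw [← h2]
  exact A.toFun.map_smul c ⟨T x, h1⟩

theorem inner_apply_comm_of_isSelfAdjoint {A : H →ₗ.[ℂ] H} (hA : IsSelfAdjoint A)
    (x y : A.domain) : ⟪A x, (y : H)⟫_ℂ = ⟪(x : H), A y⟫_ℂ := by
  have h := LinearPMap.adjoint_isFormalAdjoint hA.dense_domain
  rw [LinearPMap.isSelfAdjoint_def.1 hA] at h
  exact h x y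

/-- Both sides represent `s A s`, and `A` is symmetric on its domain. -/
theorem IsProd.star_mul_eq {A : H →ₗ.[ℂ] H} (hA : IsSelfAdjoint A) {s S : H →L[ℂ] H}
    (hs : IsSelfAdjoint s) (h : IsProd A s S) : star S * s = s * S := by
  ext y
  refine ext_inner_left ℂ fun x => ?_
  obtain ⟨h1, h2⟩ := h x
  obtain ⟨h3, h4⟩ := h y
  rw [mul_apply_eq_comp, mul_apply_eq_comp, inner_star_right, ← hs.inner_comm_apply x, ← h2, ← h4]
  exact inner_apply_comm_of_isSelfAdjoint hA ⟨_, h1⟩ ⟨_, h3⟩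

/-- `Tr[A φ] = Re ⟨A √ρ, T⟩` if `T` represents the logarithmic derivative in the direction `φ` and
`A φ` is trace class. -/
theorem IsFaithful.gradExpect_sldDir (hρ : IsFaithful ρ) {A : H →ₗ.[ℂ] H} (hA : IsSelfAdjoint A)
    {S T : H →L[ℂ] H} (hS : IsProd A (CFC.sqrt ρ) S) (hS2 : IsHS S) (hT : IsHS T)
    (hex : HasExpect (sldDir ρ T) A) : gradExpect A (sldDir ρ T) = ⟪hs S, hs T⟫_ℝ := by
  obtain ⟨Φ, hΦ, hΦ1⟩ := hex
  have hsa := sqrt_isSelfAdjoint ρ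
  have hs1 := hρ.isHS_sqrt
  rw [gradExpect, expect, hΦ.prod_eq]
  -- `A φ` is trace class, but `A` cannot be applied to the two halves of `φ` separately. The
  -- factors `K n = R n √ρ` converge strongly to `1` and allow `A` to be moved onto `√ρ`.
  have hreg := fun n : ℕ => exists_regularizer hsa (ε := 1 / ((n : ℝ) + 1)) (by positivity)
  choose R hR hRs hK1 hK2 using hreg
  have hK : ∀ x, Tendsto (fun n => (R n * CFC.sqrt ρ) x) atTop (𝓝 x) := by
    have hK3 : ∀ y, Tendsto (fun n => (R n * CFC.sqrt ρ) (CFC.sqrt ρ y)) atTop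
        (𝓝 (CFC.sqrt ρ y)) := fun y => by
      rw [tendsto_iff_norm_sub_tendsto_zero]
      refine squeeze_zero (fun _ => norm_nonneg _) (fun n => ?_)
        (g := fun n : ℕ => √(1 / ((n : ℝ) + 1)) * ‖y‖) ?_
      · exact (R n * CFC.sqrt ρ * CFC.sqrt ρ - CFC.sqrt ρ).le_of_opNorm_le (hK2 n) y
      · have h0 := (Real.continuous_sqrt.tendsto 0).comp
          (tendsto_one_div_add_atTop_nhds_zero_nat (𝕜 := ℝ))
        simpa using h0.mul_const ‖y‖
    exact tendsto_of_denseRange hK1 hρ.denseRange_sqrt hK3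
  have key : ∀ n, trace (R n * CFC.sqrt ρ * Φ)
      = 2⁻¹ * (trace (R n * CFC.sqrt ρ * (star S * T))
        + trace (R n * CFC.sqrt ρ * (S * star T))) := by
    intro n
    -- Formally `√ρ A = (A√ρ)* = S*`, which is bounded. After this replacement the direction can be
    -- split.
    have h1 : R n * CFC.sqrt ρ * Φ = R n * star S * sldDir ρ T := by
      ext y
      refine ext_inner_left ℂ fun x => ?_
      obtain ⟨h1, h2⟩ := hS (R n x)
      obtain ⟨h3, h4⟩ := hΦ y
      simp only [mul_apply_eq_comp]
      rw [← (hR n).inner_comm_apply, ← (hR n).inner_comm_apply, inner_star_right,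
        ← hsa.inner_comm_apply, ← h2, ← h4]
      exact (inner_apply_comm_of_isSelfAdjoint hA ⟨_, h1⟩ ⟨_, h3⟩).symm
    have h2 : trace (R n * star S * (T * CFC.sqrt ρ))
        = trace (R n * CFC.sqrt ρ * (star S * T)) := by
      rw [hRs n, ← mul_assoc, mul_assoc (R n), trace_mul_comm_of_isHS
        ((hT.mul_left (star S)).mul_left (R n)) hs1]
      simp only [mul_assoc]
    have h3 : R n * star S * (CFC.sqrt ρ * star T) = R n * CFC.sqrt ρ * (S * star T) := by
      rw [← mul_assoc, mul_assoc (R n), hS.star_mul_eq hA hsa]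
      simp only [mul_assoc]
    rw [h1, sldDir, mul_smul_comm, trace_smul, mul_add, h3, trace_add _ _, h2]
    · exact (isTraceClass_mul hT hs1).mul_left _
    · exact (isTraceClass_mul hS2 hT.star).mul_left _
  have hlim := tendsto_trace_mul hK1 hK hΦ1
  simp only [key] at hlim
  have hlim' := ((tendsto_trace_mul hK1 hK (isTraceClass_mul hS2.star hT)).add
    (tendsto_trace_mul hK1 hK (isTraceClass_mul hS2 hT.star))).const_mul (2⁻¹ : ℂ)
  rw [tendsto_nhds_unique hlim hlim', trace_star_mul hS2 hT, trace_mul_eq hS2 hT.star,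
    inner_hs_star hS2 hT, ← inner_conj_symm (hs T), Complex.add_conj, real_inner_eq_re]
  simp

end QM

/-! ### The form of the pseudo-inverse on a subspace of directions -/

section PinvForm

variable {U V : Type*} [NormedAddCommGroup U] [InnerProductSpace ℝ U]
  [NormedAddCommGroup V] [InnerProductSpace ℝ V] [CompleteSpace V]

/-- Replacing `t` by `c t` makes the bound a nonnegative quadratic polynomial in `c`; its
discriminant gives `|a t| ≤ √p ‖L t‖`. So `a` factors through `L`, and the Riesz vector of the
factor is `f`. It lies in the closure because the factor vanishes on the complement. -/
theorem exists_mem_closure_of_forall_le (D : Submodule ℝ U) (L : U →ₗ[ℝ] V) (a : U →ₗ[ℝ] ℝ) {p : ℝ}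
    (h : ∀ t ∈ D, 2 * a t - ‖L t‖ ^ 2 ≤ p) :
    ∃ f ∈ (D.map L).topologicalClosure, ‖f‖ ^ 2 ≤ p ∧ ∀ t ∈ D, ⟪f, L t⟫_ℝ = a t := by
  have hp : 0 ≤ p := by simpa using h 0 D.zero_mem
  have hb : ∀ t ∈ D, |a t| ≤ √p * ‖L t‖ := fun t ht => by
    have h1 : ∀ c : ℝ, 0 ≤ ‖L t‖ ^ 2 * (c * c) + (-2 * a t) * c + p := fun c => by
      have := h (c • t) (D.smul_mem c ht)
      rw [map_smul, map_smul, norm_smul, mul_pow, Real.norm_eq_abs, sq_abs, smul_eq_mul] at this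
      nlinarith
    have h2 := discrim_le_zero h1
    rw [discrim] at h2
    refine abs_le_of_sq_le_sq ?_ (by positivity)
    rw [mul_pow, Real.sq_sqrt hp]
    nlinarith
  obtain ⟨W, hW, hn, h0⟩ := exists_factor_of_norm_le (𝕜 := ℝ) (L ∘ₗ D.subtype) (a ∘ₗ D.subtype)
    (Real.sqrt_nonneg p) fun t => hb t t.2
  have hf : ∀ v, ⟪(InnerProductSpace.toDual ℝ V).symm W, v⟫_ℝ = W v := fun v =>
    InnerProductSpace.toDual_symm_apply
  refine ⟨(InnerProductSpace.toDual ℝ V).symm W, ?_, ?_, fun t ht => ?_⟩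
  · rw [← Submodule.orthogonal_orthogonal_eq_closure, Submodule.mem_orthogonal']
    intro v hv
    rw [hf]
    refine h0 v ?_
    rwa [LinearMap.range_comp, Submodule.range_subtype]
  · rw [LinearIsometryEquiv.norm_map]
    calc ‖W‖ ^ 2 ≤ √p ^ 2 := pow_le_pow_left₀ (norm_nonneg _) hn 2
      _ = p := Real.sq_sqrt hp
  · rw [hf]; exact hW ⟨t, ht⟩

theorem two_mul_sub_le_norm_sq {f v : V} : 2 * ⟪f, v⟫_ℝ - ‖v‖ ^ 2 ≤ ‖f‖ ^ 2 := by
  have := norm_sub_sq_real f v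
  nlinarith [sq_nonneg ‖f - v‖]

theorem ereal_sub_ofReal {x y : ℝ} (hy : 0 ≤ y) :
    (x : EReal) - ((ENNReal.ofReal y : ℝ≥0∞) : EReal) = ((x - y : ℝ) : EReal) := by
  rw [EReal.coe_ennreal_ofReal, max_eq_left hy, EReal.coe_sub]

/-- The value of the form at a functional represented by a vector `f` of the tangent space. -/
theorem pinvForm_eq_norm_sq {E : Type*} {S : Set E} {α : E → ℝ} {q : E → ℝ≥0∞}
    (D : Submodule ℝ U) (L : U →ₗ[ℝ] V) (e : U → E) (hS : S = e '' D)
    (hq : ∀ t ∈ D, q (e t) = ENNReal.ofReal (‖L t‖ ^ 2)) {f : V}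
    (hf : f ∈ (D.map L).topologicalClosure) (hα : ∀ t ∈ D, α (e t) = ⟪f, L t⟫_ℝ) :
    pinvForm S α q = ((‖f‖ ^ 2 : ℝ) : EReal) := by
  subst hS
  have hval : ∀ t ∈ D, ((2 * α (e t) : ℝ) : EReal) - ((q (e t) : ℝ≥0∞) : EReal)
      = ((2 * ⟪f, L t⟫_ℝ - ‖L t‖ ^ 2 : ℝ) : EReal) := fun t ht => by
    rw [hq t ht, hα t ht, ereal_sub_ofReal (sq_nonneg _)]
  unfold pinvForm
  rw [iSup_image]
  refine le_antisymm (iSup₂_le fun t ht => ?_) ?_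
  · rw [hval t ht]
    exact EReal.coe_le_coe_iff.2 two_mul_sub_le_norm_sq
  -- The supremum need not be attained: `f` is only a limit of vectors `L t`, at which the objective
  -- comes arbitrarily close to `‖f‖²`.
  · refine EReal.ge_of_forall_gt_iff_ge.1 fun z hz => ?_
    rw [EReal.coe_lt_coe_iff] at hz
    have hcont : Filter.Tendsto (fun v : V => 2 * ⟪f, v⟫_ℝ - ‖v‖ ^ 2) (nhds f)
        (nhds (‖f‖ ^ 2)) := by
      have : Continuous fun v : V => 2 * ⟪f, v⟫_ℝ - ‖v‖ ^ 2 := by fun_prop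
      convert this.tendsto f using 2
      rw [real_inner_self_eq_norm_sq]; ring
    obtain ⟨v, hv1, t, ht, rfl⟩ := mem_closure_iff_nhds.1 hf _ (hcont (Ioi_mem_nhds hz))
    refine le_iSup₂_of_le t ht ?_
    rw [hval t ht]
    exact EReal.coe_le_coe_iff.2 (le_of_lt hv1)

/-- Here `f` may have a component orthogonal to the tangent vectors, so only an upper bound remains.
It shows that any unbiased estimator makes the error finite. -/
theorem pinvForm_le_norm_sq {E : Type*} {S : Set E} {α : E → ℝ} {q : E → ℝ≥0∞}
    (D : Submodule ℝ U) (L : U →ₗ[ℝ] V) (e : U → E) (hS : S = e '' D)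
    (hq : ∀ t ∈ D, q (e t) = ENNReal.ofReal (‖L t‖ ^ 2)) {f : V}
    (hα : ∀ t ∈ D, α (e t) = ⟪f, L t⟫_ℝ) :
    pinvForm S α q ≤ ((‖f‖ ^ 2 : ℝ) : EReal) := by
  subst hS
  unfold pinvForm
  rw [iSup_image]
  refine iSup₂_le fun t ht => ?_
  rw [hq t ht, hα t ht, ereal_sub_ofReal (sq_nonneg _)]
  exact EReal.coe_le_coe_iff.2 two_mul_sub_le_norm_sq

/-- A finite form comes from a vector of the tangent space. -/
theorem exists_of_pinvForm_ne_top {E : Type*} {S : Set E} {α : E → ℝ} {q : E → ℝ≥0∞}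
    (D : Submodule ℝ U) (L : U →ₗ[ℝ] V) (e : U → E) (hS : S = e '' D)
    (hq : ∀ t ∈ D, q (e t) ≤ ENNReal.ofReal (‖L t‖ ^ 2)) (a : U →ₗ[ℝ] ℝ)
    (hα : ∀ t ∈ D, α (e t) = a t) (htop : pinvForm S α q ≠ ⊤) :
    ∃ f ∈ (D.map L).topologicalClosure, ((‖f‖ ^ 2 : ℝ) : EReal) ≤ pinvForm S α q ∧
      ∀ t ∈ D, ⟪f, L t⟫_ℝ = a t := by
  subst hS
  have hle : ∀ t ∈ D, ((2 * a t - ‖L t‖ ^ 2 : ℝ) : EReal) ≤ pinvForm (e '' D) α q := fun t ht => by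
    unfold pinvForm
    rw [iSup_image]
    refine le_iSup₂_of_le t ht ?_
    rw [hα t ht, ← ereal_sub_ofReal (sq_nonneg _)]
    exact EReal.sub_le_sub le_rfl (EReal.coe_ennreal_le_coe_ennreal_iff.2 (hq t ht))
  have hbot : pinvForm (e '' D) α q ≠ ⊥ := fun h => by
    have := hle 0 D.zero_mem
    rw [h, le_bot_iff] at this
    exact EReal.coe_ne_bot _ this
  lift pinvForm (e '' D) α q to ℝ using ⟨htop, hbot⟩ with p
  obtain ⟨f, hf, hfp, h⟩ := exists_mem_closure_of_forall_le D L a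
    fun t ht => EReal.coe_le_coe_iff.1 (hle t ht)
  exact ⟨f, hf, EReal.coe_le_coe_iff.2 hfp, h⟩

end PinvForm

/-! ### The tangent space of admissible directions -/

namespace QM

variable {H : Type*} [NormedAddCommGroup H] [InnerProductSpace ℂ H] [CompleteSpace H]

open HSSpace Filter Topology

variable {ρ : H →L[ℂ] H}

theorem sldDir_add (S T : H →L[ℂ] H) : sldDir ρ (S + T) = sldDir ρ S + sldDir ρ T := by
  simp only [sldDir, add_mul, star_add, mul_add, ← smul_add]
  congr 1
  abel

theorem sldDir_smul (c : ℝ) (T : H →L[ℂ] H) : sldDir ρ ((c : ℂ) • T) = (c : ℂ) • sldDir ρ T := by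
  rw [sldDir, sldDir, star_smul, smul_mul_assoc, mul_smul_comm, Complex.star_def,
    Complex.conj_ofReal, ← smul_add, smul_comm]

theorem HasExpect.add {φ ψ : H →L[ℂ] H} {A : H →ₗ.[ℂ] H} (h : HasExpect φ A)
    (h' : HasExpect ψ A) : HasExpect (φ + ψ) A := by
  obtain ⟨S, h1, h2⟩ := h
  obtain ⟨S', h3, h4⟩ := h'
  exact ⟨S + S', h1.add h3, h2.add h4⟩

theorem HasExpect.smul {φ : H →L[ℂ] H} {A : H →ₗ.[ℂ] H} (h : HasExpect φ A) (c : ℂ) :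
    HasExpect (c • φ) A := by
  obtain ⟨S, h1, h2⟩ := h
  exact ⟨c • S, h1.smul c, h2.smul c⟩

/-- The logarithmic derivatives of the admissible directions in which the observables of `𝒜` have
finite expectation values. -/
def sldSpace (ρ : H →L[ℂ] H) (𝒜 : Set (H →ₗ.[ℂ] H)) : Submodule ℝ (HSSpace H) where
  carrier := {t | IsSelfAdjoint (CFC.sqrt ρ * op t) ∧ ⟪hs (CFC.sqrt ρ), t⟫_ℝ = 0 ∧
    ∀ A ∈ 𝒜, HasExpect (sldDir ρ (op t)) A}
  zero_mem' := by
    refine ⟨by simp, by simp, fun A _ => ⟨0, fun x => ?_, isTraceClass_zero⟩⟩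
    have : sldDir ρ (op (0 : HSSpace H)) x = 0 := by simp [sldDir]
    refine ⟨this ▸ A.domain.zero_mem, ?_⟩
    simp only [this]
    exact A.toFun.map_zero
  add_mem' := by
    rintro s t ⟨h1, h2, h3⟩ ⟨h4, h5, h6⟩
    refine ⟨?_, by rw [inner_add_right, h2, h5, add_zero], fun A hA => ?_⟩
    · rw [map_add, mul_add]; exact h1.add h4
    · rw [map_add, sldDir_add]; exact (h3 A hA).add (h6 A hA)
  smul_mem' := by
    rintro c t ⟨h1, h2, h3⟩
    have hc : c • t = (c : ℂ) • t := rfl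
    refine ⟨?_, by rw [inner_smul_right, h2, mul_zero], fun A hA => ?_⟩
    · rw [hc, map_smul, mul_smul_comm]
      exact IsSelfAdjoint.smul (Complex.conj_ofReal c) h1
    · rw [hc, map_smul, sldDir_smul]; exact (h3 A hA).smul _

/-- This replaces the nonlinear-looking set of directions by a linear image of a subspace. Trace
zero becomes orthogonality to `√ρ`, and finite information means that some representative of the
derivative is Hilbert-Schmidt. -/
theorem IsFaithful.directions_eq (hρ : IsFaithful ρ) (𝒜 : Set (H →ₗ.[ℂ] H)) :
    directions ρ ∩ {φ | ∀ A ∈ 𝒜, HasExpect φ A} = (fun t => sldDir ρ (op t)) '' sldSpace ρ 𝒜 := by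
  have hs1 := hρ.isHS_sqrt
  have htr : ∀ {T : H →L[ℂ] H}, IsHS T →
      trace (sldDir ρ T) = ((⟪hs (CFC.sqrt ρ), hs T⟫_ℝ : ℝ) : ℂ) := fun {T} hT => by
    have := trace_sldDir_mul hs1 hT (IsSelfAdjoint.one (H →L[ℂ] H))
    rwa [mul_one, one_mul, real_inner_comm] at this
  ext φ
  constructor
  · rintro ⟨⟨⟨h1, h2, h3⟩, h4⟩, h5⟩
    obtain ⟨T, hT, hT2⟩ : ∃ T, IsSLD ρ φ T ∧ IsHS T := by
      by_contra hcon
      push Not at hcon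
      refine h4 (iInf₂_eq_top.2 fun T hT => ?_)
      have := hcon T hT
      rwa [IsHS, not_not] at this
    have hφ : φ = sldDir ρ T := hT.eq
    refine ⟨hs T, ⟨by rw [op_hs hT2]; exact hT.symm, ?_, ?_⟩, ?_⟩
    · rw [hφ, htr hT2] at h3; exact_mod_cast h3
    · rw [op_hs hT2, ← hφ]; exact h5
    · simp only [op_hs hT2, hφ]
  · rintro ⟨t, ⟨h1, h2, h3⟩, rfl⟩
    refine ⟨⟨⟨isSelfAdjoint_sldDir _, isTraceClass_sldDir hs1 (isHS_op t), ?_⟩, ?_⟩, h3⟩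
    · rw [htr (isHS_op t), hs_op, h2, Complex.ofReal_zero]
    · have hsld : IsSLD ρ (sldDir ρ (op t)) (op t) :=
        ⟨fun x hx => ?_, h1, rfl⟩
      · exact ne_top_of_le_ne_top (isHS_op t) (iInf₂_le (op t) hsld)
      · by_cases h0 : x = 0
        · rw [h0, map_zero]
        · have := hρ.pos x h0
          rw [hx, inner_zero_right] at this
          simp at this

/-- A symmetric logarithmic derivative that is orthogonal to those of all directions in which the
expectation values of `𝒜` are finite is constant. -/
theorem IsFaithful.eq_smul_of_forall_inner_eq_zero (hρ : IsFaithful ρ) {𝒜 : Set (H →ₗ.[ℂ] H)}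
    (h𝒜 : ∀ A ∈ 𝒜, HasSecondMoment ρ A) {y : HSSpace H}
    (hy : IsSelfAdjoint (CFC.sqrt ρ * op y)) (h : ∀ t ∈ sldSpace ρ 𝒜, ⟪y, t⟫_ℝ = 0) :
    ∃ c : ℝ, y = (c : ℂ) • hs (CFC.sqrt ρ) := by
  have hs1 := hρ.isHS_sqrt
  have hsa := sqrt_isSelfAdjoint ρ
  have hρsa : IsSelfAdjoint ρ := IsSelfAdjoint.of_nonneg hρ.nonneg
  have hρs : CFC.sqrt ρ * CFC.sqrt ρ = ρ := sqrt_mul_self hρ.nonneg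
  have hρ2 : IsHS ρ := hρs ▸ hs1.mul_left _
  set s := CFC.sqrt ρ with hs_def
  set Q := s * op y with hQ_def
  have hQ2 : IsHS Q := (isHS_op y).mul_left _
  have hn : (⟪hs ρ, hs ρ⟫_ℝ : ℝ) ≠ 0 := by
    rw [inner_self_ne_zero]
    intro h0
    have : ρ = 0 := by rw [← op_hs hρ2, h0, map_zero]
    have h1 := hρ.trace_eq_one
    rw [this, trace_zero] at h1
    exact zero_ne_one h1
  -- `R` is the part of `√ρ y` orthogonal to `ρ`; the goal is `R = 0`. The test direction is `√ρ Z
  -- ρ`, with `Z = R - d` and `d` chosen so that it is orthogonal to `√ρ`.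
  set c : ℝ := ⟪hs Q, hs ρ⟫_ℝ / ⟪hs ρ, hs ρ⟫_ℝ with hc
  set R := Q - (c : ℂ) • ρ with hR_def
  have hRsa : IsSelfAdjoint R := hy.sub (IsSelfAdjoint.smul (Complex.conj_ofReal c) hρsa)
  have hR2 : IsHS R := hQ2.sub (hρ2.smul _)
  set d : ℝ := ⟪hs ρ, hs (R * ρ)⟫_ℝ / ⟪hs ρ, hs ρ⟫_ℝ with hd
  set Z := R - (d : ℂ) • (1 : H →L[ℂ] H) with hZ_def
  have hZsa : IsSelfAdjoint Z :=
    hRsa.sub (IsSelfAdjoint.smul (Complex.conj_ofReal d) (IsSelfAdjoint.one _))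
  have hZρ : hs (Z * ρ) = hs (R * ρ) - d • hs ρ := by
    rw [hZ_def, sub_mul, smul_mul_assoc, one_mul, hs_sub (hρ2.mul_left R) (hρ2.smul _),
      hs_smul _ hρ2]
    rfl
  have ht2 : IsHS (s * (Z * ρ)) := (hρ2.mul_left Z).mul_left s
  have hinner : ∀ X : H →L[ℂ] H, IsHS X → IsSelfAdjoint (s * X) →
      ⟪hs X, hs (s * (Z * ρ))⟫_ℝ = ⟪hs (s * X), hs (Z * ρ)⟫_ℝ := fun X hX hsX => by
    rw [real_inner_eq_re, real_inner_eq_re, ← trace_star_mul hX ht2,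
      ← trace_star_mul (hX.mul_left s) (hρ2.mul_left Z), star_mul, hsa.star_eq, mul_assoc]
  have hmem : hs (s * (Z * ρ)) ∈ sldSpace ρ 𝒜 := by
    refine ⟨?_, ?_, fun A hA => ?_⟩
    · rw [op_hs ht2, ← hs_def, ← mul_assoc, hρs, IsSelfAdjoint, star_mul, star_mul, hρsa.star_eq,
        hZsa.star_eq, mul_assoc]
    · rw [← hs_def, hinner s hs1 (hρs ▸ hρsa), hρs, hZρ, inner_sub_right, inner_smul_right, hd,
        div_mul_cancel₀ _ hn, sub_self]
    -- Both terms of the test direction begin with `√ρ`, so `A` acts on them through the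
    -- Hilbert-Schmidt operator `A√ρ`.
    · obtain ⟨S, hS, hS2⟩ := h𝒜 A hA
      have hstar : star (s * (Z * ρ)) = ρ * Z * s := by
        rw [star_mul, star_mul, hρsa.star_eq, hZsa.star_eq, hsa.star_eq]
      refine ⟨(2⁻¹ : ℂ) • (S * (Z * ρ * s) + S * (ρ * Z * s)), ?_, ?_⟩
      · rw [op_hs ht2, sldDir, hstar, ← hs_def, mul_assoc s]
        exact ((hS.mul _).add (hS.mul _)).smul _
      · exact ((isTraceClass_mul hS2 (hs1.mul_left _)).add
          (isTraceClass_mul hS2 (hs1.mul_left _))).smul _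
  have h0 := h _ hmem
  have hyop : ⟪y, hs (s * (Z * ρ))⟫_ℝ = ⟪hs Q, hs (Z * ρ)⟫_ℝ := by
    have := hinner (op y) (isHS_op y) hy
    rwa [hs_op] at this
  -- The choices of `c` and `d` make the two correction terms cancel, leaving `‖R√ρ‖² = 0`.
  have hRR : ⟪hs R, hs (R * ρ)⟫_ℝ = 0 := by
    rw [hyop, hZρ, inner_sub_right, inner_smul_right] at h0
    have e : hs R = hs Q - c • hs ρ := by
      rw [hR_def, hs_sub hQ2 (hρ2.smul _), hs_smul _ hρ2]; rfl
    rw [e, inner_sub_left, real_inner_smul_left, ← h0, hc, hd]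
    ring
  have hRs : hs (R * s) = 0 := by
    have hRs2 := hs1.mul_left R
    have : trace (star (R * s) * (R * s)) = trace (star R * (R * ρ)) := by
      rw [star_mul, hsa.star_eq, mul_assoc, trace_mul_comm_of_isHS hs1 (hRs2.mul_left _),
        mul_assoc, mul_assoc, hρs]
    rw [trace_star_mul hRs2 hRs2, trace_star_mul hR2 (hρ2.mul_left R)] at this
    rw [← inner_self_eq_zero (𝕜 := ℝ), real_inner_eq_re, this, ← real_inner_eq_re, hRR]
  have hR0 : R = 0 := hρ.eq_zero_of_mul_sqrt (by
    rw [← hs_def, ← op_hs (hs1.mul_left R), hRs, map_zero])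
  refine ⟨c, op_injective ?_⟩
  rw [map_smul, op_hs hs1, ← sub_eq_zero]
  refine hρ.eq_zero_of_sqrt_mul ?_
  rw [← hs_def, mul_sub, mul_smul_comm, hρs, ← hQ_def, ← hR_def, hR0]

end QM

/-- The Cauchy-Schwarz inequality for the defect `1 - W* W` of a contraction. -/
theorem norm_inner_sub_inner_sq_le {F G : Type*} [NormedAddCommGroup F] [InnerProductSpace ℂ F]
    [CompleteSpace F] [NormedAddCommGroup G] [InnerProductSpace ℂ G] [CompleteSpace G]
    {W : F →L[ℂ] G} (hW : ‖W‖ ≤ 1) (x y : F) :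
    ‖⟪x, y⟫_ℂ - ⟪W x, W y⟫_ℂ‖ ^ 2 ≤ (‖x‖ ^ 2 - ‖W x‖ ^ 2) * (‖y‖ ^ 2 - ‖W y‖ ^ 2) := by
  have hle : ∀ v, ‖W v‖ ≤ ‖v‖ := fun v => by simpa using W.le_of_opNorm_le hW v
  -- `D` is positive because `W` is a contraction, so its form is an inner product of vectors `√D x`
  -- and ordinary Cauchy-Schwarz applies.
  let D : F →L[ℂ] F := 1 - ContinuousLinearMap.adjoint W ∘L W
  have hDi : ∀ u v, ⟪u, D v⟫_ℂ = ⟪u, v⟫_ℂ - ⟪W u, W v⟫_ℂ := fun u v => by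
    simp [D, ContinuousLinearMap.adjoint_inner_right]
  have hD : 0 ≤ D := QM.nonneg_of_inner fun v => by
    rw [hDi, QM.inner_self_eq_ofReal_norm_sq, QM.inner_self_eq_ofReal_norm_sq, sub_nonneg]
    exact Complex.real_le_real.2 (pow_le_pow_left₀ (norm_nonneg _) (hle v) 2)
  have h1 : ∀ u v, ⟪u, D v⟫_ℂ = ⟪CFC.sqrt D u, CFC.sqrt D v⟫_ℂ := fun u v => by
    rw [(QM.sqrt_isSelfAdjoint _).inner_comm_apply, ← mul_apply_eq_comp, QM.sqrt_mul_self hD]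
  have h2 : ∀ v, ‖v‖ ^ 2 - ‖W v‖ ^ 2 = ‖CFC.sqrt D v‖ ^ 2 := fun v => by
    rw [QM.norm_sqrt_apply_sq hD, hDi, Complex.sub_re, ← inner_self_eq_norm_sq (𝕜 := ℂ),
      ← inner_self_eq_norm_sq (𝕜 := ℂ)]
    rfl
  rw [← hDi, h1, h2, h2, ← mul_pow]
  exact pow_le_pow_left₀ (norm_nonneg _) (norm_inner_le_norm _ _) 2

/-! ### Unbiased estimators and the uncertainty relation -/

namespace QM

variable {H : Type*} [NormedAddCommGroup H] [InnerProductSpace ℂ H] [CompleteSpace H]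

open HSSpace Filter Topology

variable {Ω : Type*} [MeasurableSpace Ω] {M : Set Ω → H →L[ℂ] H} {ρ : H →L[ℂ] H}

theorem lp_induction_indicator {μ : Measure Ω} [IsFiniteMeasure μ] {p : Lp ℝ 2 μ → Prop}
    (hadd : ∀ f g, p f → p g → p (f + g)) (hsmul : ∀ (c : ℝ) f, p f → p (c • f))
    (hcl : IsClosed {f | p f})
    (hind : ∀ C (hC : MeasurableSet C), p (indicatorConstLp 2 hC (measure_ne_top _ _) 1))
    (f : Lp ℝ 2 μ) : p f := by
  refine Lp.induction (by simp) (motive := p) ?_ ?_ hcl f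
  · intro c C hC hμ
    rw [Lp.simpleFunc.coe_indicatorConst]
    have : indicatorConstLp 2 hC hμ.ne c = c • indicatorConstLp 2 hC hμ.ne (1 : ℝ) := by
      refine Lp.ext ?_
      filter_upwards [Lp.coeFn_smul c (indicatorConstLp 2 hC hμ.ne (1 : ℝ)),
        indicatorConstLp_coeFn (p := 2) (hs := hC) (hμs := hμ.ne) (c := (1 : ℝ)),
        indicatorConstLp_coeFn (p := 2) (hs := hC) (hμs := hμ.ne) (c := c)] with ω h1 h2 h3
      rw [h1, Pi.smul_apply, h2, h3]
      by_cases hω : ω ∈ C <;> simp [hω]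
    rw [this]
    exact hsmul c _ (hind C hC)
  · intro f g hf hg _ h1 h2
    exact hadd _ _ h1 h2

theorem clm_ext_indicator {G : Type*} [NormedAddCommGroup G] [NormedSpace ℝ G] {μ : Measure Ω}
    [IsFiniteMeasure μ] {S T : Lp ℝ 2 μ →L[ℝ] G}
    (h : ∀ C (hC : MeasurableSet C), S (indicatorConstLp 2 hC (measure_ne_top _ _) 1)
      = T (indicatorConstLp 2 hC (measure_ne_top _ _) 1)) : S = T := by
  ext f
  refine lp_induction_indicator (p := fun f => S f = T f) (fun f g hf hg => ?_) (fun c f hf => ?_)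
    (isClosed_eq S.continuous T.continuous) h f
  · rw [map_add, map_add, hf, hg]
  · rw [map_smul, map_smul, hf]

theorem continuous_op_apply (x : H) : Continuous fun t : HSSpace H => op t x :=
  (LinearMap.mkContinuous
    ({ toFun := fun t : HSSpace H => op t x
       map_add' := fun s t => by rw [map_add, add_apply]
       map_smul' := fun c t => by rw [map_smul]; rfl } : HSSpace H →ₗ[ℂ] H) ‖x‖
    fun t => (norm_op_apply_le t x).trans_eq (mul_comm _ _)).continuous

theorem isClosed_isSelfAdjoint_mul_op (s : H →L[ℂ] H) :
    IsClosed {t : HSSpace H | IsSelfAdjoint (s * op t)} := by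
  have : {t : HSSpace H | IsSelfAdjoint (s * op t)}
      = ⋂ (x : H) (y : H), {t | ⟪s (op t x), y⟫_ℂ = ⟪x, s (op t y)⟫_ℂ} := by
    ext t
    simp only [Set.mem_ofPred_eq, Set.mem_iInter]
    constructor
    · intro h x y
      exact h.inner_comm_apply x y
    · intro h
      rw [IsSelfAdjoint]
      ext y
      refine ext_inner_left ℂ fun x => ?_
      rw [inner_star_right]
      exact h x y
  rw [this]
  refine isClosed_iInter fun x => isClosed_iInter fun y => isClosed_eq ?_ ?_
  · exact (s.continuous.comp (continuous_op_apply x)).inner continuous_const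
  · exact continuous_const.inner (s.continuous.comp (continuous_op_apply y))

/-- Real integrals are limits of real combinations of `M(C)√ρ`, for which `√ρ M(C) √ρ` is
self-adjoint, and the condition is closed. Thus every real estimator integrates to a symmetric
derivative. -/
theorem IsPOVM.isSelfAdjoint_realIntegralCLM (hM : IsPOVM M) (hρ : 0 ≤ ρ) (hρ1 : IsTraceClass ρ)
    (f : Lp ℝ 2 (law M ρ)) : IsSelfAdjoint (CFC.sqrt ρ * op (realIntegralCLM M ρ f)) := by
  refine lp_induction_indicator
    (p := fun f => IsSelfAdjoint (CFC.sqrt ρ * op (realIntegralCLM M ρ f))) (fun f g hf hg => ?_)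
    (fun c f hf => ?_) ?_ (fun C hC => ?_) f
  · rw [map_add, map_add, mul_add]; exact hf.add hg
  · have : realIntegralCLM M ρ (c • f) = (c : ℂ) • realIntegralCLM M ρ f := by
      rw [map_smul]; rfl
    rw [this, map_smul, mul_smul_comm]
    exact IsSelfAdjoint.smul (Complex.conj_ofReal c) hf
  · exact (isClosed_isSelfAdjoint_mul_op _).preimage (realIntegralCLM M ρ).continuous
  · rw [hM.realIntegralCLM_indicator hρ hρ1, op_hs (((isHS_sqrt_iff hρ).2 hρ1).mul_left _),
      IsSelfAdjoint, star_mul, star_mul, (sqrt_isSelfAdjoint ρ).star_eq,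
      (IsSelfAdjoint.of_nonneg (hM.nonneg C hC)).star_eq, mul_assoc]

theorem IsPOVM.inner_sqrt_realIntegralCLM (hM : IsPOVM M) (hρ : 0 ≤ ρ) (hρ1 : IsTraceClass ρ)
    (f : Lp ℝ 2 (law M ρ)) :
    ⟪hs (CFC.sqrt ρ), realIntegralCLM M ρ f⟫_ℝ
      = ⟪indicatorConstLp 2 MeasurableSet.univ (measure_ne_top _ _) 1, f⟫_ℝ := by
  refine lp_induction_indicator
    (p := fun f => ⟪hs (CFC.sqrt ρ), realIntegralCLM M ρ f⟫_ℝ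
      = ⟪indicatorConstLp 2 MeasurableSet.univ (measure_ne_top _ _) 1, f⟫_ℝ) (fun f g hf hg => ?_)
    (fun c f hf => ?_) ?_ (fun C hC => ?_) f
  · rw [map_add, inner_add_right, inner_add_right, hf, hg]
  · rw [map_smul, inner_smul_right, inner_smul_right, hf]
  · exact isClosed_eq (by fun_prop) (by fun_prop)
  · rw [hM.realIntegralCLM_indicator hρ hρ1, real_inner_eq_re, ← hM.law_real hρ hρ1 hC,
      Complex.ofReal_re, real_inner_comm, L2.inner_indicatorConstLp_one,
      setIntegral_congr_ae (g := fun _ => (1 : ℝ)) hC]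
    · simp
    · filter_upwards [indicatorConstLp_coeFn (p := 2) (hs := MeasurableSet.univ)
        (hμs := measure_ne_top (law M ρ) _) (c := (1 : ℝ))] with ω hω _
      rw [hω]; simp

/-- `A √ρ` for an observable of finite second moment. -/
theorem HasSecondMoment.isProd {A : H →ₗ.[ℂ] H} (h : HasSecondMoment ρ A) :
    IsProd A (CFC.sqrt ρ) (prod A (CFC.sqrt ρ)) := by
  obtain ⟨S, hS, -⟩ := h
  rwa [hS.prod_eq]

theorem HasSecondMoment.isHS {A : H →ₗ.[ℂ] H} (h : HasSecondMoment ρ A) :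
    IsHS (prod A (CFC.sqrt ρ)) := by
  obtain ⟨S, hS, hS2⟩ := h
  rwa [hS.prod_eq]

theorem HasSecondMoment.isSelfAdjoint {A : H →ₗ.[ℂ] H} (hA : IsSelfAdjoint A)
    (h : HasSecondMoment ρ A) : IsSelfAdjoint (CFC.sqrt ρ * prod A (CFC.sqrt ρ)) := by
  rw [IsSelfAdjoint, star_mul, (sqrt_isSelfAdjoint ρ).star_eq,
    h.isProd.star_mul_eq hA (sqrt_isSelfAdjoint ρ)]

theorem IsFaithful.expect_eq (hρ : IsFaithful ρ) {A : H →ₗ.[ℂ] H} (hA : IsSelfAdjoint A)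
    (h : HasSecondMoment ρ A) :
    expect ρ A = ((⟪hs (CFC.sqrt ρ), hs (prod A (CFC.sqrt ρ))⟫_ℝ : ℝ) : ℂ) ∧
      ⟪hs (CFC.sqrt ρ), hs (prod A (CFC.sqrt ρ))⟫_ℂ
        = ((⟪hs (CFC.sqrt ρ), hs (prod A (CFC.sqrt ρ))⟫_ℝ : ℝ) : ℂ) := by
  have hs1 := hρ.isHS_sqrt
  have h1 : ⟪hs (CFC.sqrt ρ), hs (prod A (CFC.sqrt ρ))⟫_ℂ
      = trace (CFC.sqrt ρ * prod A (CFC.sqrt ρ)) := by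
    rw [← trace_star_mul hs1 h.isHS, (sqrt_isSelfAdjoint ρ).star_eq]
  have h2 : star (trace (CFC.sqrt ρ * prod A (CFC.sqrt ρ)))
      = trace (CFC.sqrt ρ * prod A (CFC.sqrt ρ)) := by
    rw [← trace_star, (h.isSelfAdjoint hA).star_eq]
  have h3 : ⟪hs (CFC.sqrt ρ), hs (prod A (CFC.sqrt ρ))⟫_ℂ
      = ((⟪hs (CFC.sqrt ρ), hs (prod A (CFC.sqrt ρ))⟫_ℝ : ℝ) : ℂ) := by
    rw [real_inner_eq_re, h1]
    exact (Complex.conj_eq_iff_re.1 h2).symm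
  refine ⟨?_, h3⟩
  have h4 : IsProd A ρ (prod A (CFC.sqrt ρ) * CFC.sqrt ρ) := by
    have := h.isProd.mul (CFC.sqrt ρ)
    rwa [sqrt_mul_self hρ.nonneg] at this
  rw [← h3, h1, expect, h4.prod_eq, trace_mul_comm_of_isHS h.isHS hs1]

/-- An estimator which is unbiased in all admissible directions becomes, after projection to the
tangent space, the centered observable. -/
theorem IsFaithful.realIntegralCLM_eq (hρ : IsFaithful ρ) (hM : IsPOVM M) {𝒜 : Set (H →ₗ.[ℂ] H)}
    (h𝒜 : ∀ A ∈ 𝒜, HasSecondMoment ρ A) {A : H →ₗ.[ℂ] H} (hA : IsSelfAdjoint A)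
    (hA2 : HasSecondMoment ρ A) {f : Lp ℝ 2 (law M ρ)}
    (hf : f ∈ ((sldSpace ρ 𝒜).map
      (ContinuousLinearMap.adjoint (realIntegralCLM M ρ)).toLinearMap).topologicalClosure)
    (h : ∀ t ∈ sldSpace ρ 𝒜,
      ⟪realIntegralCLM M ρ f, t⟫_ℝ = ⟪hs (prod A (CFC.sqrt ρ)), t⟫_ℝ) :
    realIntegralCLM M ρ f = hs (prod A (CFC.sqrt ρ)) - (expect ρ A) • hs (CFC.sqrt ρ) := by
  -- Unbiasedness says that `W f - A√ρ` is orthogonal to all tangent vectors, hence is a real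
  -- multiple of `√ρ`.
  obtain ⟨c, hc⟩ := hρ.eq_smul_of_forall_inner_eq_zero h𝒜
    (y := realIntegralCLM M ρ f - hs (prod A (CFC.sqrt ρ))) (by
      rw [map_sub, mul_sub, op_hs hA2.isHS]
      exact (hM.isSelfAdjoint_realIntegralCLM hρ.nonneg hρ.isTraceClass f).sub
        (hA2.isSelfAdjoint hA)) fun t ht => by
      rw [inner_sub_left, h t ht, sub_self]
  -- Scores have mean zero, since `W 1 = √ρ` is orthogonal to the tangent space; the same holds for
  -- limits of scores. This identifies the multiple as `-⟨A⟩`.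
  have h0 : ⟪hs (CFC.sqrt ρ), realIntegralCLM M ρ f⟫_ℝ = 0 := by
    rw [hM.inner_sqrt_realIntegralCLM hρ.nonneg hρ.isTraceClass]
    have hcl : IsClosed {f : Lp ℝ 2 (law M ρ) |
        ⟪indicatorConstLp 2 MeasurableSet.univ (measure_ne_top _ _) 1, f⟫_ℝ = 0} :=
      isClosed_eq (by fun_prop) (by fun_prop)
    refine hcl.closure_subset_iff.2 ?_ hf
    rintro _ ⟨t, ht, rfl⟩
    have := hM.realIntegralCLM_indicator hρ.nonneg hρ.isTraceClass MeasurableSet.univ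
    rw [hM.univ, one_mul] at this
    simp only [Set.mem_ofPred_eq]
    refine (ContinuousLinearMap.adjoint_inner_right _ _ _).trans ?_
    rw [this]
    exact ht.2.1
  have hc' : realIntegralCLM M ρ f = hs (prod A (CFC.sqrt ρ)) + c • hs (CFC.sqrt ρ) := by
    rw [sub_eq_iff_eq_add'] at hc; exact hc
  have hn : ⟪hs (CFC.sqrt ρ), hs (CFC.sqrt ρ)⟫_ℝ = 1 := by
    rw [real_inner_eq_re, hρ.norm_hs_sqrt, Complex.one_re]
  rw [hc', inner_add_right, inner_smul_right, hn, mul_one] at h0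
  rw [hc', (hρ.expect_eq hA hA2).1, sub_eq_add_neg, ← neg_smul, ← Complex.ofReal_neg,
    ← eq_neg_of_add_eq_zero_right h0]
  rfl

theorem IsFaithful.inner_centered (hρ : IsFaithful ρ) {A B : H →ₗ.[ℂ] H} (hA : IsSelfAdjoint A)
    (hB : IsSelfAdjoint B) (hA2 : HasSecondMoment ρ A) (hB2 : HasSecondMoment ρ B) :
    ⟪hs (prod A (CFC.sqrt ρ)) - (expect ρ A) • hs (CFC.sqrt ρ),
      hs (prod B (CFC.sqrt ρ)) - (expect ρ B) • hs (CFC.sqrt ρ)⟫_ℂ = corr ρ A B := by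
  obtain ⟨h1, h2⟩ := hρ.expect_eq hA hA2
  obtain ⟨h3, h4⟩ := hρ.expect_eq hB hB2
  have h5 : ⟪hs (prod A (CFC.sqrt ρ)), hs (CFC.sqrt ρ)⟫_ℂ = expect ρ A := by
    rw [← inner_conj_symm, h2, Complex.conj_ofReal, h1]
  rw [inner_sub_left, inner_sub_right, inner_sub_right, inner_smul_left, inner_smul_right,
    inner_smul_left, inner_smul_right, hρ.norm_hs_sqrt, h5, h4, ← h3, corr, expectMul,
    trace_star_mul hA2.isHS hB2.isHS]
  ring

/-- One square integrable unbiased estimator suffices, whether optimal or not: the Fisher term is at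
most `‖f‖²`. -/
theorem IsFaithful.povmError_ne_top (hρ : IsFaithful ρ) (hM : IsPOVM M) {A : H →ₗ.[ℂ] H}
    (hA : IsSelfAdjoint A) (hA2 : HasSecondMoment ρ A) (f : Lp ℝ 2 (law M ρ))
    (hf : ∀ t ∈ sldSpace ρ {A},
      ⟪realIntegralCLM M ρ f, t⟫_ℝ = ⟪hs (prod A (CFC.sqrt ρ)), t⟫_ℝ) :
    povmError A ρ M ≠ ⊤ := by
  have hD := hρ.directions_eq {A}
  simp only [Set.mem_singleton_iff, forall_eq] at hD
  have hle := pinvForm_le_norm_sq (α := gradExpect A) (q := fisherInfo M ρ) (sldSpace ρ {A})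
    (ContinuousLinearMap.adjoint (realIntegralCLM M ρ)).toLinearMap _ hD
    (fun t _ => by
      rw [hM.fisherInfo_sldDir hρ.nonneg hρ.isTraceClass (isHS_op t), hs_op]; rfl) (f := f)
    (fun t ht => by
      rw [hρ.gradExpect_sldDir hA hA2.isProd hA2.isHS (isHS_op t) (ht.2.2 A rfl), hs_op, ← hf t ht]
      exact (ContinuousLinearMap.adjoint_inner_right _ _ _).symm)
  rw [povmError]
  intro h
  have h1 := EReal.sub_le_sub hle (le_refl (variance ρ A : EReal))
  rw [h, top_le_iff, ← EReal.coe_sub] at h1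
  exact EReal.coe_ne_top _ h1

/-- The uncertainty relation for unbiased estimators of two observables. -/
theorem IsFaithful.remainder_sq_add_le (hρ : IsFaithful ρ) (hM : IsPOVM M) {A B : H →ₗ.[ℂ] H}
    (hA : IsSelfAdjoint A) (hB : IsSelfAdjoint B) (hA2 : HasSecondMoment ρ A)
    (hB2 : HasSecondMoment ρ B) (f g : Lp ℝ 2 (law M ρ))
    (hf : ∀ t ∈ sldSpace ρ {A, B},
      ⟪realIntegralCLM M ρ f, t⟫_ℝ = ⟪hs (prod A (CFC.sqrt ρ)), t⟫_ℝ)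
    (hg : ∀ t ∈ sldSpace ρ {A, B},
      ⟪realIntegralCLM M ρ g, t⟫_ℝ = ⟪hs (prod B (CFC.sqrt ρ)), t⟫_ℝ) :
    variance ρ A ≤ ‖f‖ ^ 2 ∧ variance ρ B ≤ ‖g‖ ^ 2 ∧
    remainder A B ρ M ^ 2 + 1 / 4 * ‖expectComm ρ A B‖ ^ 2
      ≤ (‖f‖ ^ 2 - variance ρ A) * (‖g‖ ^ 2 - variance ρ B) := by
  set L := (ContinuousLinearMap.adjoint (realIntegralCLM M ρ)).toLinearMap with hL
  -- Projecting an estimator onto the closure of the scores preserves unbiasedness and does not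
  -- increase the norm. The projected estimators are the optimal ones and compute the pseudo-inverse
  -- form.
  set K := ((sldSpace ρ {A, B}).map L).topologicalClosure with hK
  have hKc : CompleteSpace K := (Submodule.isClosed_topologicalClosure _).completeSpace_coe
  have hLt : ∀ t ∈ sldSpace ρ {A, B}, L t ∈ K := fun t ht =>
    Submodule.le_topologicalClosure _ ⟨t, ht, rfl⟩
  have hproj : ∀ k : Lp ℝ 2 (law M ρ), ∀ t ∈ sldSpace ρ {A, B},
      ⟪K.starProjection k, L t⟫_ℝ = ⟪realIntegralCLM M ρ k, t⟫_ℝ := fun k t ht => by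
    rw [K.inner_starProjection_left_eq_right, K.starProjection_eq_self_iff.2 (hLt t ht)]
    exact ContinuousLinearMap.adjoint_inner_right _ _ _
  have hnorm : ∀ k : Lp ℝ 2 (law M ρ), ‖K.starProjection k‖ ^ 2 ≤ ‖k‖ ^ 2 := fun k =>
    pow_le_pow_left₀ (norm_nonneg _) (K.norm_starProjection_apply_le k) 2
  set f₀ := K.starProjection f with hf₀
  set g₀ := K.starProjection g with hg₀
  have hf₀K : f₀ ∈ K := K.starProjection_apply_mem f
  have hg₀K : g₀ ∈ K := K.starProjection_apply_mem g
  have hLi : ∀ (k : Lp ℝ 2 (law M ρ)) t, ⟪k, L t⟫_ℝ = ⟪realIntegralCLM M ρ k, t⟫_ℝ := fun k t =>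
    ContinuousLinearMap.adjoint_inner_right _ _ _
  have h𝒜 : ∀ X ∈ ({A, B} : Set (H →ₗ.[ℂ] H)), HasSecondMoment ρ X := by
    rintro X (rfl | rfl)
    exacts [hA2, hB2]
  have hWf := hρ.realIntegralCLM_eq hM h𝒜 hA hA2 hf₀K fun t ht => by
    rw [← hLi, hproj f t ht, hf t ht]
  have hWg := hρ.realIntegralCLM_eq hM h𝒜 hB hB2 hg₀K fun t ht => by
    rw [← hLi, hproj g t ht, hg t ht]
  have hAB : ⟪realIntegralCLM M ρ f₀, realIntegralCLM M ρ g₀⟫_ℂ = corr ρ A B := by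
    rw [hWf, hWg, hρ.inner_centered hA hB hA2 hB2]
  have hBA : corr ρ B A = star (corr ρ A B) := by
    rw [← hAB, ← hρ.inner_centered hB hA hB2 hA2, ← hWf, ← hWg]
    exact (inner_conj_symm _ _).symm
  have hvarA : variance ρ A = ‖realIntegralCLM M ρ f₀‖ ^ 2 := by
    rw [variance, ← hρ.inner_centered hA hA hA2 hA2, ← hWf, ← inner_self_eq_norm_sq (𝕜 := ℂ)]
    rfl
  have hvarB : variance ρ B = ‖realIntegralCLM M ρ g₀‖ ^ 2 := by
    rw [variance, ← hρ.inner_centered hB hB hB2 hB2, ← hWg, ← inner_self_eq_norm_sq (𝕜 := ℂ)]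
    rfl
  have hWn : ∀ k : Lp ℝ 2 (law M ρ), ‖realIntegralCLM M ρ k‖ ^ 2 ≤ ‖k‖ ^ 2 := fun k =>
    pow_le_pow_left₀ (norm_nonneg _) (norm_realIntegralCLM_apply_le k) 2
  -- The complex version of the contraction is used, since the imaginary part of `C(A, B)` would be
  -- lost over `ℝ`.
  have hCS := norm_inner_sub_inner_sq_le (norm_integralCLM_le (M := M) (ρ := ρ))
    (toComplexL2 _ f₀) (toComplexL2 _ g₀)
  rw [inner_toComplexL2, norm_toComplexL2_sq, norm_toComplexL2_sq, ← realIntegralCLM_apply,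
    ← realIntegralCLM_apply, hAB, ← hvarA, ← hvarB] at hCS
  have h1 : variance ρ A ≤ ‖f₀‖ ^ 2 := hvarA ▸ hWn f₀
  have h2 : variance ρ B ≤ ‖g₀‖ ^ 2 := hvarB ▸ hWn g₀
  have hD := hρ.directions_eq {A, B}
  have hset : {φ | ∀ X ∈ ({A, B} : Set (H →ₗ.[ℂ] H)), HasExpect φ X}
      = {φ | HasExpect φ A ∧ HasExpect φ B} := by
    ext φ; simp
  rw [hset] at hD
  have hq : ∀ t ∈ sldSpace ρ {A, B},
      fisherInfo M ρ (sldDir ρ (op t)) = ENNReal.ofReal (‖L t‖ ^ 2) := fun t _ => by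
    rw [hM.fisherInfo_sldDir hρ.nonneg hρ.isTraceClass (isHS_op t), hs_op]; rfl
  have hαA : ∀ t ∈ sldSpace ρ {A, B}, gradExpect A (sldDir ρ (op t)) = ⟪f₀, L t⟫_ℝ :=
    fun t ht => by
      rw [hρ.gradExpect_sldDir hA hA2.isProd hA2.isHS (isHS_op t) (ht.2.2 A (by simp)), hs_op,
        ← hf t ht, hproj f t ht]
  have hαB : ∀ t ∈ sldSpace ρ {A, B}, gradExpect B (sldDir ρ (op t)) = ⟪g₀, L t⟫_ℝ :=
    fun t ht => by
      rw [hρ.gradExpect_sldDir hB hB2.isProd hB2.isHS (isHS_op t) (ht.2.2 B (by simp)), hs_op,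
        ← hg t ht, hproj g t ht]
  have hpair : pinvPairing (directions ρ ∩ {φ | HasExpect φ A ∧ HasExpect φ B})
      (gradExpect A) (gradExpect B) (fisherInfo M ρ) = ⟪f₀, g₀⟫_ℝ := by
    rw [pinvPairing, pinvForm_eq_norm_sq (sldSpace ρ {A, B}) L _ hD hq (K.add_mem hf₀K hg₀K)
      fun t ht => by rw [hαA t ht, hαB t ht, inner_add_left],
      pinvForm_eq_norm_sq (sldSpace ρ {A, B}) L _ hD hq (K.sub_mem hf₀K hg₀K)
      fun t ht => by rw [hαA t ht, hαB t ht, inner_sub_left], EReal.toReal_coe, EReal.toReal_coe,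
      norm_add_sq_real, norm_sub_sq_real]
    ring
  have hsym : (symCorr ρ A B).re = (corr ρ A B).re := by
    rw [symCorr, hBA, Complex.star_def, Complex.add_conj]
    simp
  have hcomm : ‖expectComm ρ A B‖ ^ 2 = 4 * (corr ρ A B).im ^ 2 := by
    have : expectComm ρ A B = corr ρ A B - star (corr ρ A B) := by
      rw [← hBA, expectComm, corr, corr]; ring
    rw [this, Complex.star_def, Complex.sub_conj, norm_mul, Complex.norm_I, mul_one,
      Complex.norm_real, Real.norm_eq_abs, sq_abs]
    ring
  refine ⟨h1.trans (hnorm f), h2.trans (hnorm g), ?_⟩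
  -- As `⟪f₀, g₀⟫` is real, the real part of the difference is the remainder and its imaginary part
  -- is `-Im C(A, B)`, while `⟨[A, B]⟩ = 2i Im C(A, B)`.
  have hlhs : remainder A B ρ M ^ 2 + 1 / 4 * ‖expectComm ρ A B‖ ^ 2
      = ‖((⟪f₀, g₀⟫_ℝ : ℝ) : ℂ) - corr ρ A B‖ ^ 2 := by
    rw [remainder, hpair, hsym, hcomm, ← Complex.normSq_eq_norm_sq, Complex.normSq_apply]
    simp only [Complex.sub_re, Complex.sub_im, Complex.ofReal_re, Complex.ofReal_im]
    ring
  rw [hlhs]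
  refine hCS.trans (mul_le_mul ?_ ?_ ?_ ?_)
  · linarith [hnorm f]
  · linarith [hnorm g]
  · linarith
  · linarith [hnorm f]

end QM

namespace QM

variable {H : Type*} [NormedAddCommGroup H] [InnerProductSpace ℂ H] [CompleteSpace H]

open Filter Topology CompactlySupported

/-! ### Spectral measures of normal operators -/

variable {U : H →L[ℂ] H}

/-- A real-valued continuous function as a complex-valued one. -/
def realToComplex {X : Type*} [TopologicalSpace X] (F : C(X, ℝ)) : C(X, ℂ) :=
  ⟨fun x => (F x : ℂ), by fun_prop⟩

theorem realToComplex_apply {X : Type*} [TopologicalSpace X] (F : C(X, ℝ)) (x : X) :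
    realToComplex F x = (F x : ℂ) := rfl

theorem inner_cfcHom_star_mul (hU : IsStarNormal U) (a b : C(spectrum ℂ U, ℂ)) (w : H) :
    ⟪cfcHom hU a w, cfcHom hU b w⟫_ℂ = ⟪w, cfcHom hU (star a * b) w⟫_ℂ := by
  rw [map_mul, map_star, mul_apply_eq_comp, inner_star_right]

theorem inner_cfcHom_realToComplex (hU : IsStarNormal U) (F : C(spectrum ℂ U, ℝ)) (w : H) :
    (((⟪w, cfcHom hU (realToComplex F) w⟫_ℂ).re : ℝ) : ℂ)
      = ⟪w, cfcHom hU (realToComplex F) w⟫_ℂ := by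
  refine Complex.conj_eq_iff_re.1 ?_
  have h : star (realToComplex F) = realToComplex F := by
    ext x; simp [realToComplex_apply]
  rw [inner_conj_symm, ← inner_star_right, ← map_star, h]

/-- Riesz-Markov representation of `F ↦ ⟨w, F(U) w⟩` on the compact spectrum; positivity comes from
writing `F` as the square of `√F`. -/
theorem exists_spectralMeasure (hU : IsStarNormal U) (w : H) :
    ∃ μ : Measure (spectrum ℂ U), IsFiniteMeasure μ ∧ ∀ F : C(spectrum ℂ U, ℝ),
      ((∫ z, F z ∂μ : ℝ) : ℂ) = ⟪w, cfcHom hU (realToComplex F) w⟫_ℂ := by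
  let Λ₀ : C_c(spectrum ℂ U, ℝ) →ₗ[ℝ] ℝ :=
    { toFun := fun F => (⟪w, cfcHom hU (realToComplex F.toContinuousMap) w⟫_ℂ).re
      map_add' := fun F G => by
        have : realToComplex (F + G).toContinuousMap
            = realToComplex F.toContinuousMap + realToComplex G.toContinuousMap := by
          ext x; simp [realToComplex_apply]
        rw [this, map_add, add_apply, inner_add_right, Complex.add_re]
      map_smul' := fun c F => by
        have : realToComplex (c • F).toContinuousMap
            = (c : ℂ) • realToComplex F.toContinuousMap := by
          ext x; simp [realToComplex_apply]
        rw [this, map_smul, smul_apply, inner_smul_right, Complex.re_ofReal_mul]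
        rfl }
  let Λ : C_c(spectrum ℂ U, ℝ) →ₚ[ℝ] ℝ := PositiveLinearMap.mk₀ Λ₀ fun F hF => by
    let g : C(spectrum ℂ U, ℂ) :=
      realToComplex ⟨fun x => √(F x), Real.continuous_sqrt.comp F.continuous⟩
    have hg : realToComplex F.toContinuousMap = star g * g := by
      ext x
      have h0 : 0 ≤ F x := hF x
      simp only [realToComplex_apply, ContinuousMap.mul_apply, ContinuousMap.star_apply, g,
        ContinuousMap.coe_mk, Complex.star_def, Complex.conj_ofReal]
      rw [← Complex.ofReal_mul, Real.mul_self_sqrt h0]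
      rfl
    change 0 ≤ (⟪w, cfcHom hU (realToComplex F.toContinuousMap) w⟫_ℂ).re
    rw [hg, ← inner_cfcHom_star_mul]
    exact inner_self_nonneg (𝕜 := ℂ)
  refine ⟨RealRMK.rieszMeasure Λ, inferInstance, fun F => ?_⟩
  rw [← inner_cfcHom_realToComplex]
  congr 1
  exact RealRMK.integral_rieszMeasure Λ (CompactlySupportedContinuousMap.continuousMapEquiv F)

/-- The spectral measure of a normal operator in a vector. -/
def spectralMeasure (hU : IsStarNormal U) (w : H) : Measure (spectrum ℂ U) :=
  (exists_spectralMeasure hU w).choose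

instance (hU : IsStarNormal U) (w : H) : IsFiniteMeasure (spectralMeasure hU w) :=
  (exists_spectralMeasure hU w).choose_spec.1

theorem integral_spectralMeasure (hU : IsStarNormal U) (w : H) (F : C(spectrum ℂ U, ℝ)) :
    ((∫ z, F z ∂(spectralMeasure hU w) : ℝ) : ℂ) = ⟪w, cfcHom hU (realToComplex F) w⟫_ℂ :=
  (exists_spectralMeasure hU w).choose_spec.2 F

theorem spectralMeasure_univ (hU : IsStarNormal U) (w : H) :
    spectralMeasure hU w Set.univ = ENNReal.ofReal (‖w‖ ^ 2) := by
  have h := integral_spectralMeasure hU w 1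
  have h1 : realToComplex (1 : C(spectrum ℂ U, ℝ)) = 1 := by ext x; simp [realToComplex_apply]
  rw [h1, map_one, one_apply_eq_self, inner_self_eq_ofReal_norm_sq] at h
  have h2 : ∫ z, (1 : C(spectrum ℂ U, ℝ)) z ∂(spectralMeasure hU w) = ‖w‖ ^ 2 := by
    exact_mod_cast h
  simp only [ContinuousMap.one_apply, integral_const, smul_eq_mul, mul_one] at h2
  rw [← h2, ofReal_measureReal]

/-- Integrating `F` against the left side gives `⟨a(U) w, F(U) a(U) w⟩ = ⟨w, (|a|² F)(U) w⟩`. -/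
theorem spectralMeasure_cfcHom (hU : IsStarNormal U) (a : C(spectrum ℂ U, ℂ)) (w : H) :
    spectralMeasure hU (cfcHom hU a w)
      = (spectralMeasure hU w).withDensity fun z => ENNReal.ofReal (‖a z‖ ^ 2) := by
  have hm : Measurable fun z => (‖a z‖ ^ 2).toNNReal := by
    have : Continuous fun z => (‖a z‖ ^ 2).toNNReal := by fun_prop
    exact this.measurable
  have hfin : IsFiniteMeasure ((spectralMeasure hU w).withDensity
      fun z => ENNReal.ofReal (‖a z‖ ^ 2)) := by
    refine isFiniteMeasure_withDensity_ofReal ?_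
    have hc : Continuous fun z => ‖a z‖ ^ 2 := by fun_prop
    exact (hc.integrable_of_hasCompactSupport (HasCompactSupport.of_compactSpace _)).2
  refine ext_of_forall_integral_eq_of_IsFiniteMeasure fun F => ?_
  have h1 := integral_spectralMeasure hU (cfcHom hU a w) F.toContinuousMap
  have h2 : ∫ z, F z ∂((spectralMeasure hU w).withDensity fun z => ENNReal.ofReal (‖a z‖ ^ 2))
      = ∫ z, ‖a z‖ ^ 2 * F z ∂(spectralMeasure hU w) := by
    have := integral_withDensity_eq_integral_smul (μ := spectralMeasure hU w) hm F
    refine this.trans (integral_congr_ae (Eventually.of_forall fun z => ?_))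
    simp only [NNReal.smul_def, smul_eq_mul, Real.coe_toNNReal _ (sq_nonneg ‖a z‖)]
  rw [h2]
  let G : C(spectrum ℂ U, ℝ) := ⟨fun z => ‖a z‖ ^ 2 * F z, by fun_prop⟩
  have h3 := integral_spectralMeasure hU w G
  have h4 : star a * (realToComplex F.toContinuousMap * a) = realToComplex G := by
    ext z
    simp only [ContinuousMap.mul_apply, ContinuousMap.star_apply, realToComplex_apply, G,
      ContinuousMap.coe_mk, Complex.star_def]
    rw [mul_left_comm, ← Complex.normSq_eq_conj_mul_self, Complex.normSq_eq_norm_sq]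
    push_cast
    rw [mul_comm]
    rfl
  rw [← h4, ← inner_cfcHom_star_mul, map_mul, mul_apply_eq_comp, ← h1] at h3
  exact_mod_cast h3.symm

/-- Closed sets form a generating π-system, and the indicator of a closed set is a pointwise limit
of continuous functions with values in `[0, 1]`. Their functional calculus converges weakly. -/
theorem exists_spectral_povm (hU : IsStarNormal U) :
    ∃ Q : Set (spectrum ℂ U) → H →L[ℂ] H, IsPOVM Q ∧
      ∀ C, MeasurableSet C → ∀ w, ⟪w, Q C w⟫_ℂ = ((spectralMeasure hU w).real C : ℂ) := by
  refine exists_povm (spectralMeasure hU) (spectralMeasure_univ hU) {C | IsClosed C}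
    (BorelSpace.measurable_eq.trans (borel_eq_generateFrom_isClosed (α := spectrum ℂ U)))
    isPiSystem_isClosed fun C hC => ?_
  have hC' : IsClosed C := hC
  let F : ℕ → C(spectrum ℂ U, ℝ) := fun n =>
    ⟨fun z => (hC'.apprSeq n z : ℝ), NNReal.continuous_coe.comp (hC'.apprSeq n).continuous⟩
  have hF0 : ∀ n z, 0 ≤ F n z := fun n z => NNReal.coe_nonneg _
  have hF1 : ∀ n z, F n z ≤ 1 := fun n z => by
    have := HasOuterApproxClosed.apprSeq_apply_le_one hC' n z
    exact_mod_cast this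
  have hlim : ∀ w, Tendsto (fun n => ⟪w, cfcHom hU (realToComplex (F n)) w⟫_ℂ) atTop
      (𝓝 ((spectralMeasure hU w).real C : ℂ)) := fun w => by
    simp only [← integral_spectralMeasure]
    refine (Complex.continuous_ofReal.tendsto _).comp ?_
    have h := HasOuterApproxClosed.tendsto_lintegral_apprSeq hC' (spectralMeasure hU w)
    have h2 := (ENNReal.tendsto_toReal (measure_ne_top (spectralMeasure hU w) C)).comp h
    refine h2.congr fun n => ?_
    rw [Function.comp_apply, integral_eq_lintegral_of_nonneg_ae (Eventually.of_forall (hF0 n))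
      (F n).continuous.aestronglyMeasurable]
    congr 1
    refine lintegral_congr fun z => ?_
    exact (ENNReal.ofReal_coe_nnreal).symm
  have hn : ∀ n, ‖cfcHom hU (realToComplex (F n))‖ ≤ 1 := fun n => by
    rw [norm_cfcHom (𝕜 := ℂ) U _ hU, ContinuousMap.norm_le _ zero_le_one]
    intro z
    rw [realToComplex_apply, Complex.norm_real, Real.norm_eq_abs, abs_of_nonneg (hF0 n z)]
    exact hF1 n z
  obtain ⟨Q, hQ⟩ := exists_weak_limit hn fun w => ⟨_, hlim w⟩
  exact ⟨Q, fun w => tendsto_nhds_unique (hQ w w) (hlim w)⟩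

end QM

namespace QM

variable {H : Type*} [NormedAddCommGroup H] [InnerProductSpace ℂ H] [CompleteSpace H]

open HSSpace Filter Topology

/-! ### Unitary dilations of partial isometries -/

variable (H) in
/-- The doubled Hilbert space. -/
abbrev Doubled := WithLp 2 (H × H)

variable (H) in
/-- The first embedding into the doubled space. -/
def inlIsometry : H →ₗᵢ[ℂ] Doubled H where
  toFun x := WithLp.toLp 2 (x, 0)
  map_add' x y := WithLp.ofLp_injective _ (by simp)
  map_smul' c x := WithLp.ofLp_injective _ (by simp)
  norm_map' x := by simp

theorem inlIsometry_apply (x : H) : inlIsometry H x = WithLp.toLp 2 (x, 0) := rfl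

/-- The block operator with entries `a, b, c, d` on the doubled space. -/
def blockOp (a b c d : H →L[ℂ] H) : Doubled H →L[ℂ] Doubled H :=
  ((WithLp.prodContinuousLinearEquiv 2 ℂ H H).symm : H × H →L[ℂ] Doubled H) ∘L
    (((a.comp (ContinuousLinearMap.fst ℂ H H) + b.comp (ContinuousLinearMap.snd ℂ H H)).prod
      (c.comp (ContinuousLinearMap.fst ℂ H H) + d.comp (ContinuousLinearMap.snd ℂ H H))) ∘L
    ((WithLp.prodContinuousLinearEquiv 2 ℂ H H) : Doubled H →L[ℂ] H × H))

theorem blockOp_apply (a b c d : H →L[ℂ] H) (x : Doubled H) :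
    blockOp a b c d x = WithLp.toLp 2 (a x.fst + b x.snd, c x.fst + d x.snd) := rfl

theorem blockOp_mul (a b c d a' b' c' d' : H →L[ℂ] H) :
    blockOp a b c d * blockOp a' b' c' d'
      = blockOp (a * a' + b * c') (a * b' + b * d') (c * a' + d * c') (c * b' + d * d') := by
  ext x
  rw [mul_apply_eq_comp, blockOp_apply, blockOp_apply, blockOp_apply]
  refine WithLp.ofLp_injective _ (Prod.ext ?_ ?_) <;>
  · simp only [WithLp.toLp_fst, WithLp.toLp_snd, map_add, add_apply, mul_apply_eq_comp]
    abel

theorem blockOp_one : blockOp (1 : H →L[ℂ] H) 0 0 1 = 1 := by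
  ext x
  rw [blockOp_apply, one_apply_eq_self]
  refine WithLp.ofLp_injective _ (Prod.ext ?_ ?_) <;> simp

theorem star_blockOp (a b c d : H →L[ℂ] H) :
    star (blockOp a b c d) = blockOp (star a) (star c) (star b) (star d) := by
  refine ContinuousLinearMap.ext fun x => ext_inner_left ℂ fun y => ?_
  rw [inner_star_right, WithLp.prod_inner_apply, WithLp.prod_inner_apply, blockOp_apply,
    blockOp_apply]
  simp only [WithLp.ofLp_fst, WithLp.ofLp_snd, inner_add_left, inner_add_right, inner_star_right]
  ring

/-- A partial isometry extends to a unitary operator on the doubled space. -/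
theorem exists_unitary_dilation {V : H →L[ℂ] H} (hV : V * star V * V = V) :
    ∃ U : Doubled H →L[ℂ] Doubled H, U ∈ unitary (Doubled H →L[ℂ] Doubled H) ∧
      ∀ x, star V (V x) = x → U (inlIsometry H x) = inlIsometry H (V x) := by
  have hV' : star V * V * star V = star V := by
    have := congrArg star hV
    simpa only [star_mul, star_star, mul_assoc] using this
  -- Halmos' dilation: the off-diagonal blocks are the projections complementary to the final and
  -- initial spaces of `V`, and the lower left one vanishes on the initial space.
  refine ⟨blockOp V (1 - V * star V) (1 - star V * V) (-star V), ?_, fun x hx => ?_⟩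
  · rw [Unitary.mem_iff, star_blockOp, blockOp_mul, blockOp_mul, ← blockOp_one]
    simp only [star_sub, star_mul, star_star, star_one, star_neg, mul_sub, sub_mul, mul_one,
      one_mul, mul_neg, neg_mul, neg_neg, ← mul_assoc, hV, hV']
    constructor <;> congr 1 <;> abel
  · rw [inlIsometry_apply, blockOp_apply, inlIsometry_apply]
    simp [hx]

/-- The Cayley transform of a symmetric pair: `Y - i s` is a partial isometry times `Y + i s`. -/
theorem exists_cayley_unitary {s Y : H →L[ℂ] H}
    (hsymm : ∀ u v, ⟪Y u, s v⟫_ℂ = ⟪s u, Y v⟫_ℂ) :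
    ∃ U : Doubled H →L[ℂ] Doubled H, U ∈ unitary (Doubled H →L[ℂ] Doubled H) ∧
      ∀ u, U (inlIsometry H (Y u + Complex.I • s u)) = inlIsometry H (Y u - Complex.I • s u) := by
  let a : H →ₗ[ℂ] H := (Y + Complex.I • s : H →L[ℂ] H)
  let b : H →ₗ[ℂ] H := (Y - Complex.I • s : H →L[ℂ] H)
  have ha : ∀ u, a u = Y u + Complex.I • s u := fun u => rfl
  have hb : ∀ u, b u = Y u - Complex.I • s u := fun u => rfl
  -- Symmetry cancels the cross terms, so `Y u + i s u ↦ Y u - i s u` is isometric.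
  have hinner : ∀ u v, ⟪b u, b v⟫_ℂ = ⟪a u, a v⟫_ℂ := fun u v => by
    simp only [ha, hb, inner_add_left, inner_add_right, inner_sub_left, inner_sub_right,
      inner_smul_left, inner_smul_right, hsymm, Complex.conj_I]
    ring
  have hnorm : ∀ u, ‖b u‖ ≤ 1 * ‖a u‖ := fun u => by
    have := hinner u u
    rw [inner_self_eq_ofReal_norm_sq, inner_self_eq_ofReal_norm_sq] at this
    have h2 : ‖b u‖ ^ 2 = ‖a u‖ ^ 2 := by exact_mod_cast this
    rw [one_mul, (sq_eq_sq₀ (norm_nonneg _) (norm_nonneg _)).1 h2]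
  obtain ⟨V, hV, hV1, hV0⟩ := exists_factor_of_norm_le a b zero_le_one hnorm
  have hperp : ∀ x, star V x ∈ ((LinearMap.range a)ᗮ)ᗮ := fun x => by
    refine (Submodule.mem_orthogonal _ _).2 fun z hz => ?_
    rw [inner_star_right, hV0 z hz, inner_zero_left]
  have hrange : ∀ z ∈ ((LinearMap.range a)ᗮ)ᗮ, (∀ u, ⟪z, a u⟫_ℂ = 0) → z = 0 := fun z hz h => by
    have : z ∈ (LinearMap.range a)ᗮ := by
      refine (Submodule.mem_orthogonal' _ _).2 ?_
      rintro _ ⟨u, rfl⟩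
      exact h u
    exact inner_self_eq_zero.1 ((Submodule.mem_orthogonal _ _).1 hz z this)
  have hiso : ∀ u, star V (V (a u)) = a u := fun u => by
    rw [← sub_eq_zero]
    refine hrange _ (Submodule.sub_mem _ (hperp _) ?_) fun v => ?_
    · exact Submodule.le_orthogonal_orthogonal _ ⟨u, rfl⟩
    · rw [inner_sub_left, inner_star_left, hV, hV, hinner, sub_self]
  have hproj : V * star V * V = V := by
    have : star V * V * star V = star V := by
      ext x
      rw [mul_apply_eq_comp, mul_apply_eq_comp, ← sub_eq_zero]
      refine hrange _ (Submodule.sub_mem _ (hperp _) (hperp _)) fun v => ?_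
      rw [inner_sub_left, inner_star_left, inner_star_left, ← inner_star_right V, hiso,
        inner_star_left, sub_self]
    have := congrArg star this
    simpa only [star_mul, star_star, mul_assoc] using this
  obtain ⟨U, hU, hUV⟩ := exists_unitary_dilation hproj
  refine ⟨U, hU, fun u => ?_⟩
  have := hUV (a u) (hiso u)
  rwa [hV, ha, hb] at this

end QM

namespace QM

variable {H : Type*} [NormedAddCommGroup H] [InnerProductSpace ℂ H] [CompleteSpace H]

open HSSpace Filter Topology

/-! ### The spectral measure of a symmetric pair -/

section Unitary

variable {K : Type*} [NormedAddCommGroup K] [InnerProductSpace ℂ K] [CompleteSpace K]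
  {U : K →L[ℂ] K}

/-- The inverse Cayley transform on the spectrum of a unitary operator. -/
def invCayley (U : K →L[ℂ] K) (z : spectrum ℂ U) : ℝ :=
  (Complex.I * (1 + (z : ℂ)) / (1 - (z : ℂ))).re

theorem measurable_invCayley : Measurable (invCayley U) := by
  unfold invCayley
  fun_prop

/-- On the circle minus `1` the number `κ = i(1 + z)/(1 - z)` is real, and the expression on the
left is `-i(κ + c)(1 - z)`. -/
theorem norm_invCayley_add {z : ℂ} (hz : ‖z‖ = 1) (hz1 : z ≠ 1) (c : ℝ) :
    ‖(1 + z) - c * Complex.I * (1 - z)‖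
      = |(Complex.I * (1 + z) / (1 - z)).re + c| * ‖1 - z‖ := by
  have h0 : z ≠ 0 := by rintro rfl; simp at hz
  have h1 : 1 - z ≠ 0 := sub_ne_zero.2 hz1.symm
  have h2 : z - 1 ≠ 0 := sub_ne_zero.2 hz1
  have hconj : (starRingEnd ℂ) z = z⁻¹ := by
    rw [Complex.inv_def, Complex.normSq_eq_norm_sq, hz]; simp
  have hreal : (((Complex.I * (1 + z) / (1 - z)).re : ℝ) : ℂ) = Complex.I * (1 + z) / (1 - z) := by
    refine Complex.conj_eq_iff_re.1 ?_
    simp only [map_div₀, map_mul, map_add, map_sub, map_one, Complex.conj_I, hconj]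
    have h3 : 1 - z⁻¹ ≠ 0 := by
      intro h
      apply hz1
      rw [sub_eq_zero] at h
      exact (inv_eq_one.1 h.symm)
    rw [div_eq_div_iff h3 h1]
    field_simp
    ring
  have key : (1 + z) - c * Complex.I * (1 - z)
      = -Complex.I * (((Complex.I * (1 + z) / (1 - z)).re + c : ℝ) : ℂ) * (1 - z) := by
    rw [Complex.ofReal_add, hreal]
    field_simp
    linear_combination (1 + z) * Complex.I_sq
  rw [key, norm_mul, norm_mul, norm_neg, Complex.norm_I, one_mul, Complex.norm_real,
    Real.norm_eq_abs]

/-- For `w = (1 - U) v` the spectral measure has density `|1 - z|²`, which vanishes at `1`. Limits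
are covered because the mass at `1` is the form of a bounded operator. -/
theorem inner_spectral_singleton_eq_zero (hU : IsStarNormal U) {Q : Set (spectrum ℂ U) → K →L[ℂ] K}
    (hQ : ∀ C, MeasurableSet C → ∀ w, ⟪w, Q C w⟫_ℂ = ((spectralMeasure hU w).real C : ℂ))
    {w : K} (hw : w ∈ closure (Set.range (1 - U : K →L[ℂ] K))) :
    spectralMeasure hU w {z | (z : ℂ) = 1} = 0 := by
  have hm : MeasurableSet {z : spectrum ℂ U | (z : ℂ) = 1} :=
    measurable_subtype_coe (measurableSet_singleton 1)
  have hcl : IsClosed {w : K | ⟪w, Q {z | (z : ℂ) = 1} w⟫_ℂ = 0} :=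
    isClosed_eq (by fun_prop) continuous_const
  have hsub : Set.range (1 - U : K →L[ℂ] K) ⊆ {w : K | ⟪w, Q {z | (z : ℂ) = 1} w⟫_ℂ = 0} := by
    rintro _ ⟨v, rfl⟩
    have h1 : (1 - U : K →L[ℂ] K) v
        = cfcHom hU (1 - (ContinuousMap.id ℂ).restrict (spectrum ℂ U)) v := by
      rw [map_sub, map_one, cfcHom_id]
    change ⟪_, Q _ _⟫_ℂ = 0
    rw [hQ _ hm, h1, spectralMeasure_cfcHom, measureReal_def, withDensity_apply _ hm,
      setLIntegral_congr_fun (g := fun _ => 0) hm]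
    · simp
    · intro z hz
      have hz' : (z : ℂ) = 1 := hz
      simp [hz']
  have h2 : ⟪w, Q {z | (z : ℂ) = 1} w⟫_ℂ = 0 := closure_minimal hsub hcl hw
  rw [hQ _ hm] at h2
  have h3 : (spectralMeasure hU w).real {z | (z : ℂ) = 1} = 0 := by exact_mod_cast h2
  rwa [measureReal_eq_zero_iff] at h3

theorem map_withDensity_comp {Ω Ω' : Type*} [MeasurableSpace Ω] [MeasurableSpace Ω']
    (μ : Measure Ω) {κ : Ω → Ω'} (hκ : Measurable κ) {g : Ω' → ℝ≥0∞} (hg : Measurable g) :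
    (μ.withDensity fun z => g (κ z)).map κ = (μ.map κ).withDensity g := by
  ext C hC
  rw [Measure.map_apply hκ hC, withDensity_apply _ (hκ hC), withDensity_apply _ hC,
    setLIntegral_map hC hg hκ]

/-- Both `x` and `y + c x` are functions of `U` applied to `w`, so their measures have explicit
densities with respect to that of `w`; the quotient is `(κ + c)²` off the null point `1`. -/
theorem spectralMeasure_add_smul (hU : IsStarNormal U) (hUu : U ∈ unitary (K →L[ℂ] K)) {w x y : K}
    (hx : (1 - U : K →L[ℂ] K) w = (2 * Complex.I) • x) (hy : (1 + U : K →L[ℂ] K) w = (2 : ℂ) • y)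
    (hw : spectralMeasure hU w {z | (z : ℂ) = 1} = 0) (c : ℝ) :
    spectralMeasure hU (y + (c : ℂ) • x)
      = (spectralMeasure hU x).withDensity fun z => ENNReal.ofReal ((invCayley U z + c) ^ 2) := by
  let e : C(spectrum ℂ U, ℂ) := (ContinuousMap.id ℂ).restrict (spectrum ℂ U)
  have he : cfcHom hU e = U := cfcHom_id hU
  have h1 : x = cfcHom hU ((2 * Complex.I)⁻¹ • (1 - e)) w := by
    rw [map_smul, map_sub, map_one, he, smul_apply, hx, smul_smul, inv_mul_cancel₀ (by simp),
      one_smul]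
  have h2 : y + (c : ℂ) • x
      = cfcHom hU ((2 : ℂ)⁻¹ • (1 + e) + (c * (2 * Complex.I)⁻¹) • (1 - e)) w := by
    rw [map_add, map_smul, map_smul, map_sub, map_add, map_one, he, add_apply, smul_apply,
      smul_apply, hx, hy, smul_smul, smul_smul, inv_mul_cancel₀ (by simp), one_smul, mul_assoc,
      inv_mul_cancel₀ (by simp), mul_one]
  have hmeas : Measurable fun z => ENNReal.ofReal ((invCayley U z + c) ^ 2) :=
    ((measurable_invCayley.add_const c).pow_const 2).ennreal_ofReal
  rw [h2, spectralMeasure_cfcHom, h1, spectralMeasure_cfcHom, ← withDensity_mul _ _ hmeas]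
  · refine withDensity_congr_ae ?_
    filter_upwards [compl_mem_ae_iff.2 hw] with z hz
    have hz1 : ‖(z : ℂ)‖ = 1 := by
      have := spectrum.subset_circle_of_unitary hUu z.2
      simpa using this
    have h3 := norm_invCayley_add hz1 hz c
    rw [Pi.mul_apply, ← ENNReal.ofReal_mul (sq_nonneg _)]
    congr 1
    have h4 : ((2 : ℂ)⁻¹ • (1 + e) + (c * (2 * Complex.I)⁻¹) • (1 - e)) z
        = 2⁻¹ * ((1 + (z : ℂ)) - c * Complex.I * (1 - z)) := by
      change (2 : ℂ)⁻¹ * (1 + (z : ℂ)) + (c * (2 * Complex.I)⁻¹) * (1 - (z : ℂ)) = _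
      rw [mul_inv, Complex.inv_I]
      ring
    have h5 : ((2 * Complex.I)⁻¹ • (1 - e)) z = (2 * Complex.I)⁻¹ * (1 - (z : ℂ)) := rfl
    rw [h4, h5, norm_mul, norm_mul, h3]
    simp only [norm_inv, norm_mul, Complex.norm_I, mul_one, mul_pow, sq_abs]
    rw [invCayley]
    ring
  · exact Measurable.ennreal_ofReal (by fun_prop)


/-- The POVM is the compression to `H` of the spectral measure of `U`, transported to the line by
the inverse Cayley transform. The density formula for all real `c` records both first and second
moments. -/
theorem exists_povm_of_unitary (ι : H →ₗᵢ[ℂ] K) (hUu : U ∈ unitary (K →L[ℂ] K))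
    {s Y : H →L[ℂ] H} (hs : IsSelfAdjoint s)
    (hUab : ∀ u, U (ι (Y u + Complex.I • s u)) = ι (Y u - Complex.I • s u))
    (hker : ∀ x, s x = 0 → star Y x = 0) :
    ∃ E : Set ℝ → H →L[ℂ] H, IsPOVM E ∧ ∃ ν : H → Measure ℝ, (∀ x, IsFiniteMeasure (ν x)) ∧
      (∀ C, MeasurableSet C → ∀ x, ⟪x, E C x⟫_ℂ = ((ν x).real C : ℂ)) ∧
      ∀ u (c : ℝ), ν (Y u + (c : ℂ) • s u)
        = (ν (s u)).withDensity fun y => ENNReal.ofReal ((y + c) ^ 2) := by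
  have hU : IsStarNormal U := ⟨by
    rw [commute_iff_eq, (Unitary.mem_iff.1 hUu).1, (Unitary.mem_iff.1 hUu).2]⟩
  obtain ⟨Q, hQ, hQμ⟩ := exists_spectral_povm hU
  let κ := invCayley U
  have hκ : Measurable κ := measurable_invCayley
  let ν : H → Measure ℝ := fun x => (spectralMeasure hU (ι x)).map κ
  have hν : ∀ x C, MeasurableSet C → (ν x).real C = (spectralMeasure hU (ι x)).real (κ ⁻¹' C) :=
    fun x C hC => map_measureReal_apply hκ hC
  obtain ⟨E, hE, hEν⟩ := exists_povm ν (fun x => by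
      rw [Measure.map_apply hκ .univ, Set.preimage_univ, spectralMeasure_univ, ι.norm_map])
    {C | MeasurableSet C} MeasurableSpace.generateFrom_measurableSet.symm
    MeasurableSpace.isPiSystem_measurableSet fun C hC => by
      refine ⟨(ContinuousLinearMap.adjoint ι.toContinuousLinearMap) ∘L
        (Q (κ ⁻¹' C) ∘L ι.toContinuousLinearMap), fun x => ?_⟩
      rw [ContinuousLinearMap.comp_apply, ContinuousLinearMap.adjoint_inner_right, hν x C hC,
        ← hQμ _ (hκ hC)]
      rfl
  refine ⟨E, hE, ν, fun x => inferInstance, hEν, fun u c => ?_⟩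
  set w := ι (Y u + Complex.I • s u) with hw
  have hUw : U w = ι (Y u - Complex.I • s u) := hUab u
  have hx : ∀ u, (1 - U) (ι (Y u + Complex.I • s u)) = (2 * Complex.I) • ι (s u) := fun u => by
    rw [sub_apply, one_apply_eq_self, hUab, map_add, map_sub, map_smul]
    module
  have hy : (1 + U) w = (2 : ℂ) • ι (Y u) := by
    rw [add_apply, one_apply_eq_self, hUw, hw, map_add, map_sub, map_smul]
    module
  -- The point `1` corresponds to infinity, where `invCayley` has the default value `0`; it must
  -- carry no mass. A vector orthogonal to the range compresses into `ker s`, hence into `ker Y*` by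
  -- `hker`, and so is orthogonal to `w`.
  have hcl : w ∈ closure (Set.range (1 - U : K →L[ℂ] K)) := by
    let R : Submodule ℂ K := 
      LinearMap.range (1 - U : K →L[ℂ] K).toLinearMap
    have hR : w ∈ Rᗮᗮ := by
      refine (Submodule.mem_orthogonal _ _).2 fun e he => ?_
      let f := ContinuousLinearMap.adjoint ι.toContinuousLinearMap e
      have hf : ∀ x, ⟪f, x⟫_ℂ = ⟪e, ι x⟫_ℂ := fun x =>
        ContinuousLinearMap.adjoint_inner_left _ _ _
      have hfs : s f = 0 := by
        refine ext_inner_right ℂ fun v => ?_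
        have h1 := (Submodule.mem_orthogonal' _ _).1 he _ ⟨ι (Y v + Complex.I • s v), rfl⟩
        rw [ContinuousLinearMap.coe_coe, hx, inner_smul_right] at h1
        rw [hs.inner_comm_apply, hf, inner_zero_left]
        exact (mul_eq_zero.1 h1).resolve_left (by simp)
      have hfY := hker f hfs
      rw [hw, ← hf, inner_add_right, inner_smul_right, ← hs.inner_comm_apply, hfs,
        ← inner_star_left, hfY]
      simp
    rw [Submodule.orthogonal_orthogonal_eq_closure] at hR
    exact hR
  have h0 := inner_spectral_singleton_eq_zero hU hQμ hcl
  have h1 := spectralMeasure_add_smul hU hUu (hx u) hy h0 c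
  change (spectralMeasure hU (ι (Y u + (c : ℂ) • s u))).map κ = _
  rw [map_add, map_smul, h1]
  exact map_withDensity_comp _ hκ (g := fun y => ENNReal.ofReal ((y + c) ^ 2)) (by fun_prop)

end Unitary

/-- The spectral measure of the symmetric operator `s u ↦ Y u` in a dilation. -/
theorem exists_povm_of_symm {s Y : H →L[ℂ] H} (hs : IsSelfAdjoint s)
    (hsymm : ∀ u v, ⟪Y u, s v⟫_ℂ = ⟪s u, Y v⟫_ℂ) (hker : ∀ x, s x = 0 → star Y x = 0) :
    ∃ E : Set ℝ → H →L[ℂ] H, IsPOVM E ∧ ∃ ν : H → Measure ℝ, (∀ x, IsFiniteMeasure (ν x)) ∧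
      (∀ C, MeasurableSet C → ∀ x, ⟪x, E C x⟫_ℂ = ((ν x).real C : ℂ)) ∧
      ∀ u (c : ℝ), ν (Y u + (c : ℂ) • s u)
        = (ν (s u)).withDensity fun y => ENNReal.ofReal ((y + c) ^ 2) := by
  obtain ⟨U, hUu, hUab⟩ := exists_cayley_unitary hsymm
  exact exists_povm_of_unitary (inlIsometry H) hUu hs hUab hker

end QM

namespace QM

variable {H : Type*} [NormedAddCommGroup H] [InnerProductSpace ℂ H] [CompleteSpace H]

open HSSpace Filter Topology

/-! ### Observables with prescribed mean operator -/

/-- A Hilbert-Schmidt operator `Y = L √σ` with `L` symmetric is the mean `∫ y E(dy) √σ` of a POVM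
on the real line, whose second moment is `‖Y‖²`. -/
theorem exists_povm_realIntegralCLM_eq {σ Y : H →L[ℂ] H} (hσ : 0 ≤ σ) (hσ1 : IsTraceClass σ)
    (hY : IsHS Y) (hsymm : IsSelfAdjoint (CFC.sqrt σ * Y))
    (hker : ∀ x, σ x = 0 → star Y x = 0) :
    ∃ E : Set ℝ → H →L[ℂ] H, IsPOVM E ∧ ∃ f : Lp ℝ 2 (law E σ),
      realIntegralCLM E σ f = hs Y ∧ ‖f‖ = ‖hs Y‖ := by
  set s := CFC.sqrt σ with hs_def
  have hsa : IsSelfAdjoint s := sqrt_isSelfAdjoint σ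
  have hsHS : IsHS s := (isHS_sqrt_iff hσ).2 hσ1
  obtain ⟨E, hE, ν, hνfin, hν, hνd⟩ := exists_povm_of_symm (s := s) (Y := Y) hsa
    (fun u v => by
      have h := hsymm.inner_comm_apply u v
      rw [mul_apply_eq_comp, mul_apply_eq_comp, hsa.inner_comm_apply, ← hsa.inner_comm_apply u] at h
      exact h)
    (fun x hx => hker x (by rw [← sqrt_mul_self hσ, mul_apply_eq_comp, ← hs_def, hx, map_zero]))
  let P := law E σ
  have hP : P = Measure.sum fun i => ν (s (onb H i)) := by
    ext C hC
    have h := Complex.hasSum_re (hasSum_trace_mul_sqrt hσ hσ1 (E C))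
    rw [Measure.sum_apply _ hC, hE.law_apply hσ hσ1 hC, ← h.tsum_eq,
      ENNReal.ofReal_tsum_of_nonneg _ h.summable]
    · refine tsum_congr fun i => ?_
      rw [← hs_def, hν C hC, Complex.ofReal_re, ofReal_measureReal]
    · exact fun i => (Complex.nonneg_iff.1 (inner_apply_self_nonneg (hE.nonneg _ hC) _)).1
  have hν_univ : ∀ x, ν x Set.univ = ENNReal.ofReal (‖x‖ ^ 2) := fun x => by
    have h := hν Set.univ .univ x
    rw [hE.univ, one_apply_eq_self, inner_self_eq_ofReal_norm_sq] at h
    rw [← ofReal_measureReal]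
    congr 1
    exact_mod_cast h.symm
  -- Compare total masses in the density formula at `c = 0`.
  have hsq : ∀ u, ∫⁻ y, ENNReal.ofReal (y ^ 2) ∂(ν (s u))
      = ENNReal.ofReal (‖Y u‖ ^ 2) := fun u => by
    have h := congrArg (fun m : Measure ℝ => m Set.univ) (hνd u 0)
    simp only [Complex.ofReal_zero, zero_smul, add_zero, hν_univ, withDensity_apply _ .univ,
      Measure.restrict_univ] at h
    exact h.symm
  have hPsq : ∫⁻ y, ENNReal.ofReal (y ^ 2) ∂P = ENNReal.ofReal (‖hs Y‖ ^ 2) := by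
    have h := hasSum_norm_sq_hs hY
    rw [hP, lintegral_sum_measure, ← h.tsum_eq, ENNReal.ofReal_tsum_of_nonneg _ h.summable]
    · exact tsum_congr fun i => hsq _
    · exact fun i => sq_nonneg _
  have hmem : ∀ {m : Measure ℝ}, ∫⁻ y, ENNReal.ofReal (y ^ 2) ∂m ≠ ⊤ → MemLp (fun y : ℝ => y) 2 m :=
    fun {m} h => by
      rw [memLp_two_iff_integrable_sq (by fun_prop)]
      refine ⟨by fun_prop, ?_⟩
      rw [hasFiniteIntegral_iff_ofReal (Eventually.of_forall fun y => sq_nonneg _)]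
      exact h.lt_top
  have hid : MemLp (fun y : ℝ => y) 2 P := hmem (by rw [hPsq]; exact ENNReal.ofReal_ne_top)
  have hidν : ∀ u, MemLp (fun y : ℝ => y) 2 (ν (s u)) := fun u =>
    hmem (by rw [hsq]; exact ENNReal.ofReal_ne_top)
  -- Polarization: subtract the density formulas at `c = 1` and `c = -1`, using `(y + 1)² - (y - 1)²
  -- = 4y`.
  have hcross : ∀ C, MeasurableSet C → ∀ u, (⟪Y u, E C (s u)⟫_ℂ).re = ∫ y in C, y ∂(ν (s u)) :=
    fun C hC u => by
      have hf_int : ∀ c : ℝ, Integrable (fun y : ℝ => (y + c) ^ 2) (ν (s u)) := fun c =>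
        ((hidν u).add (memLp_const c)).integrable_sq
      have hq : ∀ c : ℝ, (⟪Y u + (c : ℂ) • s u, E C (Y u + (c : ℂ) • s u)⟫_ℂ).re
          = ∫ y in C, (y + c) ^ 2 ∂(ν (s u)) := fun c => by
        rw [hν C hC, Complex.ofReal_re, measureReal_def, hνd, withDensity_apply _ hC,
          integral_eq_lintegral_of_nonneg_ae (Eventually.of_forall fun y => sq_nonneg _)
            (by fun_prop)]
      have h1 := hq 1
      have h2 := hq (-1)
      have hsub : ∫ y in C, (y + 1) ^ 2 ∂(ν (s u)) - ∫ y in C, (y + -1) ^ 2 ∂(ν (s u))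
          = 4 * ∫ y in C, y ∂(ν (s u)) := by
        rw [← integral_sub (hf_int 1).integrableOn (hf_int (-1)).integrableOn, ← integral_const_mul]
        refine integral_congr_ae (Eventually.of_forall fun y => ?_)
        ring
      have hE' : (⟪s u, E C (Y u)⟫_ℂ).re = (⟪Y u, E C (s u)⟫_ℂ).re := by
        rw [← (IsSelfAdjoint.of_nonneg (hE.nonneg C hC)).inner_comm_apply, ← inner_conj_symm,
          Complex.conj_re]
      rw [← h1, ← h2] at hsub
      simp only [Complex.ofReal_neg, Complex.ofReal_one, one_smul, neg_smul, map_add, map_neg,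
        inner_add_left, inner_add_right, inner_neg_left, inner_neg_right, Complex.add_re,
        Complex.neg_re, hE'] at hsub
      linarith
  let f : Lp ℝ 2 P := hid.toLp _
  have hf : ∀ C (hC : MeasurableSet C),
      ⟪f, indicatorConstLp 2 hC (measure_ne_top _ _) 1⟫_ℝ = ∫ y in C, y ∂P := fun C hC => by
    rw [real_inner_comm, L2.inner_indicatorConstLp_one]
    refine setIntegral_congr_ae hC ?_
    filter_upwards [hid.coeFn_toLp] with y hy _ using hy
  have hfn : ‖f‖ ^ 2 = ‖hs Y‖ ^ 2 := by
    rw [← real_inner_self_eq_norm_sq, L2.inner_def,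
      ← ENNReal.toReal_ofReal (sq_nonneg ‖hs Y‖), ← hPsq, ← integral_eq_lintegral_of_nonneg_ae
        (Eventually.of_forall fun y => sq_nonneg _) (by fun_prop)]
    refine integral_congr_ae ?_
    filter_upwards [hid.coeFn_toLp] with y hy
    rw [hy, real_inner_self_eq_norm_sq, Real.norm_eq_abs, sq_abs]
  -- This says that the adjoint of the integral sends `Y` to `f`. As the integral is a contraction
  -- and `‖f‖ = ‖Y‖`, equality in Cauchy-Schwarz then gives that the integral of `f` is `Y`.
  have hadj : innerSL ℝ (hs Y) ∘L realIntegralCLM E σ = innerSL ℝ f := by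
    refine clm_ext_indicator fun C hC => ?_
    have hsum := Complex.hasSum_re (hasSum_inner_hs hY (hsHS.mul_left (E C)))
    have hf_int : Integrable (fun y : ℝ => y) (P.restrict C) :=
      (hid.integrable one_le_two).integrableOn
    have hsum' := hasSum_integral_measure (μ := fun i => (ν (s (onb H i))).restrict C)
      (f := fun y : ℝ => y) (by rwa [← Measure.restrict_sum _ hC, ← hP])
    rw [← Measure.restrict_sum _ hC, ← hP] at hsum'
    rw [ContinuousLinearMap.comp_apply, innerSL_apply_apply, innerSL_apply_apply, hf C hC,
      hE.realIntegralCLM_indicator hσ hσ1, real_inner_eq_re]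
    refine hsum.unique ?_
    simp only [mul_apply_eq_comp, hcross C hC]
    exact hsum'
  have hfY : ‖f‖ = ‖hs Y‖ := (sq_eq_sq₀ (norm_nonneg _) (norm_nonneg _)).1 hfn
  refine ⟨E, hE, f, ?_, hfY⟩
  have h1 : ⟪hs Y, realIntegralCLM E σ f⟫_ℝ = ‖f‖ ^ 2 := by
    rw [← real_inner_self_eq_norm_sq]
    exact DFunLike.congr_fun hadj f
  have h2 := norm_realIntegralCLM_apply_le f
  rw [← sub_eq_zero, ← norm_eq_zero, ← sq_eq_zero_iff]
  refine le_antisymm ?_ (sq_nonneg _)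
  rw [norm_sub_sq_real, real_inner_comm, h1, hfY]
  rw [hfY] at h2
  nlinarith [norm_nonneg (realIntegralCLM E σ f), norm_nonneg (hs Y)]

end QM

namespace QM

variable {H : Type*} [NormedAddCommGroup H] [InnerProductSpace ℂ H] [CompleteSpace H]

open HSSpace Filter Topology

/-! ### Positive functionals on the trace-class operators -/

theorem ketbra_add_left (u u' v : H) : ketbra (u + u') v = ketbra u v + ketbra u' v := by
  simp [ketbra]

theorem ketbra_add_right (u v v' : H) : ketbra u (v + v') = ketbra u v + ketbra u v' := by
  simp [ketbra]

theorem ketbra_smul_left (c : ℂ) (u v : H) : ketbra (c • u) v = c • ketbra u v := by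
  simp [ketbra]

theorem ketbra_smul_right (c : ℂ) (u v : H) :
    ketbra u (c • v) = (starRingEnd ℂ c) • ketbra u v := by
  simp [ketbra]

theorem star_ketbra (u v : H) : star (ketbra u v) = ketbra v u := by
  simp [ketbra, ContinuousLinearMap.star_eq_adjoint]

/-- A property of trace-class operators which is stable under linear combinations holds as soon
as it holds for the positive ones. -/
theorem isTraceClass_induction_nonneg {p : (H →L[ℂ] H) → Prop}
    (hadd : ∀ S T, IsTraceClass S → IsTraceClass T → p S → p T → p (S + T))
    (hsmul : ∀ (c : ℂ) T, IsTraceClass T → p T → p (c • T))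
    (hpos : ∀ T, 0 ≤ T → IsTraceClass T → p T) {T : H →L[ℂ] H} (hT : IsTraceClass T) : p T := by
  obtain ⟨R, S, hR, hS, rfl⟩ := hT.exists_mul
  -- Polarization of `R S` by the positive operators `Z c` at the four fourth roots of unity.
  let Z : ℂ → H →L[ℂ] H := fun c => (R + c • star S) * star (R + c • star S)
  have hZ : ∀ c, IsTraceClass (Z c) := fun c =>
    isTraceClass_mul (hR.add (hS.star.smul c)) (hR.add (hS.star.smul c)).star
  have hp : ∀ c d, p (d • Z c) := fun c d =>
    hsmul d _ (hZ c) (hpos _ (mul_star_self_nonneg _) (hZ c))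
  have key : R * S = (4⁻¹ : ℂ) • Z 1 + ((-4⁻¹ : ℂ) • Z (-1) + ((Complex.I * 4⁻¹) • Z Complex.I
      + (-(Complex.I * 4⁻¹)) • Z (-Complex.I))) := by
    simp only [Z, star_add, star_smul, star_star, mul_add, add_mul, smul_mul_assoc, mul_smul_comm,
      smul_add, smul_smul, one_smul, Complex.star_def, Complex.conj_I]
    match_scalars <;> ring_nf <;> simp [Complex.I_sq] <;> norm_num
  rw [key]
  exact hadd _ _ ((hZ _).smul _) (((hZ _).smul _).add (((hZ _).smul _).add ((hZ _).smul _)))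
    (hp _ _) (hadd _ _ ((hZ _).smul _) (((hZ _).smul _).add ((hZ _).smul _)) (hp _ _)
      (hadd _ _ ((hZ _).smul _) ((hZ _).smul _) (hp _ _) (hp _ _)))

variable {ω : (H →L[ℂ] H) → ℂ}

/-- On rank-one operators `ω` is a positive semidefinite sesquilinear form. Its Cauchy-Schwarz
inequality turns the diagonal bound by `C` into boundedness. -/
theorem exists_inner_eq_of_positive
    (hadd : ∀ S T, IsTraceClass S → IsTraceClass T → ω (S + T) = ω S + ω T)
    (hsmul : ∀ (c : ℂ) T, IsTraceClass T → ω (c • T) = c * ω T) {C : ℝ}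
    (h0 : ∀ T, 0 ≤ T → IsTraceClass T → 0 ≤ ω T)
    (hC : ∀ T, 0 ≤ T → IsTraceClass T → ω T ≤ C * trace T) :
    ∃ Y : H →L[ℂ] H, ∀ u v, ω (ketbra u v) = ⟪v, Y u⟫_ℂ := by
  have hal : ∀ u u' v, ω (ketbra (u + u') v) = ω (ketbra u v) + ω (ketbra u' v) := fun u u' v => by
    rw [ketbra_add_left, hadd _ _ (isTraceClass_ketbra _ _) (isTraceClass_ketbra _ _)]
  have har : ∀ u v v', ω (ketbra u (v + v')) = ω (ketbra u v) + ω (ketbra u v') := fun u v v' => by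
    rw [ketbra_add_right, hadd _ _ (isTraceClass_ketbra _ _) (isTraceClass_ketbra _ _)]
  have hsl : ∀ c u v, ω (ketbra (c • u) v) = c * ω (ketbra u v) := fun c u v => by
    rw [ketbra_smul_left, hsmul _ _ (isTraceClass_ketbra _ _)]
  have hsr : ∀ c u v, ω (ketbra u (c • v)) = (starRingEnd ℂ c) * ω (ketbra u v) := fun c u v => by
    rw [ketbra_smul_right, hsmul _ _ (isTraceClass_ketbra _ _)]
  have hq : ∀ u, 0 ≤ (ω (ketbra u u)).re ∧ (ω (ketbra u u)).im = 0 := fun u => by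
    have := Complex.nonneg_iff.1 (h0 _ (ketbra_self_nonneg u) (isTraceClass_ketbra u u))
    exact ⟨this.1, this.2.symm⟩
  have hqC : ∀ u, (ω (ketbra u u)).re ≤ C * ‖u‖ ^ 2 := fun u => by
    have h1 := hC _ (ketbra_self_nonneg u) (isTraceClass_ketbra u u)
    have h2 := trace_ketbra_mul u u 1
    rw [mul_one, one_apply_eq_self, inner_self_eq_ofReal_norm_sq] at h2
    rw [h2, ← Complex.ofReal_mul] at h1
    exact (Complex.le_def.1 h1).1
  have hsymm : ∀ u v, (starRingEnd ℂ) (ω (ketbra u v)) = ω (ketbra v u) := fun u v => by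
    have h1 := (hq (u + v)).2
    have h2 := (hq (u + Complex.I • v)).2
    simp only [hal, har, hsl, hsr, Complex.add_im, (hq u).2, (hq v).2, Complex.conj_I,
      Complex.mul_im, Complex.mul_re, Complex.neg_re, Complex.neg_im, Complex.I_re,
      Complex.I_im] at h1 h2
    refine Complex.ext ?_ ?_
    · rw [Complex.conj_re]; linarith
    · rw [Complex.conj_im]; linarith
  let core : PreInnerProductSpace.Core ℂ H :=
    { inner := fun x y => ω (ketbra y x)
      conj_inner_symm := fun x y => hsymm x y
      re_inner_nonneg := fun x => (hq x).1
      add_left := fun x y z => har z x y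
      smul_left := fun x y c => hsr c y x }
  have hCS : ∀ u v, ‖ω (ketbra u v)‖ ≤ C * ‖v‖ * ‖u‖ := fun u v => by
    have h1 : ‖ω (ketbra u v)‖ * ‖ω (ketbra v u)‖ ≤ (ω (ketbra v v)).re * (ω (ketbra u u)).re :=
      @InnerProductSpace.Core.inner_mul_inner_self_le ℂ H _ _ _ core v u
    rw [← hsymm u v, RCLike.norm_conj] at h1
    have hCv : 0 ≤ C * ‖v‖ * ‖u‖ := by
      by_cases hC0 : 0 ≤ C
      · positivity
      · have : ∀ w : H, ‖w‖ = 0 := fun w => by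
          by_contra hw
          have hw' : 0 < ‖w‖ ^ 2 := by positivity
          have := (hq w).1.trans (hqC w)
          nlinarith
        simp [this]
    refine le_of_sq_le_sq ?_ hCv
    calc ‖ω (ketbra u v)‖ ^ 2 ≤ (ω (ketbra v v)).re * (ω (ketbra u u)).re := by rw [sq]; exact h1
      _ ≤ (C * ‖v‖ ^ 2) * (C * ‖u‖ ^ 2) :=
        mul_le_mul (hqC v) (hqC u) (hq u).1 ((hq v).1.trans (hqC v))
      _ = (C * ‖v‖ * ‖u‖) ^ 2 := by ring
  let B : H →L⋆[ℂ] H →L[ℂ] ℂ := LinearMap.mkContinuous₂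
    (LinearMap.mk₂'ₛₗ (starRingEnd ℂ) (RingHom.id ℂ) (fun v u => ω (ketbra u v))
      (fun v v' u => har u v v') (fun c v u => hsr c u v) (fun v u u' => hal u u' v)
      (fun c v u => hsl c u v)) C (fun v u => hCS u v)
  refine ⟨star (InnerProductSpace.continuousLinearMapOfBilin B), fun u v => ?_⟩
  rw [inner_star_right, InnerProductSpace.continuousLinearMapOfBilin_apply]
  rfl

/-- A positive functional on the trace-class operators which is bounded by the trace is given by a
bounded operator. -/
theorem exists_trace_mul_eq_of_positive
    (hadd : ∀ S T, IsTraceClass S → IsTraceClass T → ω (S + T) = ω S + ω T)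
    (hsmul : ∀ (c : ℂ) T, IsTraceClass T → ω (c • T) = c * ω T) {C : ℝ}
    (h0 : ∀ T, 0 ≤ T → IsTraceClass T → 0 ≤ ω T)
    (hC : ∀ T, 0 ≤ T → IsTraceClass T → ω T ≤ C * trace T) :
    ∃ Y : H →L[ℂ] H, ∀ T, IsTraceClass T → trace (T * Y) = ω T := by
  obtain ⟨Y, hY⟩ := exists_inner_eq_of_positive hadd hsmul h0 hC
  refine ⟨Y, fun T hT => ?_⟩
  refine isTraceClass_induction_nonneg (p := fun T => trace (T * Y) = ω T)
    (fun S T hS hT h1 h2 => ?_) (fun c T hT h => ?_) (fun T hT0 hT => ?_) hT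
  · rw [add_mul, trace_add (hS.mul_right Y) (hT.mul_right Y), h1, h2, hadd S T hS hT]
  · rw [smul_mul_assoc, trace_smul, h, hsmul c T hT]
  set s := CFC.sqrt T with hs
  have hsa : IsSelfAdjoint s := sqrt_isSelfAdjoint T
  -- `F J = √T P_J √T` is a finite-rank minorant of `T`, with `P_J` a basis projection. Since `0 ≤
  -- ω(T - F J) ≤ C Tr(T - F J)`, the error tends to zero.
  let F : Finset (basisIndex H) → H →L[ℂ] H := fun J => ∑ i ∈ J, ketbra (s (onb H i)) (s (onb H i))
  have hF : ∀ J, IsTraceClass (F J) ∧ ω (F J) = ∑ i ∈ J, ⟪s (onb H i), Y (s (onb H i))⟫_ℂ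
      ∧ trace (F J) = ∑ i ∈ J, ⟪s (onb H i), s (onb H i)⟫_ℂ := fun J => by
    classical
    induction J using Finset.induction_on with
    | empty =>
      have h1 := hsmul 0 0 isTraceClass_zero
      rw [zero_smul, zero_mul] at h1
      simp only [F, Finset.sum_empty]
      exact ⟨isTraceClass_zero, h1, trace_zero⟩
    | insert i J hi ih =>
      obtain ⟨ih1, ih2, ih3⟩ := ih
      have hk := isTraceClass_ketbra (s (onb H i)) (s (onb H i))
      have e : F (insert i J) = ketbra (s (onb H i)) (s (onb H i)) + F J := Finset.sum_insert hi
      have ht := trace_ketbra_mul (s (onb H i)) (s (onb H i)) 1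
      rw [mul_one, one_apply_eq_self] at ht
      rw [e, Finset.sum_insert hi, Finset.sum_insert hi]
      exact ⟨hk.add ih1, by rw [hadd _ _ hk ih1, ih2, hY], by rw [trace_add hk ih1, ih3, ht]⟩
  have hle : ∀ J, 0 ≤ T - F J := fun J => by
    refine nonneg_of_inner fun x => ?_
    have h1 : ⟪x, T x⟫_ℂ = ((‖s x‖ ^ 2 : ℝ) : ℂ) := by
      rw [← inner_self_eq_ofReal_norm_sq, hsa.inner_comm_apply, ← mul_apply_eq_comp,
        sqrt_mul_self hT0]
    have h2 : ⟪x, F J x⟫_ℂ = ((∑ i ∈ J, ‖⟪onb H i, s x⟫_ℂ‖ ^ 2 : ℝ) : ℂ) := by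
      rw [sum_apply, inner_sum, Complex.ofReal_sum]
      refine Finset.sum_congr rfl fun i _ => ?_
      rw [ketbra_apply, inner_smul_right, hsa.inner_comm_apply, ← hsa.inner_comm_apply x,
        ← inner_conj_symm (s x), Complex.mul_conj, Complex.normSq_eq_norm_sq]
    rw [sub_apply, inner_sub_right, h1, h2, ← Complex.ofReal_sub]
    refine Complex.zero_le_real.2 (sub_nonneg.2 ?_)
    have h3 := hasSum_norm_inner_onb_sq (s x)
    exact sum_le_hasSum J (fun i _ => sq_nonneg _) h3
  have hωT : ∀ J, ω T = ω (F J) + ω (T - F J) := fun J => by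
    rw [← hadd _ _ (hF J).1 (hT.sub (hF J).1), add_sub_cancel]
  have hlim : Tendsto (fun J => ω (T - F J)) atTop (𝓝 0) := by
    have h1 := hasSum_trace_mul_sqrt hT0 hT 1
    rw [mul_one] at h1
    have h2 : Tendsto (fun J => C * (trace T - trace (F J)).re) atTop (𝓝 0) := by
      have h3 : Tendsto (fun J => trace (F J)) atTop (𝓝 (trace T)) := by
        simp only [hF]
        exact h1
      have h4 := (h3.const_sub (trace T))
      rw [sub_self] at h4
      have h5 := ((Complex.continuous_re.tendsto _).comp h4).const_mul C
      simpa using h5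
    refine squeeze_zero_norm (fun J => ?_) h2
    have h6 := h0 _ (hle J) (hT.sub (hF J).1)
    have h7 := hC _ (hle J) (hT.sub (hF J).1)
    rw [trace_sub hT (hF J).1] at h7
    have h8 := (Complex.le_def.1 h7).1
    rw [Complex.re_ofReal_mul] at h8
    rw [← Complex.ofReal_re (‖_‖), Complex.norm_of_nonneg' h6]
    exact h8
  have hlim2 : Tendsto (fun J => ω (F J)) atTop (𝓝 (trace (T * Y))) := by
    simp only [hF]
    exact hasSum_trace_mul_sqrt hT0 hT Y
  have h9 : Tendsto (fun J => ω (F J) + ω (T - F J)) atTop (𝓝 (trace (T * Y) + 0)) :=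
    hlim2.add hlim
  simp only [← hωT, add_zero] at h9
  exact tendsto_nhds_unique h9 tendsto_const_nhds

end QM

namespace QM

variable {H : Type*} [NormedAddCommGroup H] [InnerProductSpace ℂ H] [CompleteSpace H]

open HSSpace Filter Topology

/-! ### The dual of an instrument -/

theorem trace_mul_ketbra {T : H →L[ℂ] H} (hT : IsTraceClass T) (u v : H) :
    trace (T * ketbra u v) = ⟪v, T u⟫_ℂ := by
  rw [trace_mul_comm hT, trace_ketbra_mul]

theorem IsTraceClass.ext_of_forall_isSelfAdjoint {S T : H →L[ℂ] H} (hS : IsTraceClass S)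
    (hT : IsTraceClass T)
    (h : ∀ X, IsSelfAdjoint X → trace (S * X) = trace (T * X)) : S = T := by
  have hall : ∀ X : H →L[ℂ] H, trace (S * X) = trace (T * X) := fun X => by
    have hmem : X ∈ Submodule.span ℂ {a : H →L[ℂ] H | 0 ≤ a} := by
      rw [CStarAlgebra.span_nonneg]; trivial
    induction hmem using Submodule.span_induction with
    | mem X hX => exact h X (IsSelfAdjoint.of_nonneg hX)
    | zero => simp
    | add X Y _ _ hX hY =>
      rw [mul_add, mul_add, trace_add (hS.mul_right X) (hS.mul_right Y),
        trace_add (hT.mul_right X) (hT.mul_right Y), hX, hY]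
    | smul c X _ hX => rw [mul_smul_comm, mul_smul_comm, trace_smul, trace_smul, hX]
  ext x
  refine ext_inner_left ℂ fun v => ?_
  rw [← trace_mul_ketbra hS, ← trace_mul_ketbra hT, hall]

namespace CPInstrument

variable {Ω : Type*} [MeasurableSpace Ω] (𝓘 : CPInstrument H Ω) {B : Set Ω}

theorem nonneg (hB : MeasurableSet B) {T : H →L[ℂ] H} (hT : 0 ≤ T) (hT1 : IsTraceClass T) :
    0 ≤ 𝓘.toFun B T := by
  refine nonneg_of_inner fun x => ?_
  have := 𝓘.completelyPositive B hB 1 (fun _ _ => T) (fun _ _ => hT1)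
    (fun x => by simpa using inner_apply_self_nonneg hT (x 0)) (fun _ => x)
  simpa using this

theorem trace_le (hB : MeasurableSet B) {T : H →L[ℂ] H} (hT : 0 ≤ T) (hT1 : IsTraceClass T) :
    trace (𝓘.toFun B T) ≤ trace T := by
  -- A countable partition with `B` as one term; the remaining terms have nonnegative trace.
  let f : ℕ → Set Ω := fun k => if k = 0 then B else if k = 1 then Bᶜ else ∅
  have hf : ∀ k, MeasurableSet (f k) := fun k => by
    simp only [f]; split_ifs <;> simp [hB]
  have hd : Pairwise (Function.onFun Disjoint f) := fun i j hij => by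
    simp only [Function.onFun, f]
    split_ifs with h1 h2 h3 h4 h5 h6 <;>
      first
      | omega
      | exact disjoint_compl_right
      | exact disjoint_compl_left
      | exact Set.disjoint_empty _
      | exact Set.empty_disjoint _
  have hun : ⋃ k, f k = Set.univ := by
    refine Set.eq_univ_of_forall fun ω => Set.mem_iUnion.2 ?_
    by_cases h : ω ∈ B
    · exact ⟨0, by simpa [f] using h⟩
    · exact ⟨1, by simpa [f] using h⟩
  have h := 𝓘.iUnion f hf hd T hT1 1
  simp only [mul_one, hun, 𝓘.trace_univ T hT1] at h
  have h0 : f 0 = B := by simp [f]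
  rw [← h0]
  exact le_hasSum h 0 fun k _ => trace_nonneg (𝓘.nonneg (hf k) hT hT1)

/-- For `X ≥ 0` the functional is positive and bounded by `‖X‖` times the trace; the positive
operators span all bounded ones. -/
theorem exists_dual (hB : MeasurableSet B) (X : H →L[ℂ] H) :
    ∃ Y : H →L[ℂ] H, ∀ T, IsTraceClass T → trace (T * Y) = trace (𝓘.toFun B T * X) := by
  have hmem : X ∈ Submodule.span ℂ {a : H →L[ℂ] H | 0 ≤ a} := by
    rw [CStarAlgebra.span_nonneg]; trivial
  induction hmem using Submodule.span_induction with
  | mem X hX =>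
    have hX : 0 ≤ X := hX
    refine exists_trace_mul_eq_of_positive (C := ‖X‖) (fun S T hS hT => ?_) (fun c T hT => ?_)
      (fun T hT0 hT => ?_) (fun T hT0 hT => ?_)
    · rw [𝓘.map_add B hB S T hS hT, add_mul, trace_add ((𝓘.isTraceClass B hB S hS).mul_right X)
        ((𝓘.isTraceClass B hB T hT).mul_right X)]
    · rw [𝓘.map_smul B hB c T hT, smul_mul_assoc, trace_smul]
    · exact trace_mul_nonneg (𝓘.nonneg hB hT0 hT) (𝓘.isTraceClass B hB T hT) hX
    · have hIT := 𝓘.isTraceClass B hB T hT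
      have hX' : 0 ≤ (‖X‖ : ℂ) • (1 : H →L[ℂ] H) - X := by
        have := IsSelfAdjoint.le_algebraMap_norm_self (IsSelfAdjoint.of_nonneg hX)
        rw [sub_nonneg]
        rwa [Algebra.algebraMap_eq_smul_one] at this
      have h1 := trace_mul_nonneg (𝓘.nonneg hB hT0 hT) hIT hX'
      rw [mul_sub, mul_smul_comm, mul_one, trace_sub (hIT.smul _) (hIT.mul_right X), trace_smul,
        sub_nonneg] at h1
      exact h1.trans (mul_le_mul_of_nonneg_left (𝓘.trace_le hB hT0 hT)
        (Complex.zero_le_real.2 (norm_nonneg X)))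
  | zero => exact ⟨0, fun T _ => by simp⟩
  | add X Y _ _ hX hY =>
    obtain ⟨X', hX'⟩ := hX
    obtain ⟨Y', hY'⟩ := hY
    refine ⟨X' + Y', fun T hT => ?_⟩
    have hIT := 𝓘.isTraceClass B hB T hT
    rw [mul_add, mul_add, trace_add (hT.mul_right X') (hT.mul_right Y'),
      trace_add (hIT.mul_right X) (hIT.mul_right Y), hX' T hT, hY' T hT]
  | smul c X _ hX =>
    obtain ⟨X', hX'⟩ := hX
    exact ⟨c • X', fun T hT => by
      rw [mul_smul_comm, mul_smul_comm, trace_smul, trace_smul, hX' T hT]⟩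

theorem trace_mul_dual (hB : MeasurableSet B) (X : H →L[ℂ] H) {T : H →L[ℂ] H}
    (hT : IsTraceClass T) : trace (T * 𝓘.dual B X) = trace (𝓘.toFun B T * X) := by
  rw [dual, dif_pos (𝓘.exists_dual hB X)]
  exact (𝓘.exists_dual hB X).choose_spec T hT

theorem inner_dual (hB : MeasurableSet B) (X : H →L[ℂ] H) (u v : H) :
    ⟪v, 𝓘.dual B X u⟫_ℂ = trace (𝓘.toFun B (ketbra u v) * X) := by
  rw [← trace_ketbra_mul, 𝓘.trace_mul_dual hB X (isTraceClass_ketbra u v)]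

theorem dual_add (hB : MeasurableSet B) (X Y : H →L[ℂ] H) :
    𝓘.dual B (X + Y) = 𝓘.dual B X + 𝓘.dual B Y :=
  eq_of_forall_trace_eq fun T hT => by
    have hIT := 𝓘.isTraceClass B hB T hT
    rw [𝓘.trace_mul_dual hB _ hT, mul_add, mul_add, trace_add (hIT.mul_right X) (hIT.mul_right Y),
      trace_add (hT.mul_right _) (hT.mul_right _), 𝓘.trace_mul_dual hB _ hT,
      𝓘.trace_mul_dual hB _ hT]

theorem dual_smul (hB : MeasurableSet B) (c : ℂ) (X : H →L[ℂ] H) :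
    𝓘.dual B (c • X) = c • 𝓘.dual B X :=
  eq_of_forall_trace_eq fun T hT => by
    rw [𝓘.trace_mul_dual hB _ hT, mul_smul_comm, mul_smul_comm, trace_smul, trace_smul,
      𝓘.trace_mul_dual hB _ hT]

theorem dual_nonneg (hB : MeasurableSet B) {X : H →L[ℂ] H} (hX : 0 ≤ X) : 0 ≤ 𝓘.dual B X :=
  nonneg_of_inner fun u => by
    rw [𝓘.inner_dual hB]
    exact trace_mul_nonneg (𝓘.nonneg hB (ketbra_self_nonneg u) (isTraceClass_ketbra u u))
      (𝓘.isTraceClass B hB _ (isTraceClass_ketbra u u)) hX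

theorem dual_star (hB : MeasurableSet B) (X : H →L[ℂ] H) :
    𝓘.dual B (star X) = star (𝓘.dual B X) := by
  have hmem : X ∈ Submodule.span ℂ {a : H →L[ℂ] H | 0 ≤ a} := by
    rw [CStarAlgebra.span_nonneg]; trivial
  induction hmem using Submodule.span_induction with
  | mem X hX =>
    rw [(IsSelfAdjoint.of_nonneg hX).star_eq,
      (IsSelfAdjoint.of_nonneg (𝓘.dual_nonneg hB hX)).star_eq]
  | zero =>
    have : 𝓘.dual B 0 = 0 := by simpa using 𝓘.dual_smul hB 0 0
    rw [star_zero, this, star_zero]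
  | add X Y _ _ hX hY => rw [star_add, 𝓘.dual_add hB, 𝓘.dual_add hB, star_add, hX, hY]
  | smul c X _ hX => rw [star_smul, 𝓘.dual_smul hB, 𝓘.dual_smul hB, star_smul, hX]

theorem dual_univ_one : 𝓘.dual Set.univ 1 = 1 :=
  eq_of_forall_trace_eq fun T hT => by
    rw [𝓘.trace_mul_dual .univ _ hT, mul_one, mul_one, 𝓘.trace_univ T hT]

theorem isPOVM_povm : IsPOVM 𝓘.povm where
  nonneg _ hB := 𝓘.dual_nonneg hB zero_le_one
  univ := 𝓘.dual_univ_one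
  iUnion f hf hd x y := by
    simp only [povm, 𝓘.inner_dual (hf _), 𝓘.inner_dual (MeasurableSet.iUnion hf)]
    exact 𝓘.iUnion f hf hd _ (isTraceClass_ketbra y x) 1

theorem hasSum_iUnion_dual {f : ℕ → Set Ω} (hf : ∀ k, MeasurableSet (f k))
    (hd : Pairwise (Function.onFun Disjoint f)) (X : H →L[ℂ] H) (u : H) :
    HasSum (fun k => ⟪u, 𝓘.dual (f k) X u⟫_ℂ) ⟪u, 𝓘.dual (⋃ k, f k) X u⟫_ℂ := by
  simp only [𝓘.inner_dual (hf _), 𝓘.inner_dual (MeasurableSet.iUnion hf)]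
  exact 𝓘.iUnion f hf hd _ (isTraceClass_ketbra u u) X

variable {ρ : H →L[ℂ] H}

/-- The Kadison-Schwarz inequality for the dual map, in the mean over a state. -/
theorem norm_hs_dual_mul_sqrt_le (hB : MeasurableSet B) (hρ : 0 ≤ ρ) (hρ1 : IsTraceClass ρ)
    (X : H →L[ℂ] H) :
    ‖hs (𝓘.dual B X * CFC.sqrt ρ)‖ ≤ ‖hs (X * CFC.sqrt (𝓘.toFun B ρ))‖ := by
  set D := 𝓘.dual B X with hD
  set r := CFC.sqrt ρ with hr
  set σ := 𝓘.toFun B ρ with hσ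
  have hσ0 : 0 ≤ σ := 𝓘.nonneg hB hρ hρ1
  have hσ1 : IsTraceClass σ := 𝓘.isTraceClass B hB ρ hρ1
  have hrHS : IsHS r := (isHS_sqrt_iff hρ).2 hρ1
  have hsHS : IsHS (CFC.sqrt σ) := (isHS_sqrt_iff hσ0).2 hσ1
  have hra : IsSelfAdjoint r := sqrt_isSelfAdjoint ρ
  set W := D * r with hW
  have hWHS : IsHS W := hrHS.mul_left D
  -- The Gram block of the pair `(W*, -√ρ)`. Two-positivity, tested on `(e_i, X* e_i)` and summed,
  -- gives `0 ≤ Tr 𝓘(W W*) - 2‖W‖² + ‖X√σ‖²`, and the first term is at most `‖W‖²`.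
  let T : Fin 2 → Fin 2 → H →L[ℂ] H := ![![W * star W, -(W * r)], ![-(r * star W), ρ]]
  have hTc : ∀ i j, IsTraceClass (T i j) := by
    intro i j
    fin_cases i <;> fin_cases j
    · exact isTraceClass_mul hWHS hWHS.star
    · exact (isTraceClass_mul hWHS hrHS).neg
    · exact (isTraceClass_mul hrHS hWHS.star).neg
    · exact hρ1
  have hTpos : ∀ x : Fin 2 → H, 0 ≤ ∑ i, ∑ j, ⟪x i, T i j (x j)⟫_ℂ := fun x => by
    have h1 : ∑ i, ∑ j, ⟪x i, T i j (x j)⟫_ℂ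
        = ⟪star W (x 0) - r (x 1), star W (x 0) - r (x 1)⟫_ℂ := by
      have h2 : ⟪x 1, ρ (x 1)⟫_ℂ = ⟪r (x 1), r (x 1)⟫_ℂ := by
        rw [hra.inner_comm_apply, ← mul_apply_eq_comp, sqrt_mul_self hρ]
      simp only [Fin.sum_univ_two, T, Matrix.cons_val_zero, Matrix.cons_val_one, neg_apply,
        mul_apply_eq_comp, inner_neg_right, inner_sub_left, inner_sub_right, inner_star_left, h2,
        hra.inner_comm_apply]
      ring
    rw [h1, inner_self_eq_ofReal_norm_sq]
    exact Complex.zero_le_real.2 (sq_nonneg _)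
  have hcp := 𝓘.completelyPositive B hB 2 T hTc hTpos
  have hI : ∀ i j, IsTraceClass (𝓘.toFun B (T i j)) := fun i j => 𝓘.isTraceClass B hB _ (hTc i j)
  have h00 : trace (𝓘.toFun B (T 0 0)) ≤ ((‖hs W‖ ^ 2 : ℝ) : ℂ) := by
    refine (𝓘.trace_le hB (mul_star_self_nonneg W) (hTc 0 0)).trans (le_of_eq ?_)
    rw [trace_mul_comm_of_isHS hWHS hWHS.star, trace_star_mul hWHS hWHS,
      inner_self_eq_ofReal_norm_sq]
  have h01 : trace (𝓘.toFun B (T 0 1) * star X) = -((‖hs W‖ ^ 2 : ℝ) : ℂ) := by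
    rw [← 𝓘.trace_mul_dual hB _ (hTc 0 1), 𝓘.dual_star hB, ← hD]
    change trace (-(W * r) * star D) = _
    have : W * r * star D = W * star W := by rw [hW, star_mul, hra.star_eq, mul_assoc (D * r)]
    rw [neg_mul, trace_neg, this, trace_mul_comm_of_isHS hWHS hWHS.star, trace_star_mul hWHS hWHS,
      inner_self_eq_ofReal_norm_sq]
  have h10 : trace (X * 𝓘.toFun B (T 1 0)) = -((‖hs W‖ ^ 2 : ℝ) : ℂ) := by
    rw [← trace_mul_comm (hI 1 0), ← 𝓘.trace_mul_dual hB _ (hTc 1 0), ← hD]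
    change trace (-(r * star W) * D) = _
    rw [neg_mul, trace_neg, mul_assoc, trace_mul_comm_of_isHS hrHS (hWHS.star.mul_right D),
      mul_assoc, ← hW, trace_star_mul hWHS hWHS, inner_self_eq_ofReal_norm_sq]
  have h11 : trace (X * (𝓘.toFun B (T 1 1) * star X))
      = ((‖hs (X * CFC.sqrt σ)‖ ^ 2 : ℝ) : ℂ) := by
    have hXs := hsHS.mul_left X
    have : X * (𝓘.toFun B (T 1 1) * star X)
        = X * CFC.sqrt σ * star (X * CFC.sqrt σ) := by
      change X * (σ * star X) = _
      rw [star_mul, (sqrt_isSelfAdjoint σ).star_eq]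
      nth_rewrite 1 [← sqrt_mul_self hσ0]
      simp only [mul_assoc]
    rw [this, trace_mul_comm_of_isHS hXs hXs.star, trace_star_mul hXs hXs,
      inner_self_eq_ofReal_norm_sq]
  have hsum : 0 ≤ trace (𝓘.toFun B (T 0 0)) + trace (𝓘.toFun B (T 0 1) * star X)
      + (trace (X * 𝓘.toFun B (T 1 0)) + trace (X * (𝓘.toFun B (T 1 1) * star X))) := by
    have hs1 := (((hI 0 0).hasSum_trace).add ((hI 0 1).mul_right (star X)).hasSum_trace).add
      ((((hI 1 0).mul_left X).hasSum_trace).add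
        (((hI 1 1).mul_right (star X)).mul_left X).hasSum_trace)
    refine hs1.nonneg fun i => ?_
    have h3 := hcp ![onb H i, star X (onb H i)]
    simp only [Fin.sum_univ_two, Matrix.cons_val_zero, Matrix.cons_val_one] at h3
    simp only [mul_apply_eq_comp]
    rw [← inner_star_left X, ← inner_star_left X]
    exact h3
  rw [h01, h10, h11] at hsum
  have h4 := (Complex.le_def.1 hsum).1
  have h5 := (Complex.le_def.1 h00).1
  simp only [Complex.zero_re, Complex.add_re, Complex.neg_re, Complex.ofReal_re] at h4 h5
  exact le_of_sq_le_sq (by linarith) (norm_nonneg _)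

end CPInstrument

end QM

namespace QM

variable {H : Type*} [NormedAddCommGroup H] [InnerProductSpace ℂ H] [CompleteSpace H]

open HSSpace Filter Topology

/-! ### Transfer of logarithmic derivatives by a channel -/

theorem real_inner_hs_ketbra (t : HSSpace H) (a b : H) :
    ⟪t, hs (ketbra a b)⟫_ℝ = (⟪op t b, a⟫_ℂ).re := by
  have h := trace_star_mul (isHS_op t) (isHS_ketbra a b)
  rw [hs_op] at h
  rw [real_inner_eq_re, ← h, mul_ketbra]
  have h2 := trace_ketbra_mul (star (op t) a) b 1
  rw [mul_one, one_apply_eq_self] at h2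
  rw [h2, inner_star_right]

namespace CPInstrument

variable {Ω : Type*} [MeasurableSpace Ω] (𝓘 : CPInstrument H Ω) {B : Set Ω} {ρ : H →L[ℂ] H}

/-- Kadison-Schwarz bounds the image of `|v⟩⟨x|` by `‖ |v⟩⟨√σ x| ‖ = 0`, and faithfulness of `ρ`
removes the factor `√ρ`. -/
theorem dual_ketbra_eq_zero (hB : MeasurableSet B) (hρ : IsFaithful ρ) {x : H}
    (hx : 𝓘.toFun B ρ x = 0) (v : H) :
    𝓘.dual B (ketbra v x) = 0 ∧ 𝓘.dual B (ketbra x v) = 0 := by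
  have hσ0 := 𝓘.nonneg hB hρ.nonneg hρ.isTraceClass
  have hsx : CFC.sqrt (𝓘.toFun B ρ) x = 0 := by
    have := norm_sqrt_apply_sq hσ0 x
    rw [hx, inner_zero_right, Complex.zero_re, sq_eq_zero_iff, norm_eq_zero] at this
    exact this
  have h1 := 𝓘.norm_hs_dual_mul_sqrt_le hB hρ.nonneg hρ.isTraceClass (ketbra v x)
  have h0 : ketbra v (0 : H) = 0 := by simp [ketbra]
  rw [ketbra_mul, (sqrt_isSelfAdjoint _).star_eq, hsx, h0, hs_zero, norm_zero] at h1
  have h2 : 𝓘.dual B (ketbra v x) * CFC.sqrt ρ = 0 := by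
    rw [← op_hs (hρ.isHS_sqrt.mul_left _), norm_le_zero_iff.1 h1, map_zero]
  have h3 := hρ.eq_zero_of_mul_sqrt h2
  refine ⟨h3, ?_⟩
  rw [← star_ketbra, 𝓘.dual_star hB, h3, star_zero]

/-- The contraction `X √σ ↦ 𝓔*(X) √ρ`, where `σ = 𝓔 ρ`; its adjoint maps logarithmic derivatives
of the model `ρ` to those of the model `σ`. -/
theorem exists_transfer (hB : MeasurableSet B) (hρ : IsFaithful ρ) :
    ∃ Γ : HSSpace H →L[ℝ] HSSpace H,
      (∀ X, IsSelfAdjoint X →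
        Γ (hs (X * CFC.sqrt (𝓘.toFun B ρ))) = hs (𝓘.dual B X * CFC.sqrt ρ)) ∧
      (∀ t, sldInfo (𝓘.toFun B ρ) (𝓘.toFun B (sldDir ρ (op t)))
        ≤ ENNReal.ofReal (‖ContinuousLinearMap.adjoint Γ t‖ ^ 2)) ∧
      ∀ y ∈ closure (Set.range (ContinuousLinearMap.adjoint Γ)),
        IsSelfAdjoint (CFC.sqrt (𝓘.toFun B ρ) * op y) ∧
          ∀ x, 𝓘.toFun B ρ x = 0 → star (op y) x = 0 := by
  set σ := 𝓘.toFun B ρ with hσ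
  set r := CFC.sqrt ρ with hr
  set s := CFC.sqrt σ with hs_def
  have hσ0 : 0 ≤ σ := 𝓘.nonneg hB hρ.nonneg hρ.isTraceClass
  have hσ1 : IsTraceClass σ := 𝓘.isTraceClass B hB ρ hρ.isTraceClass
  have hrHS : IsHS r := hρ.isHS_sqrt
  have hsHS : IsHS s := (isHS_sqrt_iff hσ0).2 hσ1
  have hsa : IsSelfAdjoint s := sqrt_isSelfAdjoint σ
  have hker : ∀ x, σ x = 0 → s x = 0 := fun x hx => by
    have := norm_sqrt_apply_sq hσ0 x
    rwa [hx, inner_zero_right, Complex.zero_re, sq_eq_zero_iff, norm_eq_zero] at this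
  let a : selfAdjoint (H →L[ℂ] H) →ₗ[ℝ] HSSpace H :=
    { toFun := fun X => hs ((X : H →L[ℂ] H) * s)
      map_add' := fun X Y => by
        rw [AddSubgroup.coe_add, add_mul, hs_add (hsHS.mul_left _) (hsHS.mul_left _)]
      map_smul' := fun c X => by
        have : ((c • X : selfAdjoint (H →L[ℂ] H)) : H →L[ℂ] H) = (c : ℂ) • (X : H →L[ℂ] H) := rfl
        rw [this, smul_mul_assoc, hs_smul _ (hsHS.mul_left _)]
        rfl }
  let b : selfAdjoint (H →L[ℂ] H) →ₗ[ℝ] HSSpace H :=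
    { toFun := fun X => hs (𝓘.dual B (X : H →L[ℂ] H) * r)
      map_add' := fun X Y => by
        rw [AddSubgroup.coe_add, 𝓘.dual_add hB, add_mul, hs_add (hrHS.mul_left _) (hrHS.mul_left _)]
      map_smul' := fun c X => by
        have : ((c • X : selfAdjoint (H →L[ℂ] H)) : H →L[ℂ] H) = (c : ℂ) • (X : H →L[ℂ] H) := rfl
        rw [this, 𝓘.dual_smul hB, smul_mul_assoc, hs_smul _ (hrHS.mul_left _)]
        rfl }
  obtain ⟨Γ, hΓ, -, hΓ0⟩ := exists_factor_of_norm_le a b zero_le_one fun X => by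
    rw [one_mul]
    exact 𝓘.norm_hs_dual_mul_sqrt_le hB hρ.nonneg hρ.isTraceClass X
  have hΓX : ∀ X, IsSelfAdjoint X → Γ (hs (X * s)) = hs (𝓘.dual B X * r) := fun X hX =>
    hΓ ⟨X, hX⟩
  -- `Γ` vanishes on the complement of the vectors `X√σ` with `X` self-adjoint, so its adjoint takes
  -- values in their closure. Symmetry and vanishing on `ker σ` pass to the limit.
  have hcl : ∀ t, ContinuousLinearMap.adjoint Γ t ∈ closure (Set.range a) := fun t => by
    have : ContinuousLinearMap.adjoint Γ t ∈ (LinearMap.range a)ᗮᗮ := by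
      refine (Submodule.mem_orthogonal _ _).2 fun z hz => ?_
      rw [ContinuousLinearMap.adjoint_inner_right, hΓ0 z hz, inner_zero_left]
    rw [Submodule.orthogonal_orthogonal_eq_closure] at this
    exact this
  have hsymm : ∀ t, IsSelfAdjoint (s * op (ContinuousLinearMap.adjoint Γ t)) := fun t => by
    refine closure_minimal ?_ (isClosed_isSelfAdjoint_mul_op s) (hcl t)
    rintro _ ⟨X, rfl⟩
    change IsSelfAdjoint (s * op (hs ((X : H →L[ℂ] H) * s)))
    rw [op_hs (hsHS.mul_left _), IsSelfAdjoint, star_mul, star_mul, hsa.star_eq, X.2.star_eq,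
      mul_assoc]
  have hkill : ∀ t x, σ x = 0 → op (ContinuousLinearMap.adjoint Γ t) x = 0 := fun t x hx => by
    refine closure_minimal (t := {y : HSSpace H | op y x = 0}) ?_
      (isClosed_eq (continuous_op_apply x) continuous_const) (hcl t)
    rintro _ ⟨X, rfl⟩
    change op (hs ((X : H →L[ℂ] H) * s)) x = 0
    rw [op_hs (hsHS.mul_left _), mul_apply_eq_comp, hker x hx, map_zero]
  -- This is the kernel condition needed for the Cayley transform when `σ` is not faithful; it does
  -- not follow from `hkill`. The dual map kills `|x⟩⟨v| + |v⟩⟨x|`, so `y √σ v` is orthogonal to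
  -- `x`.
  have hstar : ∀ t x, σ x = 0 → star (op (ContinuousLinearMap.adjoint Γ t)) x = 0 := by
    intro t x hx
    set y := ContinuousLinearMap.adjoint Γ t with hy
    have h1 : ∀ v, (⟪op y (s v), x⟫_ℂ).re = 0 := fun v => by
      have hZ : IsSelfAdjoint (ketbra x v + ketbra v x) := by
        rw [IsSelfAdjoint, star_add, star_ketbra, star_ketbra, add_comm]
      have h2 := hΓX _ hZ
      obtain ⟨h3, h4⟩ := 𝓘.dual_ketbra_eq_zero hB hρ hx v
      rw [𝓘.dual_add hB, h3, h4, add_zero, zero_mul, hs_zero, add_mul, ketbra_mul, ketbra_mul,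
        hsa.star_eq, hker x hx] at h2
      have h0 : ketbra v (0 : H) = 0 := by simp [ketbra]
      rw [h0, add_zero] at h2
      rw [← real_inner_hs_ketbra, hy, ContinuousLinearMap.adjoint_inner_left, h2, inner_zero_right]
    have h5 : ∀ v, ⟪op y (s v), x⟫_ℂ = 0 := fun v => by
      refine Complex.ext (h1 v) ?_
      have h6 := h1 (Complex.I • v)
      rw [_root_.map_smul, _root_.map_smul, inner_smul_left, Complex.conj_I] at h6
      simpa using h6
    set z := star (op y) x with hz
    have h7 : s z = 0 := by
      refine ext_inner_left ℂ fun v => ?_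
      rw [← hsa.inner_comm_apply, hz, inner_star_right, h5, inner_zero_right]
    -- For `z = y* x`, `√σ z = 0` puts `z` in `ker σ`, so `y z = 0` and `‖z‖² = ⟨y z, x⟩ = 0`.
    have h8 : op y z = 0 := hkill t z (by
      rw [← sqrt_mul_self hσ0, mul_apply_eq_comp, ← hs_def, h7, map_zero])
    rw [← inner_self_eq_zero (𝕜 := ℂ)]
    nth_rewrite 2 [hz]
    rw [inner_star_right, h8, inner_zero_left]
  refine ⟨Γ, hΓX, fun t => ?_, fun y hy => ⟨?_, fun x hx => ?_⟩⟩
  · set y := ContinuousLinearMap.adjoint Γ t with hy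
    have hsld : IsSLD σ (𝓘.toFun B (sldDir ρ (op t))) (op y) := by
      refine ⟨hkill t, hsymm t, ?_⟩
      change _ = sldDir σ (op y)
      have hφ := isTraceClass_sldDir hrHS (isHS_op t)
      have hφ' := isTraceClass_sldDir hsHS (isHS_op y)
      refine (𝓘.isTraceClass B hB _ hφ).ext_of_forall_isSelfAdjoint hφ' fun X hX => ?_
      have hDX : IsSelfAdjoint (𝓘.dual B X) := by
        rw [IsSelfAdjoint, ← 𝓘.dual_star hB, hX.star_eq]
      rw [← 𝓘.trace_mul_dual hB X hφ, trace_sldDir_mul hrHS (isHS_op t) hDX,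
        trace_sldDir_mul hsHS (isHS_op y) hX, hs_op, hs_op, ← hs_def, ← hr, ← hΓX X hX, hy,
        ContinuousLinearMap.adjoint_inner_left]
    exact (iInf₂_le _ hsld).trans (le_of_eq (hsNormSq_op y))
  · refine closure_minimal ?_ (isClosed_isSelfAdjoint_mul_op s) hy
    rintro _ ⟨t, rfl⟩
    exact hsymm t
  · refine ext_inner_right ℂ fun v => ?_
    rw [inner_star_left, inner_zero_left]
    refine closure_minimal (t := {y : HSSpace H | ⟪x, op y v⟫_ℂ = 0}) ?_
      (isClosed_eq ((continuous_const.inner (continuous_op_apply v))) continuous_const) hy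
    rintro _ ⟨t, rfl⟩
    change ⟪x, op (ContinuousLinearMap.adjoint Γ t) v⟫_ℂ = 0
    rw [← inner_star_left, hstar t x hx, inner_zero_left]

end CPInstrument

end QM

/-! ### Extending a bimeasure to a measure on the product -/

open Filter Topology ProbabilityTheory in
/-- A bimeasure on a measurable space and the real line extends to a measure on the product. -/
theorem MeasureTheory.exists_measure_prod_of_bimeasure {Ω : Type*} [MeasurableSpace Ω]
    (m : Set ℝ → Measure Ω) (n : Set Ω → Measure ℝ) (hfin : IsFiniteMeasure (m Set.univ))
    (h : ∀ C D, MeasurableSet C → MeasurableSet D → m D C = n C D) :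
    ∃ μ : Measure (Ω × ℝ), IsFiniteMeasure μ ∧
      ∀ C D, MeasurableSet C → MeasurableSet D → μ (C ×ˢ D) = m D C := by
  set m₀ := m Set.univ with hm₀
  have hmono : ∀ D D', MeasurableSet D → MeasurableSet D' → D ⊆ D' → m D ≤ m D' :=
    fun D D' hD hD' hDD' => Measure.le_iff.2 fun C hC => by
      rw [h C D hC hD, h C D' hC hD']; exact measure_mono hDD'
  have hle : ∀ D, MeasurableSet D → m D ≤ m₀ := fun D hD =>
    hmono D _ hD .univ (Set.subset_univ D)
  have hmfin : ∀ D, MeasurableSet D → IsFiniteMeasure (m D) := fun D hD =>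
    isFiniteMeasure_of_le _ (hle D hD)
  let I : ℚ → Set ℝ := fun q => Set.Iic (q : ℝ)
  have hI : ∀ q, MeasurableSet (I q) := fun q => measurableSet_Iic
  have hImono : Monotone I := fun q r hqr => Set.Iic_subset_Iic.2 (by exact_mod_cast hqr)
  have hnfin : IsFiniteMeasure (n Set.univ) := ⟨by
    rw [← h _ _ .univ .univ]; exact measure_lt_top _ _⟩
  -- `f q` is the conditional distribution function at a rational point. Almost everywhere it is
  -- monotone with limits `0` and `1` and is right-continuous, so it defines a Markov kernel.
  let f : ℚ → Ω → ℝ≥0∞ := fun q => (m (I q)).rnDeriv m₀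
  have hfm : ∀ q, Measurable (f q) := fun q => Measure.measurable_rnDeriv _ _
  have hset : ∀ q C, MeasurableSet C → ∫⁻ ω in C, f q ω ∂m₀ = m (I q) C := fun q C hC => by
    have := hmfin _ (hI q)
    rw [← withDensity_apply _ hC, Measure.withDensity_rnDeriv_eq _ _
      (Measure.absolutelyContinuous_of_le (hle _ (hI q)))]
  have hf_int : ∀ q, ∫⁻ ω, f q ω ∂m₀ = n Set.univ (I q) := fun q => by
    rw [← setLIntegral_univ, hset q _ .univ, h _ _ .univ (hI q)]
  have hf_mono : ∀ᵐ ω ∂m₀, Monotone fun q => f q ω := by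
    simp_rw [Monotone, ae_all_iff]
    refine fun q r hqr => ae_le_of_forall_setLIntegral_le_of_sigmaFinite (hfm q) fun C hC _ => ?_
    rw [hset q C hC, hset r C hC]
    exact hmono _ _ (hI q) (hI r) (hImono hqr) C
  have hf_one : ∀ᵐ ω ∂m₀, ∀ q, f q ω ≤ 1 := by
    rw [ae_all_iff]
    refine fun q => ae_le_of_forall_setLIntegral_le_of_sigmaFinite (hfm q) fun C hC _ => ?_
    rw [hset q C hC, setLIntegral_one]
    exact hle _ (hI q) C
  have hf_top : ∀ᵐ ω ∂m₀, ⨆ q, f q ω = 1 := by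
    refine ae_eq_of_ae_le_of_lintegral_le (f := fun ω => ⨆ q, f q ω) (g := fun _ => 1)
      ?_ ?_ aemeasurable_const ?_
    · filter_upwards [hf_one] with ω hω using iSup_le hω
    · refine ne_top_of_le_ne_top (measure_ne_top m₀ Set.univ) ?_
      rw [← lintegral_one]
      refine lintegral_mono_ae ?_
      filter_upwards [hf_one] with ω hω using iSup_le hω
    · have h1 : m₀ Set.univ = ⨆ q, n Set.univ (I q) := by
        rw [hm₀, h _ _ .univ .univ, ← hImono.measure_iUnion]
        exact congrArg _ Real.iUnion_Iic_rat.symm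
      rw [lintegral_one, h1]
      refine iSup_le fun q => ?_
      rw [← hf_int q]
      exact lintegral_mono fun ω => le_iSup (fun q => f q ω) q
  have hf_bot : ∀ᵐ ω ∂m₀, ⨅ q, f q ω = 0 := by
    have h0 : ∫⁻ ω, ⨅ q, f q ω ∂m₀ = 0 := by
      refine le_antisymm ?_ zero_le
      have h1 : n Set.univ (⋂ q : ℚ, I q) = ⨅ q, n Set.univ (I q) :=
        hImono.measure_iInter (fun q => (hI q).nullMeasurableSet)
          ⟨0, measure_ne_top _ _⟩
      rw [Real.iInter_Iic_rat, measure_empty] at h1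
      rw [h1]
      refine le_iInf fun q => ?_
      rw [← hf_int q]
      exact lintegral_mono fun ω => iInf_le (fun q => f q ω) q
    exact (lintegral_eq_zero_iff (Measurable.iInf hfm)).1 h0
  have hf_right : ∀ᵐ ω ∂m₀, ∀ q, ⨅ r : Set.Ioi q, f r ω = f q ω := by
    rw [ae_all_iff]
    intro q
    have h1 : f q =ᵐ[m₀] fun ω => ⨅ r : Set.Ioi q, f r ω := by
      refine ae_eq_of_ae_le_of_lintegral_le ?_ ?_
        (Measurable.iInf fun r : Set.Ioi q => hfm r).aemeasurable ?_
      · filter_upwards [hf_mono] with ω hω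
        exact le_iInf fun r => hω (le_of_lt r.2)
      · rw [hf_int]; exact measure_ne_top _ _
      · have h2 : n Set.univ (⋂ r : Set.Ioi q, I r) = ⨅ r : Set.Ioi q, n Set.univ (I r) := by
          refine Monotone.measure_iInter (s := fun r : Set.Ioi q => I r)
            (fun r r' hrr' => hImono hrr') (fun r => (hI r).nullMeasurableSet)
            ⟨⟨q + 1, by simp⟩, measure_ne_top _ _⟩
        have h3 : ⋂ r : Set.Ioi q, I r = I q := by
          refine Set.Subset.antisymm (fun x hx => ?_)
            (Set.subset_iInter fun r => hImono (le_of_lt r.2))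
          refine Set.mem_Iic.2 (le_of_forall_gt_imp_ge_of_dense fun y hy => ?_)
          obtain ⟨r, hr1, hr2⟩ := exists_rat_btwn (show (q : ℝ) < y from hy)
          have := Set.mem_iInter.1 hx ⟨r, by exact_mod_cast hr1⟩
          exact (show x ≤ r from this).trans hr2.le
        rw [hf_int, ← h3, h2]
        refine le_iInf fun r => ?_
        rw [← hf_int r]
        exact lintegral_mono fun ω => iInf_le (fun r : Set.Ioi q => f r ω) r
    filter_upwards [h1] with ω hω using hω.symm
  let F : Ω → ℚ → ℝ := fun ω q => (f q ω).toReal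
  have hF : Measurable F := measurable_pi_iff.2 fun q => (hfm q).ennreal_toReal
  have hpt : ∀ᵐ ω ∂m₀, IsRatStieltjesPoint F ω := by
    filter_upwards [hf_mono, hf_one, hf_top, hf_bot, hf_right] with ω h1 h2 h3 h4 h5
    have hne : ∀ q, f q ω ≠ ⊤ := fun q => ((h2 q).trans_lt ENNReal.one_lt_top).ne
    refine ⟨fun q r hqr => ENNReal.toReal_mono (hne r) (h1 hqr), ?_, ?_, fun q => ?_⟩
    · have := tendsto_atTop_iSup h1
      rw [h3] at this
      exact (ENNReal.tendsto_toReal ENNReal.one_ne_top).comp this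
    · have := tendsto_atBot_iInf h1
      rw [h4] at this
      exact (ENNReal.tendsto_toReal ENNReal.zero_ne_top).comp this
    · change ⨅ r : Set.Ioi q, (f r ω).toReal = (f q ω).toReal
      rw [← h5 q, ENNReal.toReal_iInf fun r : Set.Ioi q => hne r]
  let κ : Kernel Ω ℝ :=
    ⟨fun ω => (stieltjesOfMeasurableRat F hF ω).measure,
      measurable_measure_stieltjesOfMeasurableRat hF⟩
  have hκ : IsMarkovKernel κ := ⟨fun ω => instIsProbabilityMeasure_stieltjesOfMeasurableRat hF ω⟩
  have hμ : IsFiniteMeasure (m₀ ⊗ₘ κ) := inferInstance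
  refine ⟨m₀ ⊗ₘ κ, hμ, fun C D hC hD => ?_⟩
  have hrat : ∀ q, (m₀ ⊗ₘ κ) (C ×ˢ I q) = m (I q) C := fun q => by
    rw [Measure.compProd_apply_prod hC (hI q), ← hset q C hC]
    refine setLIntegral_congr_fun_ae hC ?_
    filter_upwards [hpt, hf_one] with ω h1 h2 _
    change (stieltjesOfMeasurableRat F hF ω).measure (Set.Iic (q : ℝ)) = f q ω
    rw [measure_stieltjesOfMeasurableRat_Iic, stieltjesOfMeasurableRat_eq,
      toRatCDF_of_isRatStieltjesPoint h1]
    exact ENNReal.ofReal_toReal ((h2 q).trans_lt ENNReal.one_lt_top).ne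
  -- For fixed `C` both sides are finite measures in `D` which agree on rational half-lines and have
  -- equal mass.
  let ν : Measure ℝ := ((m₀ ⊗ₘ κ).restrict (C ×ˢ Set.univ)).map Prod.snd
  have hν : ∀ D, MeasurableSet D → ν D = (m₀ ⊗ₘ κ) (C ×ˢ D) := fun D hD => by
    rw [Measure.map_apply measurable_snd hD, Measure.restrict_apply (measurable_snd hD)]
    congr 1
    ext ⟨a, b⟩
    simp [and_comm]
  have hnC : IsFiniteMeasure (n C) := ⟨by
    rw [← h _ _ hC .univ]; exact measure_lt_top _ _⟩
  have huniv : ν Set.univ = n C Set.univ := by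
    rw [← Real.iUnion_Iic_rat, hImono.measure_iUnion, hImono.measure_iUnion]
    exact iSup_congr fun q => by rw [hν _ (hI q), hrat, h C _ hC (hI q)]
  have hνn : ν = n C := by
    refine ext_of_generate_finite _ Real.borel_eq_generateFrom_Iic_rat Real.isPiSystem_Iic_rat ?_
      huniv
    intro D hD
    obtain ⟨q, rfl⟩ := by simpa using hD
    rw [hν _ (hI q), hrat, h C _ hC (hI q)]
  rw [← hν D hD, hνn, h C D hC hD]

/-! ### Lifting square integrable functions -/

section Lift

variable {Ω Ω₁ : Type*} [MeasurableSpace Ω] [MeasurableSpace Ω₁]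

/-- The class of a simple function in `L²`. -/
def simpleToL2 (P : Measure Ω) [IsFiniteMeasure P] : SimpleFunc Ω ℝ →ₗ[ℝ] Lp ℝ 2 P where
  toFun s := (s.memLp_of_isFiniteMeasure 2 P).toLp s
  map_add' _ _ := rfl
  map_smul' _ _ := rfl

theorem norm_simpleToL2_sq (P : Measure Ω) [IsFiniteMeasure P] (s : SimpleFunc Ω ℝ) :
    ‖simpleToL2 P s‖ ^ 2 = ∫ ω, s ω ^ 2 ∂P := by
  rw [← real_inner_self_eq_norm_sq, L2.inner_def]
  refine integral_congr_ae ?_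
  filter_upwards [(s.memLp_of_isFiniteMeasure 2 P).coeFn_toLp] with ω hω
  change ⟪(s.memLp_of_isFiniteMeasure 2 P).toLp s ω, (s.memLp_of_isFiniteMeasure 2 P).toLp s ω⟫_ℝ
    = _
  rw [hω, real_inner_self_eq_norm_sq, Real.norm_eq_abs, sq_abs]

theorem simpleToL2_piecewise (P : Measure Ω) [IsFiniteMeasure P] {C : Set Ω}
    (hC : MeasurableSet C) :
    simpleToL2 P (SimpleFunc.piecewise C hC (SimpleFunc.const Ω 1) (SimpleFunc.const Ω 0))
      = indicatorConstLp 2 hC (measure_ne_top _ _) 1 := by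
  rw [indicatorConstLp]
  congr 1

/-- Pulling back a simple function along a map and restricting it to a set. -/
def simplePullback {π : Ω₁ → Ω} (hπ : Measurable π) {G : Set Ω₁} (hG : MeasurableSet G) :
    SimpleFunc Ω ℝ →ₗ[ℝ] SimpleFunc Ω₁ ℝ where
  toFun s := SimpleFunc.piecewise G hG (s.comp π hπ) (SimpleFunc.const Ω₁ 0)
  map_add' s t := by
    ext ω
    by_cases h : ω ∈ G <;> simp [h]
  map_smul' c s := by
    ext ω
    by_cases h : ω ∈ G <;> simp [h]

theorem simplePullback_apply {π : Ω₁ → Ω} (hπ : Measurable π) {G : Set Ω₁} (hG : MeasurableSet G)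
    (s : SimpleFunc Ω ℝ) (ω : Ω₁) :
    simplePullback hπ hG s ω = G.indicator (fun ω => s (π ω)) ω := by
  classical
  change SimpleFunc.piecewise G hG (s.comp π hπ) (SimpleFunc.const Ω₁ 0) ω = _
  by_cases h : ω ∈ G <;> simp [h]

/-- The lift is `s ↦ c · 1_G · (s ∘ π)`. Its squared norm is `c² ∫_G (s ∘ π)² dP = c ∫ s² dP'`. A
marginal has `c = 1`; a branch of a fair coin has `c = 2`. -/
theorem exists_lift_L2 {P : Measure Ω₁} [IsFiniteMeasure P] {P' : Measure Ω} [IsFiniteMeasure P']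
    {π : Ω₁ → Ω} (hπ : Measurable π) {G : Set Ω₁} (hG : MeasurableSet G) {c : ℝ} (hc : 0 ≤ c)
    (hP : ∀ C, MeasurableSet C → c * P.real (G ∩ π ⁻¹' C) = P'.real C) :
    ∃ Φ : Lp ℝ 2 P' →L[ℝ] Lp ℝ 2 P, ‖Φ‖ ≤ √c ∧ ∀ C (hC : MeasurableSet C),
      Φ (indicatorConstLp 2 hC (measure_ne_top _ _) 1)
        = c • indicatorConstLp 2 (hG.inter (hπ hC)) (measure_ne_top _ _) 1 := by
  have hP' : P' = ENNReal.ofReal c • (P.restrict G).map π := by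
    ext C hC
    rw [Measure.smul_apply, Measure.map_apply hπ hC, Measure.restrict_apply (hπ hC), smul_eq_mul,
      ← ofReal_measureReal (μ := P'), ← hP C hC, ENNReal.ofReal_mul hc, ofReal_measureReal,
      Set.inter_comm]
  obtain ⟨Φ, hΦ, hn, -⟩ := exists_factor_of_norm_le (simpleToL2 P')
    (c • (simpleToL2 P ∘ₗ simplePullback hπ hG)) (Real.sqrt_nonneg c) fun s => by
      refine le_of_sq_le_sq (le_of_eq ?_) (by positivity)
      have h1 : ∫ ω, s ω ^ 2 ∂P' = c * ∫ ω in G, s (π ω) ^ 2 ∂P := by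
        rw [hP', integral_smul_measure, ENNReal.toReal_ofReal hc, smul_eq_mul,
          integral_map hπ.aemeasurable (s.measurable.pow_const 2).aestronglyMeasurable]
      have h2 : ∫ ω, simplePullback hπ hG s ω ^ 2 ∂P = ∫ ω in G, s (π ω) ^ 2 ∂P := by
        rw [← integral_indicator hG]
        refine integral_congr_ae (Filter.Eventually.of_forall fun ω => ?_)
        simp only [simplePullback_apply]
        by_cases h : ω ∈ G <;> simp [h]
      rw [LinearMap.smul_apply, LinearMap.comp_apply, norm_smul, mul_pow, mul_pow,
        norm_simpleToL2_sq, norm_simpleToL2_sq, h1, h2, Real.sq_sqrt hc, Real.norm_eq_abs, sq_abs]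
      ring
  refine ⟨Φ, hn, fun C hC => ?_⟩
  rw [← simpleToL2_piecewise, hΦ, LinearMap.smul_apply, LinearMap.comp_apply,
    ← simpleToL2_piecewise]
  congr 2
  ext ω
  classical
  rw [simplePullback_apply]
  by_cases h : ω ∈ G <;> by_cases h' : π ω ∈ C <;> simp [h, h']

end Lift

namespace QM

variable {H : Type*} [NormedAddCommGroup H] [InnerProductSpace ℂ H] [CompleteSpace H]

open HSSpace Filter Topology

variable {Ω Ω₁ : Type*} [MeasurableSpace Ω] [MeasurableSpace Ω₁] {M : Set Ω₁ → H →L[ℂ] H}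
  {N : Set Ω → H →L[ℂ] H} {ρ σ : H →L[ℂ] H}

/-- The integrals of a POVM are integrals of every POVM of which it is a conditional marginal. -/
theorem IsPOVM.exists_lift (hM : IsPOVM M) (hN : IsPOVM N) (hρ : 0 ≤ ρ) (hρ1 : IsTraceClass ρ)
    (hσ : 0 ≤ σ) (hσ1 : IsTraceClass σ) {π : Ω₁ → Ω} (hπ : Measurable π) {G : Set Ω₁}
    (hG : MeasurableSet G) {c : ℝ} (hc : 0 ≤ c) (Γ : HSSpace H →L[ℝ] HSSpace H)
    (hlaw : ∀ C, MeasurableSet C → (c : ℂ) * trace (ρ * M (G ∩ π ⁻¹' C)) = trace (σ * N C))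
    (hΓ : ∀ C, MeasurableSet C → Γ (hs (N C * CFC.sqrt σ))
      = (c : ℂ) • hs (M (G ∩ π ⁻¹' C) * CFC.sqrt ρ)) (f : Lp ℝ 2 (law N σ)) :
    ∃ F : Lp ℝ 2 (law M ρ), realIntegralCLM M ρ F = Γ (realIntegralCLM N σ f)
      ∧ ‖F‖ ≤ √c * ‖f‖ := by
  have hP : ∀ C, MeasurableSet C → c * (law M ρ).real (G ∩ π ⁻¹' C) = (law N σ).real C :=
    fun C hC => by
      have h := hlaw C hC
      rw [trace_mul_eq_inner_sqrt hρ hρ1, trace_mul_eq_inner_sqrt hσ hσ1,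
        ← hM.law_real hρ hρ1 (hG.inter (hπ hC)), ← hN.law_real hσ hσ1 hC] at h
      exact_mod_cast h
  obtain ⟨Φ, hΦ, hΦi⟩ := exists_lift_L2 hπ hG hc hP
  refine ⟨Φ f, ?_, Φ.le_of_opNorm_le hΦ f⟩
  have : realIntegralCLM M ρ ∘L Φ = Γ ∘L realIntegralCLM N σ := by
    refine clm_ext_indicator fun C hC => ?_
    rw [ContinuousLinearMap.comp_apply, ContinuousLinearMap.comp_apply, hΦi C hC, map_smul,
      hM.realIntegralCLM_indicator hρ hρ1, hN.realIntegralCLM_indicator hσ hσ1, hΓ C hC]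
    rfl
  exact DFunLike.congr_fun this f

/-! ### Measuring an observable after an instrument -/

namespace CPInstrument

variable (𝓘 : CPInstrument H Ω) {E : Set ℝ → H →L[ℂ] H}

theorem exists_measure_dual {X : H →L[ℂ] H} (hX : 0 ≤ X) (u : H) :
    ∃ μ : Measure Ω, ∀ C, MeasurableSet C → μ C = ENNReal.ofReal (⟪u, 𝓘.dual C X u⟫_ℂ).re := by
  refine ⟨Measure.ofMeasurable (fun C _ => ENNReal.ofReal (⟪u, 𝓘.dual C X u⟫_ℂ).re) ?_
    (fun f hf hd => ?_), fun C hC => Measure.ofMeasurable_apply C hC⟩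
  · have h := 𝓘.hasSum_iUnion_dual (f := fun _ => ∅) (fun _ => .empty)
      (fun _ _ _ => by simp [Function.onFun]) X u
    rw [(summable_const_iff _).1 h.summable]
    simp
  · have h := Complex.hasSum_re (𝓘.hasSum_iUnion_dual hf hd X u)
    rw [← h.tsum_eq, ENNReal.ofReal_tsum_of_nonneg _ h.summable]
    exact fun k => (Complex.nonneg_iff.1
      (inner_apply_self_nonneg (𝓘.dual_nonneg (hf k) hX) u)).1

/-- The joint measurement of the outcome of an instrument and a subsequent POVM. -/
theorem exists_joint_povm (hE : IsPOVM E) : ∃ M : Set (Ω × ℝ) → H →L[ℂ] H, IsPOVM M ∧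
    ∀ C D, MeasurableSet C → MeasurableSet D → M (C ×ˢ D) = 𝓘.dual C (E D) := by
  -- Guarding by measurability lets a measure be chosen for every set `D`; the zero measure fills
  -- the irrelevant cases.
  have hex : ∀ (D : Set ℝ) (u : H), ∃ μ : Measure Ω, MeasurableSet D → ∀ C, MeasurableSet C →
      μ C = ENNReal.ofReal (⟪u, 𝓘.dual C (E D) u⟫_ℂ).re := fun D u => by
    by_cases hD : MeasurableSet D
    · obtain ⟨μ, hμ⟩ := 𝓘.exists_measure_dual (hE.nonneg D hD) u
      exact ⟨μ, fun _ => hμ⟩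
    · exact ⟨0, fun h => absurd h hD⟩
  choose m hm using hex
  have hk : ∀ u : H, 0 ≤ ketbra u u := ketbra_self_nonneg
  have hn : ∀ u C D, MeasurableSet C → MeasurableSet D →
      m D u C = law E (𝓘.toFun C (ketbra u u)) D := fun u C D hC hD => by
    rw [hE.law_apply (𝓘.nonneg hC (hk u) (isTraceClass_ketbra u u))
      (𝓘.isTraceClass C hC _ (isTraceClass_ketbra u u)) hD, hm D u hD C hC, 𝓘.inner_dual hC]
  have hfin : ∀ u, IsFiniteMeasure (m Set.univ u) := fun u => ⟨by
    rw [hm _ u .univ _ .univ]; exact ENNReal.ofReal_lt_top⟩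
  choose μ hμfin hμ using fun u => exists_measure_prod_of_bimeasure (fun D => m D u)
    (fun C => law E (𝓘.toFun C (ketbra u u))) (hfin u) (fun C D hC hD => hn u C D hC hD)
  have hrect : ∀ C D, MeasurableSet C → MeasurableSet D → ∀ u,
      ⟪u, 𝓘.dual C (E D) u⟫_ℂ = ((μ u).real (C ×ˢ D) : ℂ) := fun C D hC hD u => by
    obtain ⟨h0, h1⟩ := Complex.nonneg_iff.1
      (inner_apply_self_nonneg (𝓘.dual_nonneg hC (hE.nonneg D hD)) u)
    rw [measureReal_def, hμ u C D hC hD, hm D u hD C hC, ENNReal.toReal_ofReal h0]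
    exact Complex.ext (by simp) (by simp [← h1])
  obtain ⟨M, hM, hMμ⟩ := exists_povm μ (fun u => by
      rw [← Set.univ_prod_univ, hμ u _ _ .univ .univ, hm _ u .univ _ .univ, hE.univ,
        𝓘.dual_univ_one, one_apply_eq_self, inner_self_eq_ofReal_norm_sq, Complex.ofReal_re])
    _ generateFrom_prod.symm isPiSystem_prod (by
      rintro _ ⟨C, hC, D, hD, rfl⟩
      exact ⟨𝓘.dual C (E D), hrect C D hC hD⟩)
  refine ⟨M, hM, fun C D hC hD => ext_of_inner_self fun u => ?_⟩
  rw [hMμ _ (hC.prod hD), hrect C D hC hD]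

end CPInstrument

/-! ### Mixtures of two measurements -/

/-- Measuring `E` or `F` according to a fair coin, which is recorded in the second component. -/
def mixture (E F : Set ℝ → H →L[ℂ] H) (S : Set (ℝ × ℝ)) : H →L[ℂ] H :=
  (2⁻¹ : ℂ) • (E ((fun y => (y, 0)) ⁻¹' S) + F ((fun y => (y, 1)) ⁻¹' S))

variable {E F : Set ℝ → H →L[ℂ] H}

theorem isPOVM_mixture (hE : IsPOVM E) (hF : IsPOVM F) : IsPOVM (mixture E F) := by
  have h0 : Measurable fun y : ℝ => (y, (0 : ℝ)) := by fun_prop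
  have h1 : Measurable fun y : ℝ => (y, (1 : ℝ)) := by fun_prop
  refine ⟨fun S hS => ?_, ?_, fun f hf hd x y => ?_⟩
  · refine nonneg_of_inner fun x => ?_
    rw [mixture, smul_apply, add_apply, inner_smul_right, inner_add_right]
    exact mul_nonneg (by simp) (add_nonneg (inner_apply_self_nonneg (hE.nonneg _ (h0 hS)) x)
      (inner_apply_self_nonneg (hF.nonneg _ (h1 hS)) x))
  · rw [mixture, Set.preimage_univ, Set.preimage_univ, hE.univ, hF.univ, ← two_smul ℂ, smul_smul]
    simp
  · simp only [mixture, smul_apply, add_apply, inner_smul_right, inner_add_right,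
      Set.preimage_iUnion]
    exact ((hE.iUnion _ (fun k => h0 (hf k)) (fun i j hij => (hd hij).preimage _) x y).add
      (hF.iUnion _ (fun k => h1 (hf k)) (fun i j hij => (hd hij).preimage _) x y)).mul_left _

theorem mixture_inter_left (hF : IsPOVM F) (C : Set ℝ) :
    mixture E F ({p | p.2 = 0} ∩ Prod.fst ⁻¹' C) = (2⁻¹ : ℂ) • E C := by
  have h1 : (fun y : ℝ => (y, (0 : ℝ))) ⁻¹' ({p | p.2 = 0} ∩ Prod.fst ⁻¹' C) = C := by
    ext y; simp
  have h2 : (fun y : ℝ => (y, (1 : ℝ))) ⁻¹' ({p | p.2 = 0} ∩ Prod.fst ⁻¹' C) = ∅ := by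
    ext y; simp
  rw [mixture, h1, h2, hF.empty, add_zero]

theorem mixture_inter_right (hE : IsPOVM E) (C : Set ℝ) :
    mixture E F ({p | p.2 = 1} ∩ Prod.fst ⁻¹' C) = (2⁻¹ : ℂ) • F C := by
  have h1 : (fun y : ℝ => (y, (0 : ℝ))) ⁻¹' ({p | p.2 = 1} ∩ Prod.fst ⁻¹' C) = ∅ := by
    ext y; simp
  have h2 : (fun y : ℝ => (y, (1 : ℝ))) ⁻¹' ({p | p.2 = 1} ∩ Prod.fst ⁻¹' C) = C := by
    ext y; simp
  rw [mixture, h1, h2, hE.empty, zero_add]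

end QM

namespace QM

variable {H : Type*} [NormedAddCommGroup H] [InnerProductSpace ℂ H] [CompleteSpace H]

open HSSpace Filter Topology

/-! ### The error-disturbance inequality -/

variable {ρ : H →L[ℂ] H} {A B : H →ₗ.[ℂ] H}

/-- The spectral measure of an observable of finite second moment, with its identity function. -/
theorem IsFaithful.exists_povm_of_hasSecondMoment (hρ : IsFaithful ρ) (hA : IsSelfAdjoint A)
    (hA2 : HasSecondMoment ρ A) :
    ∃ E : Set ℝ → H →L[ℂ] H, IsPOVM E ∧ ∃ f : Lp ℝ 2 (law E ρ),
      realIntegralCLM E ρ f = hs (prod A (CFC.sqrt ρ)) := by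
  obtain ⟨E, hE, f, hf, -⟩ := exists_povm_realIntegralCLM_eq hρ.nonneg hρ.isTraceClass hA2.isHS
    (hA2.isSelfAdjoint hA) fun x hx => by
      have : x = 0 := by
        by_contra h
        have h1 := hρ.pos x h
        rw [hx, inner_zero_right] at h1
        exact lt_irrefl _ h1
      rw [this, map_zero]
  exact ⟨E, hE, f, hf⟩

theorem IsFaithful.exists_povmError_ne_top (hρ : IsFaithful ρ) (hA : IsSelfAdjoint A)
    (hB : IsSelfAdjoint B) (hA2 : HasSecondMoment ρ A) (hB2 : HasSecondMoment ρ B) :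
    ∃ M : Set (ℝ × ℝ) → H →L[ℂ] H, IsPOVM M ∧ povmError A ρ M ≠ ⊤ ∧ povmError B ρ M ≠ ⊤ := by
  obtain ⟨E, hE, f, hf⟩ := hρ.exists_povm_of_hasSecondMoment hA hA2
  obtain ⟨F, hF, g, hg⟩ := hρ.exists_povm_of_hasSecondMoment hB hB2
  have hM := isPOVM_mixture hE hF
  have h2 : ((2 : ℝ) : ℂ) * 2⁻¹ = 1 := by norm_num
  have hlift : ∀ (N : Set ℝ → H →L[ℂ] H), IsPOVM N → ∀ z : ℝ,
      (∀ C, mixture E F ({p | p.2 = z} ∩ Prod.fst ⁻¹' C) = (2⁻¹ : ℂ) • N C) →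
      ∀ k : Lp ℝ 2 (law N ρ), ∃ K : Lp ℝ 2 (law (mixture E F) ρ),
        realIntegralCLM (mixture E F) ρ K = realIntegralCLM N ρ k := fun N hN z hz k => by
    obtain ⟨K, hK, -⟩ := hM.exists_lift hN hρ.nonneg hρ.isTraceClass hρ.nonneg hρ.isTraceClass
      measurable_fst (G := {p : ℝ × ℝ | p.2 = z}) (measurable_snd (measurableSet_singleton z))
      zero_le_two (ContinuousLinearMap.id ℝ _)
      (fun C _ => by rw [hz, mul_smul_comm, trace_smul, ← mul_assoc, h2, one_mul])
      (fun C _ => by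
        rw [hz, smul_mul_assoc, hs_smul _ (hρ.isHS_sqrt.mul_left _), smul_smul, h2, one_smul]
        rfl) k
    exact ⟨K, hK⟩
  obtain ⟨K, hK⟩ := hlift E hE 0 (mixture_inter_left hF) f
  obtain ⟨L, hL⟩ := hlift F hF 1 (mixture_inter_right hE) g
  exact ⟨mixture E F, hM, hρ.povmError_ne_top hM hA hA2 K fun t _ => by rw [hK, hf],
    hρ.povmError_ne_top hM hB hB2 L fun t _ => by rw [hL, hg]⟩

/-- A finite error is attained by an unbiased estimator. -/
theorem IsFaithful.exists_estimator {Ω : Type*} [MeasurableSpace Ω] {M : Set Ω → H →L[ℂ] H}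
    (hρ : IsFaithful ρ) (hM : IsPOVM M) (hA : IsSelfAdjoint A) (hA2 : HasSecondMoment ρ A)
    (hfin : povmError A ρ M ≠ ⊤) :
    ∃ f : Lp ℝ 2 (law M ρ), ((‖f‖ ^ 2 - variance ρ A : ℝ) : EReal) ≤ povmError A ρ M ∧
      ∀ t ∈ sldSpace ρ {A}, ⟪realIntegralCLM M ρ f, t⟫_ℝ = ⟪hs (prod A (CFC.sqrt ρ)), t⟫_ℝ := by
  have hD := hρ.directions_eq {A}
  simp only [Set.mem_singleton_iff, forall_eq] at hD
  obtain ⟨f, -, hf, hft⟩ := exists_of_pinvForm_ne_top (α := gradExpect A) (q := fisherInfo M ρ)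
    (sldSpace ρ {A}) (ContinuousLinearMap.adjoint (realIntegralCLM M ρ)).toLinearMap _ hD
    (fun t _ => by
      rw [hM.fisherInfo_sldDir hρ.nonneg hρ.isTraceClass (isHS_op t), hs_op]; rfl)
    (innerSL ℝ (hs (prod A (CFC.sqrt ρ)))).toLinearMap
    (fun t ht => by
      rw [hρ.gradExpect_sldDir hA hA2.isProd hA2.isHS (isHS_op t) (ht.2.2 A rfl), hs_op]; rfl)
    (fun h => hfin (by rw [povmError, h, EReal.top_sub_coe]))
  refine ⟨f, ?_, fun t ht => ?_⟩
  · rw [EReal.coe_sub]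
    exact EReal.sub_le_sub hf le_rfl
  · rw [← ContinuousLinearMap.adjoint_inner_right]
    exact hft t ht

/-- A finite disturbance is attained by an observable of the final state. -/
theorem CPInstrument.exists_estimator {Ω : Type*} [MeasurableSpace Ω] (𝓘 : CPInstrument H Ω)
    (hρ : IsFaithful ρ) (hB : IsSelfAdjoint B) (hB2 : HasSecondMoment ρ B)
    {Γ : HSSpace H →L[ℝ] HSSpace H}
    (hΓ : ∀ t, sldInfo (𝓘.toFun Set.univ ρ) (𝓘.toFun Set.univ (sldDir ρ (op t)))
      ≤ ENNReal.ofReal (‖ContinuousLinearMap.adjoint Γ t‖ ^ 2))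
    (hfin : 𝓘.disturbance B ρ ≠ ⊤) :
    ∃ y ∈ closure (Set.range (ContinuousLinearMap.adjoint Γ)),
      ((‖y‖ ^ 2 - variance ρ B : ℝ) : EReal) ≤ 𝓘.disturbance B ρ ∧
      ∀ t ∈ sldSpace ρ {B}, ⟪Γ y, t⟫_ℝ = ⟪hs (prod B (CFC.sqrt ρ)), t⟫_ℝ := by
  have hD := hρ.directions_eq {B}
  simp only [Set.mem_singleton_iff, forall_eq] at hD
  obtain ⟨y, hy, hyn, hyt⟩ := exists_of_pinvForm_ne_top (α := gradExpect B)
    (q := fun φ => sldInfo (𝓘.toFun Set.univ ρ) (𝓘.toFun Set.univ φ))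
    -- An upper bound for the information suffices: a larger quadratic form gives a smaller
    -- supremum, so the form built from `Γ*` is also finite.
    (sldSpace ρ {B}) (ContinuousLinearMap.adjoint Γ).toLinearMap _ hD (fun t _ => hΓ t)
    (innerSL ℝ (hs (prod B (CFC.sqrt ρ)))).toLinearMap
    (fun t ht => by
      rw [hρ.gradExpect_sldDir hB hB2.isProd hB2.isHS (isHS_op t) (ht.2.2 B rfl), hs_op]; rfl)
    (fun h => hfin (by rw [disturbance, channelDisturbance, h, EReal.top_sub_coe]))
  refine ⟨y, closure_mono ?_ hy, ?_, fun t ht => ?_⟩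
  · rintro _ ⟨t, -, rfl⟩
    exact ⟨t, rfl⟩
  · rw [EReal.coe_sub]
    exact EReal.sub_le_sub hyn le_rfl
  · rw [← ContinuousLinearMap.adjoint_inner_right]
    exact hyt t ht

theorem mul_le_extMul {x y : EReal} {a b : ℝ} (ha : 0 ≤ a) (hb : 0 ≤ b) (hx : (a : EReal) ≤ x)
    (hy : (b : EReal) ≤ y) : ((a * b : ℝ) : EReal) ≤ extMul x y := by
  rw [extMul]
  split_ifs with h
  · exact le_top
  · rw [EReal.coe_mul]
    exact mul_le_mul hx hy (EReal.coe_nonneg.2 hb) ((EReal.coe_nonneg.2 ha).trans hx)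

theorem IsFaithful.error_disturbance (hρ : IsFaithful ρ) (hA : IsSelfAdjoint A)
    (hB : IsSelfAdjoint B) (hA2 : HasSecondMoment ρ A) (hB2 : HasSecondMoment ρ B)
    (𝓘 : CPInstrument H ℝ) :
    ∃ M : Set (ℝ × ℝ) → H →L[ℂ] H, IsPOVM M ∧ povmError A ρ M ≠ ⊤ ∧ povmError B ρ M ≠ ⊤ ∧
      ((remainder A B ρ M ^ 2 + 1 / 4 * ‖expectComm ρ A B‖ ^ 2 : ℝ) : EReal)
        ≤ extMul (𝓘.error A ρ) (𝓘.disturbance B ρ) := by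
  by_cases htop : 𝓘.error A ρ = ⊤ ∨ 𝓘.disturbance B ρ = ⊤
  · obtain ⟨M, hM, h1, h2⟩ := hρ.exists_povmError_ne_top hA hB hA2 hB2
    refine ⟨M, hM, h1, h2, ?_⟩
    rw [extMul, if_pos htop]
    exact le_top
  push Not at htop
  obtain ⟨f, hf, hft⟩ := hρ.exists_estimator 𝓘.isPOVM_povm hA hA2 htop.1
  obtain ⟨Γ, hΓ, hΓsld, hΓcl⟩ := 𝓘.exists_transfer .univ hρ
  obtain ⟨y, hy, hyn, hyt⟩ := 𝓘.exists_estimator hρ hB hB2 hΓsld htop.2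
  set σ := 𝓘.toFun Set.univ ρ with hσ
  have hσ0 : 0 ≤ σ := 𝓘.nonneg .univ hρ.nonneg hρ.isTraceClass
  have hσ1 : IsTraceClass σ := 𝓘.isTraceClass _ .univ ρ hρ.isTraceClass
  -- `y` is an optimal symmetric estimator in the final state; `E` measures it there without
  -- increasing its second moment.
  obtain ⟨E, hE, e, he, hen⟩ := exists_povm_realIntegralCLM_eq hσ0 hσ1 (isHS_op y) (hΓcl y hy).1
    (hΓcl y hy).2
  rw [hs_op] at he hen
  obtain ⟨M, hM, hMrect⟩ := 𝓘.exists_joint_povm hE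
  have hfst : ∀ C, MeasurableSet C → M (Set.univ ∩ Prod.fst ⁻¹' C) = 𝓘.povm C := fun C hC => by
    rw [Set.univ_inter, ← Set.prod_univ, hMrect C _ hC .univ, hE.univ, CPInstrument.povm]
  have hsnd : ∀ D, MeasurableSet D → M (Set.univ ∩ Prod.snd ⁻¹' D) = 𝓘.dual Set.univ (E D) :=
    fun D hD => by rw [Set.univ_inter, ← Set.univ_prod, hMrect _ D .univ hD]
  obtain ⟨F, hF, hFn⟩ := hM.exists_lift 𝓘.isPOVM_povm hρ.nonneg hρ.isTraceClass hρ.nonneg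
    hρ.isTraceClass measurable_fst .univ zero_le_one (ContinuousLinearMap.id ℝ _)
    (fun C hC => by rw [hfst C hC, Complex.ofReal_one, one_mul])
    (fun C hC => by rw [hfst C hC, Complex.ofReal_one, one_smul]; rfl) f
  -- The second marginal of `M` is `𝓘(ℝ)*(E)`. Hence integrating against `M` in the state `ρ` is `Γ`
  -- applied to integrating against `E` in the state `σ`, which yields `Γ y`.
  obtain ⟨K, hK, hKn⟩ := hM.exists_lift hE hρ.nonneg hρ.isTraceClass hσ0 hσ1 measurable_snd .univ
    zero_le_one Γ
    (fun D hD => by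
      rw [hsnd D hD, Complex.ofReal_one, one_mul, 𝓘.trace_mul_dual .univ _ hρ.isTraceClass])
    (fun D hD => by
      rw [hsnd D hD, Complex.ofReal_one, one_smul, hΓ _ (IsSelfAdjoint.of_nonneg (hE.nonneg D hD))])
    e
  rw [Real.sqrt_one, one_mul] at hFn hKn
  rw [hen] at hKn
  rw [he] at hK
  have hFt : ∀ t ∈ sldSpace ρ {A}, ⟪realIntegralCLM M ρ F, t⟫_ℝ
      = ⟪hs (prod A (CFC.sqrt ρ)), t⟫_ℝ := fun t ht => by rw [hF]; exact hft t ht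
  have hKt : ∀ t ∈ sldSpace ρ {B}, ⟪realIntegralCLM M ρ K, t⟫_ℝ
      = ⟪hs (prod B (CFC.sqrt ρ)), t⟫_ℝ := fun t ht => by rw [hK]; exact hyt t ht
  refine ⟨M, hM, hρ.povmError_ne_top hM hA hA2 F hFt, hρ.povmError_ne_top hM hB hB2 K hKt, ?_⟩
  -- The remainder uses only directions in which both expectations are finite; unbiasedness
  -- restricts to that smaller space.
  obtain ⟨h1, h2, h3⟩ := hρ.remainder_sq_add_le hM hA hB hA2 hB2 F K
    (fun t ht => hFt t ⟨ht.1, ht.2.1, fun X hX => ht.2.2 X (Or.inl hX)⟩)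
    (fun t ht => hKt t ⟨ht.1, ht.2.1, fun X hX => ht.2.2 X (Or.inr hX)⟩)
  have hF2 : ‖F‖ ^ 2 ≤ ‖f‖ ^ 2 := pow_le_pow_left₀ (norm_nonneg _) hFn 2
  have hK2 : ‖K‖ ^ 2 ≤ ‖y‖ ^ 2 := pow_le_pow_left₀ (norm_nonneg _) hKn 2
  refine (EReal.coe_le_coe_iff.2 h3).trans (mul_le_extMul (sub_nonneg.2 h1) (sub_nonneg.2 h2)
    (le_trans ?_ hf) (le_trans ?_ hyn))
  · exact EReal.coe_le_coe_iff.2 (by linarith)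
  · exact EReal.coe_le_coe_iff.2 (by linarith)

end QM

end

theorem mainTheorem1 {H : Type*} [NormedAddCommGroup H] [InnerProductSpace ℂ H] [CompleteSpace H]
    (ρ₀ θ : H →L[ℂ] H) (hρ₀ : QM.IsDensity ρ₀) (hθ : θ ∈ QM.parameterSet ρ₀)
    (A B : H →ₗ.[ℂ] H) (hA : IsSelfAdjoint A) (hB : IsSelfAdjoint B)
    (hA2 : QM.HasSecondMoment (ρ₀ + θ) A) (hB2 : QM.HasSecondMoment (ρ₀ + θ) B)
    (𝓘 : QM.CPInstrument H ℝ) :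
    ∃ M : Set (ℝ × ℝ) → H →L[ℂ] H, QM.IsPOVM M ∧
      QM.povmError A (ρ₀ + θ) M ≠ ⊤ ∧ QM.povmError B (ρ₀ + θ) M ≠ ⊤ ∧
      ((QM.remainder A B (ρ₀ + θ) M ^ 2 + 1 / 4 * ‖QM.expectComm (ρ₀ + θ) A B‖ ^ 2 : ℝ) : EReal)
        ≤ QM.extMul (𝓘.error A (ρ₀ + θ)) (𝓘.disturbance B (ρ₀ + θ)) := by
  exact (QM.isFaithful_of_mem_parameterSet hρ₀ hθ).error_disturbance hA hB hA2 hB2 𝓘
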